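/- **Setting.** Let $1\le k\le p$ and $m$ be integers and let $D_0\in\mathbb R^{m\times p}$ be a matrix with columns $d_0^1,\dots,d_0^p$ of unit Euclidean norm. Let $\mu_0=\max_{i\ne j}|\langle d_0^i,d_0^j\rangle|$ be its coherence ($0$ if $p=1$), $\|D_0\|_2$ its spectral norm, and $\delta_k(D_0)$ its restricted isometry constant, i.e. the smallest $\delta$ such that $(1-\delta)\|z\|_2^2\le\|D_0z\|_2^2\le(1+\delta)\|z\|_2^2$ for every $z\in\mathbb R^p$ supported on a set of $k$ indices. For $t>0$ put $$\mu(t)=\mu_0+3t,\quad Q_t=\frac1{\sqrt{1-k\mu(t)}},\quad C_t=\frac1{\sqrt{1-\delta_k(D_0)}-t},\quad \mathcal K=C_t\big(\|D_0\|_2\sqrt{k/p}+t\big).$$ *Signals.* A signal is $x=D_0\alpha_0+\varepsilon\in\mathbb R^m$. The support $J\subseteq\{1,\dots,p\}$ is random with $|J|=k$, $\Pr(j\in J)=\frac kp$ and $\Pr(i,j\in J)=\frac{k(k-1)}{p(p-1)}$ for $i\ne j$ (for example, a uniform draw without replacement). Given $J$, the entries of $\alpha_0$ in $J$ are i.i.d.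 copies of a real random variable $\alpha$, and the other entries are zero. The noise $\varepsilon$ is independent of $\alpha_0$ and has i.i.d. entries that are sub-Gaussian with parameter $\sigma\ge0$. A real random variable $Y$ is sub-Gaussian with parameter $c\ge 0$ if $\mathbb E e^{sY}\le e^{c^2s^2/2}$ for all $s\in\mathbb R$. Assume that $\alpha$ is sub-Gaussian, and let $\sigma_\alpha$ be its smallest parameter. Assume $\Pr(|\alpha|<\underline\alpha)=0$ for some $\underline\alpha>0$. If $k\ge2$, assume moreover that the signs are balanced, $\mathbb E[\operatorname{sign}(\alpha)]=0$. *Cost.* For $\lambda>0$ and signals $x^1,\dots,x^n$ let $$F_n(D)=\frac1n\sum_{i=1}^n\min_{a\in\mathbb R^p}\Big\{\tfrac12\|x^i-Da\|_2^2+\lambda\|a\|_1\Big\}.$$ Let $\mathcal W_{D_0}$ be the set of $W\in\mathbb R^{m\times p}$ whose columns $w^j$ satisfy $\|w^j\|_2=1$ and $\langle w^j,d_0^j\rangle=0$, let $\mathcal S^p$ be the unit Euclidean sphere of $\mathbb R^p$, and $$D(W,v,t)=D_0\,\mathrm{Diag}(\cos(v_jt))_j+W\,\mathrm{Diag}(\sin(v_jt))_j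 .$$ **Theorem.** Let $\mu_0<1/2$ and let $t>0$ be such that $$k\mu(t)<\tfrac12,\qquad \frac{3t}{2-Q_t^2}<\frac{4\underline\alpha}{9\sigma_\alpha}.$$ 1. There is $\sigma_0>0$ such that for every $\sigma\in[0,\sigma_0]$ there is $\lambda>0$ with $$\frac{3}{2-Q_t^2}\sqrt{t^2\sigma_\alpha^2+m\sigma^2}\le\lambda\le\tfrac49\underline\alpha.\qquad(*)$$ 2. For all $\sigma\ge0$ and $\lambda$ satisfying $(*)$, $$\gamma:=\frac{\lambda(2-Q_t^2)}{\sqrt5\,\sqrt{t^2\sigma_\alpha^2+m\sigma^2}}\ \ge\ \sqrt{2\log2}.$$ Moreover, if $n\ge2$, $n/\log n\ge mp$, and $x^1,\dots,x^n$ are independent signals drawn from the model above, then, except with probability at most $\big(\tfrac{mpn}9\big)^{-mp/2}+\exp(-4n\,e^{-\gamma^2})$, $$\begin{aligned}\inf_{W\in\mathcal W_{D_0},\,v\in\mathcal S^p}\big[F_n(D(W,v,t))-F_n(D_0)\big]\ \ge\ &(1-\mathcal K^2)\,\frac{\mathbb E[\alpha^2]}2\,\frac kp\,t^2\\&-Q_t^2\big(\tfrac{16}9Q_t^2+3\big)\,\mathbb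 E|\alpha|\;t\,\frac kp\,\|D_0\|_2\;k\mu(t)\,\lambda\\&-A\,\gamma^2e^{-\gamma^2}-B\sqrt{mp\,\tfrac{\log n}n},\end{aligned}$$ where $$A=367\,(t^2\sigma_\alpha^2+2m\sigma^2+2\lambda k\sigma_\alpha),\qquad B=3045\,(k\sigma_\alpha^2t+2m\sigma^2+2\lambda k\sigma_\alpha).$$ -/

import Mathlib

open MeasureTheory ProbabilityTheory Matrix

namespace SparseCoding

noncomputable section

/-- The spectral norm of a rectangular matrix: its operator norm for the Euclidean norms. -/
def opNorm {m p : ℕ} (A : Matrix (Fin m) (Fin p) ℝ) : ℝ :=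
  ‖LinearMap.toContinuousLinearMap (Matrix.toEuclideanLin A)‖

/-- The squared Euclidean norm. -/
def sqNorm {d : ℕ} (x : Fin d → ℝ) : ℝ := ∑ i, x i ^ 2

/-- A dictionary: a matrix all of whose columns (atoms) have unit Euclidean norm. -/
def IsDictionary {m p : ℕ} (D : Matrix (Fin m) (Fin p) ℝ) : Prop :=
  ∀ j, sqNorm (fun i => D i j) = 1

/-- The Lasso objective at the signal `x`, the dictionary `D` and the coefficients `α`. -/
def lassoObj {m p : ℕ} (lam : ℝ) (x : Fin m → ℝ) (D : Matrix (Fin m) (Fin p) ℝ)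
    (α : Fin p → ℝ) : ℝ :=
  1 / 2 * sqNorm (x - D *ᵥ α) + lam * ∑ j, |α j|

/-- The minimal value of the Lasso objective over all coefficient vectors. -/
def lassoVal {m p : ℕ} (lam : ℝ) (x : Fin m → ℝ) (D : Matrix (Fin m) (Fin p) ℝ) : ℝ :=
  ⨅ α : Fin p → ℝ, lassoObj lam x D α

/-- The sparse coding cost function of the `n` signals `X 0, …, X (n - 1)`. -/
def costF {m p n : ℕ} (lam : ℝ) (X : Fin n → Fin m → ℝ) (D : Matrix (Fin m) (Fin p) ℝ) : ℝ :=
  1 / (n : ℝ) * ∑ i, lassoVal lam (X i) D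

/-- The matrices whose columns have unit norm and are orthogonal to the corresponding atoms. -/
def directions {m p : ℕ} (D₀ : Matrix (Fin m) (Fin p) ℝ) : Set (Matrix (Fin m) (Fin p) ℝ) :=
  {W | (∀ j, ∑ i, W i j * D₀ i j = 0) ∧ ∀ j, ∑ i, W i j * W i j = 1}

/-- The unit Euclidean sphere of `ℝ^p`. -/
def unitSphere (p : ℕ) : Set (Fin p → ℝ) := {v | sqNorm v = 1}

/-- The curve of dictionaries `D₀ Diag(cos (t v)) + W Diag(sin (t v))`. -/
def curve {m p : ℕ} (D₀ W : Matrix (Fin m) (Fin p) ℝ) (v : Fin p → ℝ) (t : ℝ) :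
    Matrix (Fin m) (Fin p) ℝ :=
  D₀ * Matrix.diagonal (fun j => Real.cos (v j * t)) +
    W * Matrix.diagonal (fun j => Real.sin (v j * t))

/-- The increment of the cost function between `D₀` and the point at time `t` of a curve. -/
def deltaF {m p n : ℕ} (lam : ℝ) (X : Fin n → Fin m → ℝ) (D₀ W : Matrix (Fin m) (Fin p) ℝ)
    (v : Fin p → ℝ) (t : ℝ) : ℝ :=
  costF lam X (curve D₀ W v t) - costF lam X D₀

/-- The mutual coherence: the largest absolute inner product of two distinct columns
(zero when there is only one column). -/
def coherence {m p : ℕ} (D : Matrix (Fin m) (Fin p) ℝ) : ℝ :=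
  ⨆ q : {q : Fin p × Fin p // q.1 ≠ q.2}, |∑ i, D i q.1.1 * D i q.1.2|

/-- The upper bound `μ₀ + 3 t` on the coherence along the curves. -/
def coherenceAt {m p : ℕ} (D₀ : Matrix (Fin m) (Fin p) ℝ) (t : ℝ) : ℝ :=
  coherence D₀ + 3 * t

/-- The restricted isometry constant of order `k`: the smallest `δ` for which the restriction
of `D` to any `k` columns is an isometry up to factors `1 - δ` and `1 + δ`. -/
def ripConst {m p : ℕ} (D : Matrix (Fin m) (Fin p) ℝ) (k : ℕ) : ℝ :=
  sInf {δ : ℝ | ∀ J : Finset (Fin p), J.card = k → ∀ z : Fin p → ℝ, (∀ j, j ∉ J → z j = 0) →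
    (1 - δ) * sqNorm z ≤ sqNorm (D *ᵥ z) ∧ sqNorm (D *ᵥ z) ≤ (1 + δ) * sqNorm z}

/-- `Q_t = 1 / √(1 - k μ(t))`. -/
def constQ {m p : ℕ} (D₀ : Matrix (Fin m) (Fin p) ℝ) (k : ℕ) (t : ℝ) : ℝ :=
  1 / √(1 - k * coherenceAt D₀ t)

/-- `C_t = 1 / (√(1 - δ_k(D₀)) - t)`. -/
def constC {m p : ℕ} (D₀ : Matrix (Fin m) (Fin p) ℝ) (k : ℕ) (t : ℝ) : ℝ :=
  1 / (√(1 - ripConst D₀ k) - t)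

/-- `𝒦 = C_t (‖D₀‖₂ √(k / p) + t)`. -/
def constK {m p : ℕ} (D₀ : Matrix (Fin m) (Fin p) ℝ) (k : ℕ) (t : ℝ) : ℝ :=
  constC D₀ k t * (opNorm D₀ * √((k : ℝ) / p) + t)

/-- `A = 367 (t² σ_α² + 2 m σ² + 2 λ k σ_α)`. -/
def constA (m k : ℕ) (t σα σ lam : ℝ) : ℝ :=
  367 * (t ^ 2 * σα ^ 2 + 2 * m * σ ^ 2 + 2 * lam * k * σα)

/-- `B = 3045 (k σ_α² t + 2 m σ² + 2 λ k σ_α)`. -/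
def constB (m k : ℕ) (t σα σ lam : ℝ) : ℝ :=
  3045 * (k * σα ^ 2 * t + 2 * m * σ ^ 2 + 2 * lam * k * σα)

/-- `γ = λ (2 - Q_t²) / (√5 √(t² σ_α² + m σ²))`. -/
def constGamma {m p : ℕ} (D₀ : Matrix (Fin m) (Fin p) ℝ) (k : ℕ) (t σα σ lam : ℝ) : ℝ :=
  lam * (2 - constQ D₀ k t ^ 2) / (√5 * √(t ^ 2 * σα ^ 2 + m * σ ^ 2))

/-- The admissible range of the regularization parameter:
`3 / (2 - Q_t²) · √(t² σ_α² + m σ²) ≤ λ ≤ (4 / 9) α_min`. -/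
def Admissible {m p : ℕ} (D₀ : Matrix (Fin m) (Fin p) ℝ) (k : ℕ) (t σα αmin σ lam : ℝ) : Prop :=
  3 / (2 - constQ D₀ k t ^ 2) * √(t ^ 2 * σα ^ 2 + m * σ ^ 2) ≤ lam ∧ lam ≤ 4 / 9 * αmin

/-- The law `ν` on `ℝ` is sub-Gaussian with parameter `c`:
`∫ exp (s x) dν ≤ exp (c² s² / 2)` for all real `s`. -/
def IsSubGaussian (ν : Measure ℝ) (c : ℝ) : Prop :=
  0 ≤ c ∧ HasSubgaussianMGF id ⟨c ^ 2, sq_nonneg c⟩ ν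

/-- A law of random supports of size `k` in `{1, …, p}` with the first and second order
inclusion probabilities of a uniform draw without replacement. -/
structure IsSupportLaw {p : ℕ} (π : PMF (Finset (Fin p))) (k : ℕ) : Prop where
  card_eq : ∀ J, π J ≠ 0 → J.card = k
  prob_mem : ∀ j, ∑ J with j ∈ J, (π J).toReal = (k : ℝ) / p
  prob_pair : ∀ i j, i ≠ j →
    ∑ J with i ∈ J ∧ j ∈ J, (π J).toReal = (k : ℝ) * (k - 1) / (p * (p - 1))

/-- The vector that agrees with `z` on `J` and vanishes off `J`. -/
def maskVec {p : ℕ} (J : Finset (Fin p)) (z : Fin p → ℝ) : Fin p → ℝ :=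
  fun j => if j ∈ J then z j else 0

/-- The law of one signal `x = D₀ α₀ + ε`: draw the support `J` from `π`; given `J`, the entries
of `α₀` in `J` are i.i.d. with law `ν` and the others vanish; the entries of the noise `ε` are
i.i.d. with law `η` and independent of `α₀`. -/
def signalLaw {m p : ℕ} (D₀ : Matrix (Fin m) (Fin p) ℝ) (π : PMF (Finset (Fin p)))
    (ν η : Measure ℝ) : Measure (Fin m → ℝ) :=
  ∑ J : Finset (Fin p), π J •
    Measure.map (fun q : (Fin p → ℝ) × (Fin m → ℝ) => D₀ *ᵥ maskVec J q.1 + q.2)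
      ((Measure.pi fun _ : Fin p => ν).prod (Measure.pi fun _ : Fin m => η))

end

end SparseCoding

/-! Fix a support J of size k and freeze the signs s of the coefficients. Replacing λ‖a‖₁ by λ s·a
on the columns in J turns the Lasso into least squares with a linear term, whose value `lsqVal` is
explicit. Two one-sided comparisons suffice. At the moved dictionary the residual of this problem is
dual feasible, so `lsqVal` is a lower bound (`IsCoherentDict.lsqVal_le_lassoVal`). At D₀ its
minimizer has the right signs, so `lsqVal` is an upper bound (`IsCoherentDict.lassoVal_le_lsqVal`).
Both hold when the noise, and the noise combined with the displacement of the atoms, have norm at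
most λ(2 - Q_t²). The opposite event has probability O(e^{-2γ²}); there the comparison fails by at
most `costBound` (`ModelData.lsqVal_sub_le`), which has exponential moments, so it costs O(e^{-γ²})
in expectation.

The expectation of `lsqVal` is a combination of traces (`integral_lsqVal`), and the noise term
cancels between the two dictionaries. The energy of the original atoms off the span of the moved
ones is the gain, (1 - 𝒦²)t²k/p (`avg_projCompl_ge`). The traces of the pseudo-inverse and of the
inverse Gram matrix lose only multiples of t·kμ(t) (`avg_trace_pinv_ge`, `avg_trace_inv_sub_le`).
Averaging over J, instead of bounding for each J, brings in k/p and the spectral norm.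

The empirical cost is handled by Chernoff bounds at single dictionaries, a union bound over a grid
net of the dictionaries reached at time t, and the stability of the Lasso value under small moves of
the columns. The condition mp·log n ≤ n absorbs the size of the net. -/

namespace SparseCoding

set_option linter.unusedSectionVars false

/-! ### Euclidean norm of plain families of reals -/

section EuclideanNorm

variable {ι κ : Type*} [Fintype ι] [Fintype κ]

/-- The Euclidean norm of a family of real numbers. -/
noncomputable def euclNorm (x : ι → ℝ) : ℝ := ‖WithLp.toLp 2 x‖

lemma euclNorm_nonneg (x : ι → ℝ) : 0 ≤ euclNorm x := norm_nonneg _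

lemma euclNorm_sq (x : ι → ℝ) : euclNorm x ^ 2 = x ⬝ᵥ x := by
  rw [euclNorm, EuclideanSpace.norm_sq_eq, dotProduct]
  exact Finset.sum_congr rfl fun i _ => by simp [sq]

lemma euclNorm_add_le (x y : ι → ℝ) : euclNorm (x + y) ≤ euclNorm x + euclNorm y := by
  simpa [euclNorm] using norm_add_le (WithLp.toLp 2 x) (WithLp.toLp 2 y)

lemma euclNorm_sub_le (x y : ι → ℝ) : euclNorm (x - y) ≤ euclNorm x + euclNorm y := by
  simpa [euclNorm] using norm_sub_le (WithLp.toLp 2 x) (WithLp.toLp 2 y)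

lemma euclNorm_smul (c : ℝ) (x : ι → ℝ) : euclNorm (c • x) = |c| * euclNorm x := by
  simpa [euclNorm] using norm_smul c (WithLp.toLp 2 x)

lemma euclNorm_sum_le {s : Finset κ} (f : κ → ι → ℝ) :
    euclNorm (∑ i ∈ s, f i) ≤ ∑ i ∈ s, euclNorm (f i) := by
  have := norm_sum_le s (fun i => WithLp.toLp 2 (f i))
  rwa [← WithLp.toLp_sum] at this

lemma euclNorm_eq_of_dot {x : ι → ℝ} {c : ℝ} (hc : 0 ≤ c) (h : x ⬝ᵥ x = c ^ 2) :
    euclNorm x = c := by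
  rw [← euclNorm_sq] at h
  exact (sq_eq_sq₀ (euclNorm_nonneg x) hc).1 h

lemma euclNorm_le_of_dot {x : ι → ℝ} {c : ℝ} (hc : 0 ≤ c) (h : x ⬝ᵥ x ≤ c ^ 2) :
    euclNorm x ≤ c := by
  rw [← euclNorm_sq] at h
  exact (sq_le_sq₀ (euclNorm_nonneg x) hc).1 h

lemma dot_self_nonneg (x : ι → ℝ) : 0 ≤ x ⬝ᵥ x := by
  rw [← euclNorm_sq]; positivity

lemma dot_self_eq_sum (x : ι → ℝ) : x ⬝ᵥ x = ∑ i, x i ^ 2 :=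
  Finset.sum_congr rfl fun i _ => by rw [sq]

lemma dot_sq_le (x y : ι → ℝ) : (x ⬝ᵥ y) ^ 2 ≤ (x ⬝ᵥ x) * (y ⬝ᵥ y) := by
  simp only [dot_self_eq_sum]
  exact Finset.sum_mul_sq_le_sq_mul_sq _ x y

lemma abs_dot_le (x y : ι → ℝ) : |x ⬝ᵥ y| ≤ euclNorm x * euclNorm y := by
  apply abs_le_of_sq_le_sq _ (mul_nonneg (euclNorm_nonneg x) (euclNorm_nonneg y))
  rw [mul_pow, euclNorm_sq, euclNorm_sq]
  exact dot_sq_le x y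

lemma sq_le_dot_self (x : ι → ℝ) (i : ι) : x i ^ 2 ≤ x ⬝ᵥ x := by
  rw [dot_self_eq_sum]
  exact Finset.single_le_sum (f := fun i => x i ^ 2) (fun j _ => sq_nonneg _) (Finset.mem_univ i)

lemma abs_le_euclNorm (x : ι → ℝ) (i : ι) : |x i| ≤ euclNorm x := by
  apply abs_le_of_sq_le_sq _ (euclNorm_nonneg x)
  rw [euclNorm_sq]
  exact sq_le_dot_self x i

lemma sum_abs_le_sqrt_card_mul (x : ι → ℝ) :
    ∑ i, |x i| ≤ √(Fintype.card ι) * euclNorm x := by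
  apply le_of_sq_le_sq _ (mul_nonneg (Real.sqrt_nonneg _) (euclNorm_nonneg x))
  rw [mul_pow, Real.sq_sqrt (by positivity), euclNorm_sq, dot_self_eq_sum]
  have := sq_sum_le_card_mul_sum_sq (s := (Finset.univ : Finset ι)) (f := fun i => |x i|)
  simpa using this

lemma dot_mulVec_eq (A : Matrix κ ι ℝ) (x : κ → ℝ) (y : ι → ℝ) :
    x ⬝ᵥ (A *ᵥ y) = (Aᵀ *ᵥ x) ⬝ᵥ y := by
  rw [dotProduct_mulVec, mulVec_transpose]

end EuclideanNorm

/-! ### Inverses of Gram matrices of small coherence -/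

section Gram

variable {ι κ : Type*} [Fintype ι] [Fintype κ] [DecidableEq ι]

/-- A matrix with unit diagonal whose other entries are bounded by `μ`. -/
structure IsCoherent (G : Matrix ι ι ℝ) (μ : ℝ) : Prop where
  diag : ∀ i, G i i = 1
  off : ∀ i j, i ≠ j → |G i j| ≤ μ

lemma IsCoherent.abs_sub_one_le {G : Matrix ι ι ℝ} {μ : ℝ} (h : IsCoherent G μ) (hμ : 0 ≤ μ)
    (i j : ι) : |(G - 1) i j| ≤ μ := by
  rw [Matrix.sub_apply]
  by_cases hij : i = j
  · subst hij; simpa [h.diag] using hμ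
  · simpa [Matrix.one_apply_ne hij] using h.off i j hij

/-- Diagonal dominance: at an index where |z| is largest, the off-diagonal part of G contributes at
most card · μ · |z i₀|. All inverse bounds below derive from this. -/
lemma IsCoherent.abs_le_of_mulVec {G : Matrix ι ι ℝ} {μ : ℝ} (h : IsCoherent G μ) (hμ : 0 ≤ μ)
    (hc : Fintype.card ι * μ < 1) {z : ι → ℝ} {c : ℝ} (hz : ∀ i, |(G *ᵥ z) i| ≤ c) (i : ι) :
    |z i| ≤ c * (1 / (1 - Fintype.card ι * μ)) := by
  obtain ⟨i₀, -, hi₀⟩ := Finset.exists_max_image Finset.univ (fun i => |z i|) ⟨i, Finset.mem_univ i⟩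
  have h1 : (G *ᵥ z) i₀ = z i₀ + ((G - 1) *ᵥ z) i₀ := by
    simp [sub_mulVec]
  have h2 : |((G - 1) *ᵥ z) i₀| ≤ Fintype.card ι * μ * |z i₀| := by
    calc |((G - 1) *ᵥ z) i₀| ≤ ∑ j, |(G - 1) i₀ j * z j| := Finset.abs_sum_le_sum_abs _ _
      _ ≤ ∑ _j : ι, μ * |z i₀| := by
          refine Finset.sum_le_sum fun j _ => ?_
          rw [abs_mul]
          exact mul_le_mul (h.abs_sub_one_le hμ _ _) (hi₀ j (Finset.mem_univ j)) (abs_nonneg _) hμ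
      _ = _ := by simp [mul_assoc]
  have h3 : |z i₀| ≤ c + Fintype.card ι * μ * |z i₀| := by
    have : z i₀ = (G *ᵥ z) i₀ - ((G - 1) *ᵥ z) i₀ := by rw [h1]; ring
    calc |z i₀| = |(G *ᵥ z) i₀ - ((G - 1) *ᵥ z) i₀| := by rw [← this]
      _ ≤ |(G *ᵥ z) i₀| + |((G - 1) *ᵥ z) i₀| := abs_sub _ _
      _ ≤ _ := add_le_add (hz i₀) h2
  refine (hi₀ i (Finset.mem_univ i)).trans ?_
  rw [mul_one_div, le_div_iff₀ (by linarith)]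
  linarith

lemma IsCoherent.isUnit_det {G : Matrix ι ι ℝ} {μ : ℝ} (h : IsCoherent G μ) (hμ : 0 ≤ μ)
    (hc : Fintype.card ι * μ < 1) : IsUnit G.det := by
  rw [isUnit_iff_ne_zero]
  intro hdet
  obtain ⟨v, hv, hGv⟩ := Matrix.exists_mulVec_eq_zero_iff.2 hdet
  apply hv
  ext i
  have := h.abs_le_of_mulVec hμ hc (z := v) (c := 0) (by simp [hGv]) i
  simpa using this

lemma IsCoherent.abs_inv_mulVec_le {G : Matrix ι ι ℝ} {μ : ℝ} (h : IsCoherent G μ) (hμ : 0 ≤ μ)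
    (hc : Fintype.card ι * μ < 1) {v : ι → ℝ} {c : ℝ} (hv : ∀ i, |v i| ≤ c) (i : ι) :
    |(G⁻¹ *ᵥ v) i| ≤ c * (1 / (1 - Fintype.card ι * μ)) := by
  refine h.abs_le_of_mulVec hμ hc (fun i => ?_) i
  rw [mulVec_mulVec, mul_nonsing_inv _ (h.isUnit_det hμ hc), one_mulVec]
  exact hv i

lemma IsCoherent.abs_inv_mul_le {G : Matrix ι ι ℝ} {μ : ℝ} (h : IsCoherent G μ) (hμ : 0 ≤ μ)
    (hc : Fintype.card ι * μ < 1) {B : Matrix ι κ ℝ} {c : ℝ} (hB : ∀ i j, |B i j| ≤ c)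
    (i : ι) (j : κ) : |(G⁻¹ * B) i j| ≤ c * (1 / (1 - Fintype.card ι * μ)) :=
  h.abs_inv_mulVec_le hμ hc (v := fun i => B i j) (fun i => hB i j) i

/-- Since G⁻¹ - 1 = -G⁻¹(G - 1), the deviation from the identity keeps a factor μ entrywise; this
makes the later error terms proportional to the coherence. -/
lemma IsCoherent.abs_inv_sub_one_le {G : Matrix ι ι ℝ} {μ : ℝ} (h : IsCoherent G μ) (hμ : 0 ≤ μ)
    (hc : Fintype.card ι * μ < 1) (i j : ι) :
    |(G⁻¹ - 1) i j| ≤ μ * (1 / (1 - Fintype.card ι * μ)) := by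
  have h1 : G⁻¹ - 1 = -(G⁻¹ * (G - 1)) := by
    rw [Matrix.mul_sub, nonsing_inv_mul _ (h.isUnit_det hμ hc), Matrix.mul_one, neg_sub]
  rw [h1, Matrix.neg_apply, abs_neg]
  exact h.abs_inv_mul_le hμ hc (h.abs_sub_one_le hμ) i j

lemma IsCoherent.quadratic_le {G : Matrix ι ι ℝ} {μ : ℝ} (h : IsCoherent G μ) (hμ : 0 ≤ μ)
    (z : ι → ℝ) : |z ⬝ᵥ (G *ᵥ z) - z ⬝ᵥ z| ≤ Fintype.card ι * μ * (z ⬝ᵥ z) := by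
  have h1 : z ⬝ᵥ (G *ᵥ z) - z ⬝ᵥ z = z ⬝ᵥ ((G - 1) *ᵥ z) := by
    rw [sub_mulVec, one_mulVec, dotProduct_sub]
  rw [h1]
  calc |z ⬝ᵥ ((G - 1) *ᵥ z)| ≤ ∑ i, |z i * ∑ j, (G - 1) i j * z j| :=
        Finset.abs_sum_le_sum_abs _ _
    _ ≤ ∑ i, |z i| * ∑ j, μ * |z j| := by
        refine Finset.sum_le_sum fun i _ => ?_
        rw [abs_mul]
        refine mul_le_mul_of_nonneg_left ((Finset.abs_sum_le_sum_abs _ _).trans ?_) (abs_nonneg _)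
        refine Finset.sum_le_sum fun j _ => ?_
        rw [abs_mul]
        exact mul_le_mul_of_nonneg_right (h.abs_sub_one_le hμ _ _) (abs_nonneg _)
    _ = μ * (∑ i, |z i|) ^ 2 := by
        rw [← Finset.mul_sum, ← Finset.sum_mul]; ring
    _ ≤ μ * (Fintype.card ι * (z ⬝ᵥ z)) := by
        refine mul_le_mul_of_nonneg_left ?_ hμ
        have := sq_sum_le_card_mul_sum_sq (s := (Finset.univ : Finset ι)) (f := fun i => |z i|)
        rw [dot_self_eq_sum]
        simpa using this
    _ = _ := by ring

end Gram

/-! ### Least squares with a linear term -/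

section Phi

variable {ι κ : Type*} [Fintype ι] [Fintype κ] [DecidableEq ι] [DecidableEq κ]

/-- The minimizer of `a ↦ |x - A a|² / 2 + b · a`. -/
noncomputable def lsqCoef (A : Matrix κ ι ℝ) (x : κ → ℝ) (b : ι → ℝ) : ι → ℝ :=
  (Aᵀ * A)⁻¹ *ᵥ (Aᵀ *ᵥ x - b)

/-- The residual of `lsqCoef`. -/
noncomputable def lsqRes (A : Matrix κ ι ℝ) (x : κ → ℝ) (b : ι → ℝ) : κ → ℝ :=
  x - A *ᵥ lsqCoef A x b

/-- The orthogonal projection onto the complement of the column space. -/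
noncomputable def projCompl (A : Matrix κ ι ℝ) : Matrix κ κ ℝ :=
  1 - A * (Aᵀ * A)⁻¹ * Aᵀ

/-- The minimal value of `a ↦ |x - A a|² / 2 + b · a`, written as a quadratic form. -/
noncomputable def lsqVal (A : Matrix κ ι ℝ) (x : κ → ℝ) (b : ι → ℝ) : ℝ :=
  1 / 2 * (x ⬝ᵥ (projCompl A *ᵥ x)) + b ⬝ᵥ (((Aᵀ * A)⁻¹ * Aᵀ) *ᵥ x)
    - 1 / 2 * (b ⬝ᵥ ((Aᵀ * A)⁻¹ *ᵥ b))

variable {A : Matrix κ ι ℝ}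

lemma transpose_mulVec_lsqRes (h : IsUnit (Aᵀ * A).det) (x : κ → ℝ) (b : ι → ℝ) :
    Aᵀ *ᵥ lsqRes A x b = b := by
  rw [lsqRes, mulVec_sub, mulVec_mulVec, lsqCoef, mulVec_mulVec, mul_nonsing_inv _ h, one_mulVec]
  simp

lemma projCompl_mul (h : IsUnit (Aᵀ * A).det) : projCompl A * A = 0 := by
  rw [projCompl, Matrix.sub_mul, Matrix.mul_assoc, Matrix.mul_assoc, nonsing_inv_mul _ h]
  simp

lemma gram_inv_transpose (A : Matrix κ ι ℝ) : ((Aᵀ * A)⁻¹)ᵀ = (Aᵀ * A)⁻¹ := by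
  rw [transpose_nonsing_inv, transpose_mul, transpose_transpose]

lemma projCompl_transpose (A : Matrix κ ι ℝ) : (projCompl A)ᵀ = projCompl A := by
  rw [projCompl, transpose_sub, transpose_mul, transpose_mul, gram_inv_transpose]
  simp [Matrix.mul_assoc]

lemma projCompl_mul_self (h : IsUnit (Aᵀ * A).det) :
    projCompl A * projCompl A = projCompl A := by
  conv_lhs => rw [projCompl.eq_def A, Matrix.mul_sub, Matrix.mul_one]
  rw [← projCompl, ← Matrix.mul_assoc, ← Matrix.mul_assoc, projCompl_mul h]
  simp

lemma lsqRes_eq (x : κ → ℝ) (b : ι → ℝ) :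
    lsqRes A x b = projCompl A *ᵥ x + A *ᵥ ((Aᵀ * A)⁻¹ *ᵥ b) := by
  rw [lsqRes, lsqCoef, projCompl, mulVec_sub, mulVec_sub, sub_mulVec]
  simp only [mulVec_mulVec, one_mulVec, Matrix.mul_assoc]
  abel

lemma dot_projCompl (h : IsUnit (Aᵀ * A).det) (x : κ → ℝ) :
    x ⬝ᵥ (projCompl A *ᵥ x) = (projCompl A *ᵥ x) ⬝ᵥ (projCompl A *ᵥ x) := by
  rw [dot_mulVec_eq (projCompl A) (projCompl A *ᵥ x), projCompl_transpose, mulVec_mulVec,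
    projCompl_mul_self h, dotProduct_comm]

lemma euclNorm_projCompl_le (h : IsUnit (Aᵀ * A).det) (x : κ → ℝ) :
    euclNorm (projCompl A *ᵥ x) ≤ euclNorm x := by
  by_cases h0 : euclNorm (projCompl A *ᵥ x) = 0
  · rw [h0]; exact euclNorm_nonneg x
  have h1 := abs_dot_le x (projCompl A *ᵥ x)
  rw [dot_projCompl h, ← euclNorm_sq, abs_of_nonneg (sq_nonneg _), sq] at h1
  exact le_of_mul_le_mul_right h1 (lt_of_le_of_ne (euclNorm_nonneg _) (Ne.symm h0))

/-- The two parts of the residual, the projection of x and A(AᵀA)⁻¹b, are orthogonal. The right side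
is the Lasso dual objective at the residual, the form to which weak duality applies. -/
lemma lsqVal_eq_dual (h : IsUnit (Aᵀ * A).det) (x : κ → ℝ) (b : ι → ℝ) :
    lsqVal A x b = lsqRes A x b ⬝ᵥ x - 1 / 2 * (lsqRes A x b ⬝ᵥ lsqRes A x b) := by
  have h1 : (projCompl A *ᵥ x) ⬝ᵥ (A *ᵥ ((Aᵀ * A)⁻¹ *ᵥ b)) = 0 := by
    have h2 : Aᵀ * projCompl A = 0 := by
      have := congrArg transpose (projCompl_mul h)
      rwa [transpose_mul, projCompl_transpose, transpose_zero] at this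
    rw [dot_mulVec_eq, mulVec_mulVec, h2]
    simp
  have h3 : (A *ᵥ ((Aᵀ * A)⁻¹ *ᵥ b)) ⬝ᵥ (A *ᵥ ((Aᵀ * A)⁻¹ *ᵥ b)) = b ⬝ᵥ ((Aᵀ * A)⁻¹ *ᵥ b) := by
    rw [dot_mulVec_eq A, mulVec_mulVec, mulVec_mulVec, mul_nonsing_inv _ h, one_mulVec]
  have h4 : (A *ᵥ ((Aᵀ * A)⁻¹ *ᵥ b)) ⬝ᵥ x = b ⬝ᵥ (((Aᵀ * A)⁻¹ * Aᵀ) *ᵥ x) := by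
    rw [dot_mulVec_eq ((Aᵀ * A)⁻¹ * Aᵀ), transpose_mul, transpose_transpose, gram_inv_transpose,
      mulVec_mulVec]
  rw [lsqRes_eq, lsqVal]
  simp only [add_dotProduct, dotProduct_add]
  rw [dotProduct_comm (A *ᵥ ((Aᵀ * A)⁻¹ *ᵥ b)) (projCompl A *ᵥ x), h1, h3, h4,
    ← dot_projCompl h, dotProduct_comm _ x]
  ring

/-- The linear term becomes the ℓ¹ penalty as soon as the coefficients have the signs recorded in b.
-/
lemma lsqVal_eq_primal (h : IsUnit (Aᵀ * A).det) (x : κ → ℝ) (b : ι → ℝ) :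
    lsqVal A x b = 1 / 2 * (lsqRes A x b ⬝ᵥ lsqRes A x b) + b ⬝ᵥ lsqCoef A x b := by
  have h1 : b ⬝ᵥ lsqCoef A x b = lsqRes A x b ⬝ᵥ x - lsqRes A x b ⬝ᵥ lsqRes A x b := by
    have h2 : A *ᵥ lsqCoef A x b = x - lsqRes A x b := by rw [lsqRes]; abel
    have h3 := dot_mulVec_eq A (lsqRes A x b) (lsqCoef A x b)
    rw [transpose_mulVec_lsqRes h x b, h2] at h3
    rw [← h3, dotProduct_sub]
  rw [lsqVal_eq_dual h, h1]; ring

lemma dual_le_add (u x : κ → ℝ) :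
    u ⬝ᵥ x - 1 / 2 * (u ⬝ᵥ u) ≤ 1 / 2 * (x ⬝ᵥ x) := by
  have := dot_self_nonneg (x - u)
  simp only [sub_dotProduct, dotProduct_sub, dotProduct_comm x u] at this
  linarith

lemma lsqVal_le (h : IsUnit (Aᵀ * A).det) (y : κ → ℝ) (a b : ι → ℝ) :
    lsqVal A (A *ᵥ a + y) b ≤ 1 / 2 * (y ⬝ᵥ y) + b ⬝ᵥ a := by
  rw [lsqVal_eq_dual h, dotProduct_add, dot_mulVec_eq, transpose_mulVec_lsqRes h]
  have := dual_le_add (lsqRes A (A *ᵥ a + y) b) y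
  linarith

/-- A crude bound for the bad event, free of any sign recovery: drop the energy off the span and
complete the square in A(AᵀA)⁻¹b + y. -/
lemma dot_le_lsqVal (h : IsUnit (Aᵀ * A).det) (y : κ → ℝ) (a b : ι → ℝ) :
    b ⬝ᵥ a - 1 / 2 * (y ⬝ᵥ y) - b ⬝ᵥ ((Aᵀ * A)⁻¹ *ᵥ b) ≤ lsqVal A (A *ᵥ a + y) b := by
  have h3 : (A *ᵥ ((Aᵀ * A)⁻¹ *ᵥ b)) ⬝ᵥ (A *ᵥ ((Aᵀ * A)⁻¹ *ᵥ b)) = b ⬝ᵥ ((Aᵀ * A)⁻¹ *ᵥ b) := by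
    rw [dot_mulVec_eq A, mulVec_mulVec, mulVec_mulVec, mul_nonsing_inv _ h, one_mulVec]
  have h4 : b ⬝ᵥ (((Aᵀ * A)⁻¹ * Aᵀ) *ᵥ y) = (A *ᵥ ((Aᵀ * A)⁻¹ *ᵥ b)) ⬝ᵥ y := by
    rw [dot_mulVec_eq ((Aᵀ * A)⁻¹ * Aᵀ), transpose_mul, transpose_transpose, gram_inv_transpose,
      mulVec_mulVec]
  have h5 : ((Aᵀ * A)⁻¹ * Aᵀ) *ᵥ (A *ᵥ a) = a := by
    rw [mulVec_mulVec, Matrix.mul_assoc, nonsing_inv_mul _ h, one_mulVec]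
  rw [lsqVal, mulVec_add ((Aᵀ * A)⁻¹ * Aᵀ), h5, dotProduct_add, h4, dot_projCompl h]
  have h6 := dot_self_nonneg (projCompl A *ᵥ (A *ᵥ a + y))
  have h7 := dot_self_nonneg (A *ᵥ ((Aᵀ * A)⁻¹ *ᵥ b) + y)
  simp only [add_dotProduct, dotProduct_add, dotProduct_comm y, h3] at h7
  linarith

end Phi

/-! ### Lasso values: duality, sign recovery, stability -/

section Lasso

variable {m p : ℕ}

lemma sqNorm_eq_dot {d : ℕ} (x : Fin d → ℝ) : sqNorm x = x ⬝ᵥ x := (dot_self_eq_sum x).symm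

lemma lassoObj_nonneg {lam : ℝ} (hlam : 0 ≤ lam) (x : Fin m → ℝ) (D : Matrix (Fin m) (Fin p) ℝ)
    (a : Fin p → ℝ) : 0 ≤ lassoObj lam x D a := by
  rw [lassoObj, sqNorm_eq_dot]
  have := dot_self_nonneg (x - D *ᵥ a)
  have : 0 ≤ ∑ j, |a j| := Finset.sum_nonneg fun i _ => abs_nonneg _
  positivity

lemma bddBelow_lassoObj {lam : ℝ} (hlam : 0 ≤ lam) (x : Fin m → ℝ)
    (D : Matrix (Fin m) (Fin p) ℝ) : BddBelow (Set.range fun a => lassoObj lam x D a) :=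
  ⟨0, by rintro _ ⟨a, rfl⟩; exact lassoObj_nonneg hlam x D a⟩

lemma lassoVal_le {lam : ℝ} (hlam : 0 ≤ lam) (x : Fin m → ℝ) (D : Matrix (Fin m) (Fin p) ℝ)
    (a : Fin p → ℝ) : lassoVal lam x D ≤ lassoObj lam x D a :=
  ciInf_le (bddBelow_lassoObj hlam x D) a

lemma lassoVal_nonneg {lam : ℝ} (hlam : 0 ≤ lam) (x : Fin m → ℝ) (D : Matrix (Fin m) (Fin p) ℝ) :
    0 ≤ lassoVal lam x D :=
  le_ciInf fun a => lassoObj_nonneg hlam x D a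

/-- An infimum of uncountably many continuous functions is still upper semicontinuous, hence
measurable. -/
lemma measurable_lassoVal {lam : ℝ} (hlam : 0 ≤ lam) (D : Matrix (Fin m) (Fin p) ℝ) :
    Measurable fun x => lassoVal lam x D := by
  apply UpperSemicontinuous.measurable
  apply upperSemicontinuous_ciInf (fun x => bddBelow_lassoObj hlam x D)
  intro a
  apply Continuous.upperSemicontinuous
  unfold lassoObj sqNorm
  simp only [Pi.sub_apply]
  fun_prop

/-- Weak duality for the Lasso. -/
lemma le_lassoVal_of_dual {lam : ℝ} (x u : Fin m → ℝ) (D : Matrix (Fin m) (Fin p) ℝ)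
    (hu : ∀ j, |Dᵀ j ⬝ᵥ u| ≤ lam) : u ⬝ᵥ x - 1 / 2 * (u ⬝ᵥ u) ≤ lassoVal lam x D := by
  refine le_ciInf fun a => ?_
  rw [lassoObj, sqNorm_eq_dot]
  have h1 := dual_le_add u (x - D *ᵥ a)
  have h2 : u ⬝ᵥ (D *ᵥ a) ≤ lam * ∑ j, |a j| := by
    rw [dot_mulVec_eq, Finset.mul_sum]
    refine Finset.sum_le_sum fun j _ => (le_abs_self _).trans ?_
    rw [abs_mul]
    exact mul_le_mul_of_nonneg_right (hu j) (abs_nonneg _)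
  rw [dotProduct_sub] at h1
  linarith

/-- The submatrix of the columns with index in `J`. -/
def subDict (D : Matrix (Fin m) (Fin p) ℝ) (J : Finset (Fin p)) : Matrix (Fin m) J ℝ :=
  D.submatrix id Subtype.val

/-- The extension of a family indexed by `J` by zero. -/
def extendZero {J : Finset (Fin p)} (a : J → ℝ) : Fin p → ℝ :=
  fun j => if h : j ∈ J then a ⟨j, h⟩ else 0

lemma sum_extendZero {J : Finset (Fin p)} (a : J → ℝ) (F : Fin p → ℝ → ℝ) (hF : ∀ j, F j 0 = 0) :
    ∑ j, F j (extendZero a j) = ∑ j : J, F j (a j) := by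
  rw [← Finset.sum_subset (Finset.subset_univ J), ← Finset.sum_attach J]
  · refine Finset.sum_congr rfl fun j _ => ?_
    simp [extendZero]
  · intro j _ hj
    simp [extendZero, hj, hF]

lemma mulVec_extendZero (D : Matrix (Fin m) (Fin p) ℝ) {J : Finset (Fin p)} (a : J → ℝ) :
    D *ᵥ extendZero a = subDict D J *ᵥ a := by
  ext i
  exact sum_extendZero a (fun j z => D i j * z) (by simp)

lemma mulVec_maskVec (D : Matrix (Fin m) (Fin p) ℝ) (J : Finset (Fin p)) (z : Fin p → ℝ) :
    D *ᵥ maskVec J z = subDict D J *ᵥ fun j => z j := by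
  rw [← mulVec_extendZero]
  congr 1

/-- The columns of `D` have unit norm and inner products bounded by `μ`. -/
structure IsCoherentDict (D : Matrix (Fin m) (Fin p) ℝ) (μ : ℝ) : Prop where
  unit : ∀ j, Dᵀ j ⬝ᵥ Dᵀ j = 1
  off : ∀ i j, i ≠ j → |Dᵀ i ⬝ᵥ Dᵀ j| ≤ μ

lemma IsCoherentDict.mono {D : Matrix (Fin m) (Fin p) ℝ} {μ μ' : ℝ} (h : IsCoherentDict D μ)
    (hμ : μ ≤ μ') : IsCoherentDict D μ' :=
  ⟨h.unit, fun i j hij => (h.off i j hij).trans hμ⟩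

lemma IsCoherentDict.gram {D : Matrix (Fin m) (Fin p) ℝ} {μ : ℝ} (h : IsCoherentDict D μ)
    (J : Finset (Fin p)) : IsCoherent ((subDict D J)ᵀ * subDict D J) μ where
  diag i := h.unit i
  off i j hij := h.off i j (fun h => hij (Subtype.ext h))

lemma IsCoherentDict.euclNorm_eq {D : Matrix (Fin m) (Fin p) ℝ} {μ : ℝ} (h : IsCoherentDict D μ)
    (j : Fin p) : euclNorm (Dᵀ j) = 1 :=
  euclNorm_eq_of_dot zero_le_one (by rw [h.unit]; norm_num)

lemma IsCoherentDict.isUnit {D : Matrix (Fin m) (Fin p) ℝ} {μ : ℝ} (h : IsCoherentDict D μ)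
    (hμ : 0 ≤ μ) {J : Finset (Fin p)} (hJ : (J.card : ℝ) * μ < 1) :
    IsUnit ((subDict D J)ᵀ * subDict D J).det :=
  (h.gram J).isUnit_det hμ (by simpa using hJ)

/-- The restricted least squares value bounds the Lasso value from below when the part of the
signal off the span of the selected columns is small. -/
lemma IsCoherentDict.lsqVal_le_lassoVal {D : Matrix (Fin m) (Fin p) ℝ} {μ q lam : ℝ}
    (h : IsCoherentDict D μ) (hμ : 0 ≤ μ) {J : Finset (Fin p)} (hJ : (J.card : ℝ) * μ < 1)
    (hq : q = 1 / (1 - J.card * μ)) (hlam : 0 ≤ lam) {s : J → ℝ} (hs : ∀ j, |s j| ≤ 1)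
    (a : J → ℝ) (y : Fin m → ℝ) (hy : euclNorm y ≤ lam * (2 - q)) :
    lsqVal (subDict D J) (subDict D J *ᵥ a + y) (lam • s)
      ≤ lassoVal lam (subDict D J *ᵥ a + y) D := by
  have hU := h.isUnit hμ hJ
  rw [lsqVal_eq_dual hU]
  apply le_lassoVal_of_dual
  intro j
  by_cases hj : j ∈ J
  · have := congrFun (transpose_mulVec_lsqRes hU (subDict D J *ᵥ a + y) (lam • s)) ⟨j, hj⟩
    have h2 : Dᵀ j ⬝ᵥ lsqRes (subDict D J) (subDict D J *ᵥ a + y) (lam • s) = lam * s ⟨j, hj⟩ := this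
    rw [h2, abs_mul, abs_of_nonneg hlam]
    exact mul_le_of_le_one_right hlam (hs _)
  · rw [lsqRes_eq, mulVec_add, mulVec_mulVec, projCompl_mul hU, zero_mulVec, zero_add,
      dotProduct_add, mulVec_smul, mulVec_smul, dotProduct_smul, smul_eq_mul]
    have h1 : |Dᵀ j ⬝ᵥ (projCompl (subDict D J) *ᵥ y)| ≤ lam * (2 - q) := by
      refine (abs_dot_le _ _).trans ?_
      rw [h.euclNorm_eq, one_mul]
      exact (euclNorm_projCompl_le hU y).trans hy
    have h2 : |Dᵀ j ⬝ᵥ (subDict D J *ᵥ (((subDict D J)ᵀ * subDict D J)⁻¹ *ᵥ s))|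
        ≤ J.card * (μ * q) := by
      rw [dot_mulVec_eq]
      calc _ ≤ ∑ i : J, |((subDict D J)ᵀ *ᵥ Dᵀ j) i
            * (((subDict D J)ᵀ * subDict D J)⁻¹ *ᵥ s) i| := Finset.abs_sum_le_sum_abs _ _
        _ ≤ ∑ _i : J, μ * q := by
            refine Finset.sum_le_sum fun i _ => ?_
            rw [abs_mul]
            refine mul_le_mul (h.off i j (fun hij => hj (hij ▸ i.2))) ?_ (abs_nonneg _) hμ
            have := (h.gram J).abs_inv_mulVec_le hμ (by simpa using hJ) hs i
            simpa [hq] using this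
        _ = _ := by simp
    have h3 : J.card * (μ * q) = q - 1 := by
      rw [hq]; field_simp [(by linarith : (1 : ℝ) - J.card * μ ≠ 0)]; ring
    calc _ ≤ _ := abs_add_le _ _
      _ ≤ lam * (2 - q) + lam * (q - 1) := by
          refine add_le_add h1 ?_
          rw [abs_mul, abs_of_nonneg hlam]
          exact mul_le_mul_of_nonneg_left (h2.trans h3.le) hlam
      _ = lam := by ring

/-- The restricted least squares value bounds the Lasso value from above when the signs of the
coefficients are recovered. -/
lemma IsCoherentDict.lassoVal_le_lsqVal {D : Matrix (Fin m) (Fin p) ℝ} {μ q lam : ℝ}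
    (h : IsCoherentDict D μ) (hμ : 0 ≤ μ) {J : Finset (Fin p)} (hJ : (J.card : ℝ) * μ < 1)
    (hq : 1 / (1 - J.card * μ) ≤ q) (hlam : 0 ≤ lam) {s : J → ℝ} (hs : ∀ j, |s j| = 1)
    {a : J → ℝ} (hsa : ∀ j, s j * a j = |a j|) (ha : ∀ j, 9 / 4 * lam ≤ |a j|)
    {y : Fin m → ℝ} (hy : euclNorm y ≤ lam * (2 - q)) :
    lassoVal lam (subDict D J *ᵥ a + y) D
      ≤ lsqVal (subDict D J) (subDict D J *ᵥ a + y) (lam • s) := by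
  have hU := h.isUnit hμ hJ
  have hq0 : 0 ≤ q := le_trans (by have : 0 < 1 - (J.card : ℝ) * μ := by linarith
                                   positivity) hq
  set x := subDict D J *ᵥ a + y with hx
  set c := lsqCoef (subDict D J) x (lam • s) with hc
  have hc1 : c = a + ((subDict D J)ᵀ * subDict D J)⁻¹ *ᵥ ((subDict D J)ᵀ *ᵥ y - lam • s) := by
    rw [hc, lsqCoef, hx, mulVec_add, add_sub_assoc, mulVec_add, mulVec_mulVec, mulVec_mulVec,
      Matrix.mul_assoc, nonsing_inv_mul _ hU, one_mulVec]
  have hsmall : ∀ j, |(((subDict D J)ᵀ * subDict D J)⁻¹ *ᵥ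
      ((subDict D J)ᵀ *ᵥ y - lam • s)) j| ≤ |a j| := by
    intro j
    have h1 : ∀ i, |((subDict D J)ᵀ *ᵥ y - lam • s) i| ≤ lam * (3 - q) := by
      intro i
      have h2 : |Dᵀ i ⬝ᵥ y| ≤ lam * (2 - q) := by
        refine (abs_dot_le _ _).trans ?_
        rw [h.euclNorm_eq, one_mul]; exact hy
      calc _ = |Dᵀ i ⬝ᵥ y - lam * s i| := rfl
        _ ≤ |Dᵀ i ⬝ᵥ y| + |lam * s i| := abs_sub _ _
        _ ≤ lam * (2 - q) + lam * 1 := by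
            rw [abs_mul, hs, abs_of_nonneg hlam]; linarith
        _ = _ := by ring
    have h3 := (h.gram J).abs_inv_mulVec_le hμ (by simpa using hJ) h1 j
    have h4 : 0 ≤ lam * (3 - q) := (abs_nonneg _).trans (h1 j)
    rw [Fintype.card_coe] at h3
    refine h3.trans (le_trans ?_ (ha j))
    refine (mul_le_mul_of_nonneg_left hq h4).trans ?_
    -- The coefficients move by at most λ(3 - q)q, maximal at q = 3/2 with value 9λ/4; hence the
    -- condition λ ≤ (4/9) α_min.
    nlinarith [mul_nonneg hlam (sq_nonneg (q - 3 / 2))]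
  have hsc : ∀ j, |c j| = s j * c j := by
    intro j
    have h1 : 0 ≤ s j * c j := by
      rw [hc1, Pi.add_apply, mul_add, hsa]
      have := neg_abs_le (s j * (((subDict D J)ᵀ * subDict D J)⁻¹ *ᵥ
        ((subDict D J)ᵀ *ᵥ y - lam • s)) j)
      rw [abs_mul, hs, one_mul] at this
      linarith [hsmall j]
    rw [← abs_of_nonneg h1, abs_mul, hs, one_mul]
  rw [lsqVal_eq_primal hU]
  refine (lassoVal_le hlam x D (extendZero c)).trans (le_of_eq ?_)
  rw [lassoObj, sqNorm_eq_dot, mulVec_extendZero, sum_extendZero c (fun _ z => |z|) (by simp),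
    smul_dotProduct, smul_eq_mul]
  congr 1
  rw [dotProduct]
  congr 1
  exact Finset.sum_congr rfl fun j _ => hsc j

lemma lassoVal_signal_le {lam : ℝ} (hlam : 0 ≤ lam) (D : Matrix (Fin m) (Fin p) ℝ)
    {J : Finset (Fin p)} (a : J → ℝ) (y : Fin m → ℝ) :
    lassoVal lam (subDict D J *ᵥ a + y) D ≤ 1 / 2 * (y ⬝ᵥ y) + lam * ∑ j, |a j| := by
  refine (lassoVal_le hlam _ D (extendZero a)).trans (le_of_eq ?_)
  rw [lassoObj, sqNorm_eq_dot, mulVec_extendZero, sum_extendZero a (fun _ z => |z|) (by simp)]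
  simp

lemma euclNorm_mulVec_le_of_col {ι κ : Type*} [Fintype ι] [Fintype κ] (E : Matrix κ ι ℝ) {δ : ℝ}
    (hE : ∀ j, euclNorm (Eᵀ j) ≤ δ) (a : ι → ℝ) : euclNorm (E *ᵥ a) ≤ δ * ∑ j, |a j| := by
  have h1 : E *ᵥ a = ∑ j, a j • Eᵀ j := by
    ext i
    simp [mulVec, dotProduct, Finset.sum_apply, mul_comm]
  rw [h1, Finset.mul_sum]
  refine (euclNorm_sum_le _).trans (Finset.sum_le_sum fun j _ => ?_)
  rw [euclNorm_smul, mul_comm]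
  exact mul_le_mul_of_nonneg_right (hE j) (abs_nonneg _)

/-- Stability of the Lasso value under a change of the dictionary. -/
lemma lassoVal_le_of_col_close {lam δ : ℝ} (hlam : 0 < lam) (hδ : 0 ≤ δ)
    {D D' : Matrix (Fin m) (Fin p) ℝ} (hD : ∀ j, euclNorm ((D - D')ᵀ j) ≤ δ) (x : Fin m → ℝ) :
    lassoVal lam x D' ≤ lassoVal lam x D * (1 + δ * √(2 * lassoVal lam x D) / lam
      + δ ^ 2 * lassoVal lam x D / (2 * lam ^ 2)) := by
  set g : ℝ → ℝ := fun o => o * (1 + δ * √(2 * o) / lam + δ ^ 2 * o / (2 * lam ^ 2)) with hg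
  have hgc : Continuous g := by fun_prop
  have hgm : ∀ o o', 0 ≤ o → o ≤ o' → g o ≤ g o' := by
    intro o o' ho hoo
    have h0 : (0 : ℝ) ≤ o' := ho.trans hoo
    simp only [hg]
    gcongr
  have key : ∀ a, lassoVal lam x D' ≤ g (lassoObj lam x D a) := by
    intro a
    set o := lassoObj lam x D a with ho
    have hsum : 0 ≤ ∑ j, |a j| := Finset.sum_nonneg fun i _ => abs_nonneg _
    -- Each part of the objective is at most o, so the residual is at most √(2o) and the ℓ¹ norm at
    -- most o/λ. Passing to D' lengthens the residual by at most δ times the ℓ¹ norm.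
    have h1 : euclNorm (x - D *ᵥ a) ≤ √(2 * o) := by
      apply Real.le_sqrt_of_sq_le
      rw [euclNorm_sq, ho, lassoObj, sqNorm_eq_dot]
      have : 0 ≤ lam * ∑ j, |a j| := by positivity
      linarith
    have h2 : ∑ j, |a j| ≤ o / lam := by
      rw [le_div_iff₀ hlam, ho, lassoObj, sqNorm_eq_dot]
      have := dot_self_nonneg (x - D *ᵥ a)
      linarith
    have h3 : euclNorm (x - D' *ᵥ a) ≤ euclNorm (x - D *ᵥ a) + δ * ∑ j, |a j| := by
      have : x - D' *ᵥ a = (x - D *ᵥ a) + (D - D') *ᵥ a := by rw [sub_mulVec]; abel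
      rw [this]
      exact (euclNorm_add_le _ _).trans (by gcongr; exact euclNorm_mulVec_le_of_col _ hD a)
    have h4 : (x - D' *ᵥ a) ⬝ᵥ (x - D' *ᵥ a)
        ≤ (x - D *ᵥ a) ⬝ᵥ (x - D *ᵥ a) + 2 * √(2 * o) * (δ * (o / lam)) + (δ * (o / lam)) ^ 2 := by
      rw [← euclNorm_sq, ← euclNorm_sq]
      have h5 := euclNorm_nonneg (x - D *ᵥ a)
      have h6 : δ * ∑ j, |a j| ≤ δ * (o / lam) := by gcongr
      have h7 : 0 ≤ δ * ∑ j, |a j| := by positivity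
      calc _ ≤ (euclNorm (x - D *ᵥ a) + δ * (o / lam)) ^ 2 := by
            have := euclNorm_nonneg (x - D' *ᵥ a)
            gcongr
            linarith
        _ = euclNorm (x - D *ᵥ a) ^ 2 + 2 * euclNorm (x - D *ᵥ a) * (δ * (o / lam))
              + (δ * (o / lam)) ^ 2 := by ring
        _ ≤ _ := by
            have : 0 ≤ δ * (o / lam) := h7.trans h6
            gcongr
    refine (lassoVal_le hlam.le x D' a).trans ?_
    have h8 : g o = o + √(2 * o) * (δ * (o / lam)) + 1 / 2 * (δ * (o / lam)) ^ 2 := by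
      simp only [hg]; field_simp
    rw [h8]
    have h9 : o = 1 / 2 * ((x - D *ᵥ a) ⬝ᵥ (x - D *ᵥ a)) + lam * ∑ j, |a j| := by
      rw [ho, lassoObj, sqNorm_eq_dot]
    rw [lassoObj, sqNorm_eq_dot]
    linarith
  -- Attainment of the infimum is not used: the bound holds for every value above it and passes to
  -- the limit by continuity of g.
  have h2 : ∀ o, lassoVal lam x D < o → lassoVal lam x D' ≤ g o := by
    intro o ho
    obtain ⟨a, ha⟩ := exists_lt_of_ciInf_lt ho
    exact (key a).trans (hgm _ _ (lassoObj_nonneg hlam.le x D a) ha.le)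
  have ht : Filter.Tendsto g (nhdsWithin (lassoVal lam x D) (Set.Ioi (lassoVal lam x D)))
      (nhds (g (lassoVal lam x D))) := (hgc.tendsto _).mono_left nhdsWithin_le_nhds
  refine ge_of_tendsto ht ?_
  filter_upwards [self_mem_nhdsWithin] with o ho using h2 o ho

end Lasso

/-! ### Dictionaries, restricted isometry and the curve -/

section Dictionary

variable {m p : ℕ}

lemma euclNorm_mulVec_le (D : Matrix (Fin m) (Fin p) ℝ) (z : Fin p → ℝ) :
    euclNorm (D *ᵥ z) ≤ opNorm D * euclNorm z :=
  (LinearMap.toContinuousLinearMap (Matrix.toEuclideanLin D)).le_opNorm (WithLp.toLp 2 z)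

lemma opNorm_nonneg (D : Matrix (Fin m) (Fin p) ℝ) : 0 ≤ opNorm D := norm_nonneg _

lemma euclNorm_transpose_mulVec_le (D : Matrix (Fin m) (Fin p) ℝ) (w : Fin m → ℝ) :
    euclNorm (Dᵀ *ᵥ w) ≤ opNorm D * euclNorm w := by
  by_cases h0 : euclNorm (Dᵀ *ᵥ w) = 0
  · rw [h0]; exact mul_nonneg (opNorm_nonneg D) (euclNorm_nonneg w)
  have h1 : (Dᵀ *ᵥ w) ⬝ᵥ (Dᵀ *ᵥ w) = w ⬝ᵥ (D *ᵥ (Dᵀ *ᵥ w)) := (dot_mulVec_eq D _ _).symm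
  have h2 : euclNorm (Dᵀ *ᵥ w) * euclNorm (Dᵀ *ᵥ w)
      ≤ opNorm D * euclNorm w * euclNorm (Dᵀ *ᵥ w) := by
    rw [← sq, euclNorm_sq, h1]
    refine (le_abs_self _).trans ((abs_dot_le _ _).trans ?_)
    have := mul_le_mul_of_nonneg_left (euclNorm_mulVec_le D (Dᵀ *ᵥ w)) (euclNorm_nonneg w)
    linarith
  exact le_of_mul_le_mul_right h2 (lt_of_le_of_ne (euclNorm_nonneg _) (Ne.symm h0))

lemma IsDictionary.unit {D : Matrix (Fin m) (Fin p) ℝ} (h : IsDictionary D) (j : Fin p) :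
    Dᵀ j ⬝ᵥ Dᵀ j = 1 := by
  rw [← sqNorm_eq_dot]; exact h j

lemma IsDictionary.one_le_opNorm {D : Matrix (Fin m) (Fin p) ℝ} (h : IsDictionary D)
    (j : Fin p) : 1 ≤ opNorm D := by
  have h1 : euclNorm (Dᵀ j) = 1 :=
    euclNorm_eq_of_dot zero_le_one (by rw [h.unit]; norm_num)
  have h2 := euclNorm_transpose_mulVec_le D (Dᵀ j)
  have h3 := abs_le_euclNorm (Dᵀ *ᵥ Dᵀ j) j
  have h4 : (Dᵀ *ᵥ Dᵀ j) j = 1 := h.unit j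
  rw [h4, abs_one] at h3
  rw [h1, mul_one] at h2
  exact h3.trans h2

lemma IsDictionary.isCoherentDict {D : Matrix (Fin m) (Fin p) ℝ} (h : IsDictionary D) :
    IsCoherentDict D (coherence D) where
  unit := h.unit
  off i j hij := le_ciSup
    (f := fun q : {q : Fin p × Fin p // q.1 ≠ q.2} => |∑ i, D i q.1.1 * D i q.1.2|)
    (Set.finite_range _).bddAbove ⟨(i, j), hij⟩

lemma coherence_nonneg (D : Matrix (Fin m) (Fin p) ℝ) : 0 ≤ coherence D :=
  Real.iSup_nonneg fun _ => abs_nonneg _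

lemma isCoherentDict_subDict_quadratic {D : Matrix (Fin m) (Fin p) ℝ} {μ : ℝ}
    (h : IsCoherentDict D μ) (hμ : 0 ≤ μ) (J : Finset (Fin p)) (z : J → ℝ) :
    |(subDict D J *ᵥ z) ⬝ᵥ (subDict D J *ᵥ z) - z ⬝ᵥ z| ≤ J.card * μ * (z ⬝ᵥ z) := by
  have h1 := (h.gram J).quadratic_le hμ z
  rw [dot_mulVec_eq (subDict D J), mulVec_mulVec, dotProduct_comm _ z]
  simpa using h1

lemma eq_extendZero {J : Finset (Fin p)} {z : Fin p → ℝ} (hz : ∀ j, j ∉ J → z j = 0) :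
    z = extendZero (J := J) fun j => z j := by
  ext j
  by_cases h : j ∈ J <;> simp [extendZero, h, hz]

lemma sqNorm_extendZero {J : Finset (Fin p)} (a : J → ℝ) :
    sqNorm (extendZero a) = a ⬝ᵥ a := by
  rw [dot_self_eq_sum]
  exact sum_extendZero a (fun _ z => z ^ 2) (by simp)

lemma IsDictionary.mem_ripSet {D : Matrix (Fin m) (Fin p) ℝ} (h : IsDictionary D) (k : ℕ) :
    (k * coherence D) ∈ {δ : ℝ | ∀ J : Finset (Fin p), J.card = k → ∀ z : Fin p → ℝ,
      (∀ j, j ∉ J → z j = 0) →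
      (1 - δ) * sqNorm z ≤ sqNorm (D *ᵥ z) ∧ sqNorm (D *ᵥ z) ≤ (1 + δ) * sqNorm z} := by
  intro J hJ z hz
  rw [eq_extendZero hz, mulVec_extendZero, sqNorm_extendZero, sqNorm_eq_dot]
  have := isCoherentDict_subDict_quadratic h.isCoherentDict (coherence_nonneg D) J fun j => z j
  rw [hJ, abs_le] at this
  constructor <;> linarith [this.1, this.2]

/-- The infimum needs a set bounded below: a coordinate vector supported in J shows that every
admissible δ is nonnegative. -/
lemma IsDictionary.ripConst_le {D : Matrix (Fin m) (Fin p) ℝ} (h : IsDictionary D) {k : ℕ}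
    (hk : 1 ≤ k) {J : Finset (Fin p)} (hJ : J.card = k) : ripConst D k ≤ k * coherence D := by
  refine csInf_le ⟨0, ?_⟩ (h.mem_ripSet k)
  intro δ hδ
  obtain ⟨j, hj⟩ := Finset.card_pos.1 (hJ ▸ hk : 0 < J.card)
  have h1 := hδ J hJ (Pi.single j 1) (fun i hi => by
    rw [Pi.single_apply, if_neg]; rintro rfl; exact hi hj)
  have h2 : sqNorm (Pi.single j 1 : Fin p → ℝ) = 1 := by
    rw [sqNorm_eq_dot, single_dotProduct]; simp
  rw [h2] at h1
  linarith [h1.1, h1.2]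

/-- The infimum keeps the lower isometry inequality, since 1 - |Da|²/|a|² lies below every
admissible δ. -/
lemma IsDictionary.ripConst_mul_le {D : Matrix (Fin m) (Fin p) ℝ} (h : IsDictionary D) {k : ℕ}
    {J : Finset (Fin p)} (hJ : J.card = k) (a : J → ℝ) :
    (1 - ripConst D k) * (a ⬝ᵥ a) ≤ (subDict D J *ᵥ a) ⬝ᵥ (subDict D J *ᵥ a) := by
  rcases (dot_self_nonneg a).eq_or_lt with h0 | h0
  · rw [← h0, mul_zero]; exact dot_self_nonneg _
  have h1 : 1 - (subDict D J *ᵥ a) ⬝ᵥ (subDict D J *ᵥ a) / (a ⬝ᵥ a) ≤ ripConst D k := by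
    refine le_csInf ⟨_, h.mem_ripSet k⟩ fun δ hδ => ?_
    have h2 := (hδ J hJ (extendZero a) (fun j hj => by simp [extendZero, hj])).1
    rw [mulVec_extendZero, sqNorm_extendZero, sqNorm_eq_dot] at h2
    rw [sub_le_comm, le_div_iff₀ h0]
    exact h2
  have h3 := mul_le_mul_of_nonneg_right h1 h0.le
  rw [sub_mul, div_mul_cancel₀ _ h0.ne'] at h3
  linarith

/-- The data shared by the estimates along a curve of dictionaries. -/
structure CurveData (D₀ W : Matrix (Fin m) (Fin p) ℝ) (v : Fin p → ℝ) (t : ℝ) (k : ℕ) : Prop where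
  dict : IsDictionary D₀
  dir : W ∈ directions D₀
  sphere : v ∈ unitSphere p
  one_le : 1 ≤ k
  pos : 0 < t
  small : k * coherenceAt D₀ t < 1 / 2

variable {D₀ W : Matrix (Fin m) (Fin p) ℝ} {v : Fin p → ℝ} {t : ℝ} {k : ℕ}

lemma coherenceAt_pos (ht : 0 < t) : 0 < coherenceAt D₀ t := by
  have := coherence_nonneg D₀
  rw [coherenceAt]; positivity

/-- The summand 3t of μ(t) alone gives 3kt < 1/2; the later smallness of t comes from here. -/
lemma mul_lt_of_small (hk : 1 ≤ k) (h : k * coherenceAt D₀ t < 1 / 2) :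
    k * t < 1 / 6 := by
  have := coherence_nonneg D₀
  rw [coherenceAt] at h
  have hk0 : (1 : ℝ) ≤ k := by exact_mod_cast hk
  nlinarith [mul_nonneg (zero_le_one.trans hk0) this]

lemma lt_of_small (hk : 1 ≤ k) (h : k * coherenceAt D₀ t < 1 / 2) : t < 1 / 6 := by
  have h1 := mul_lt_of_small hk h
  have hk0 : (1 : ℝ) ≤ k := by exact_mod_cast hk
  nlinarith

lemma constQ_sq (h : k * coherenceAt D₀ t < 1 / 2) :
    constQ D₀ k t ^ 2 = 1 / (1 - k * coherenceAt D₀ t) := by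
  rw [constQ, div_pow, one_pow, Real.sq_sqrt (by linarith)]

lemma one_le_constQ_sq (ht : 0 < t) (h : k * coherenceAt D₀ t < 1 / 2) :
    1 ≤ constQ D₀ k t ^ 2 := by
  rw [constQ_sq h, le_div_iff₀ (by linarith)]
  have : 0 ≤ k * coherenceAt D₀ t := mul_nonneg (by positivity) (coherenceAt_pos ht).le
  linarith

lemma constQ_sq_lt_two (h : k * coherenceAt D₀ t < 1 / 2) : constQ D₀ k t ^ 2 < 2 := by
  rw [constQ_sq h, div_lt_iff₀ (by linarith)]
  linarith

lemma curve_col (D₀ W : Matrix (Fin m) (Fin p) ℝ) (v : Fin p → ℝ) (t : ℝ) (j : Fin p) :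
    (curve D₀ W v t)ᵀ j = Real.cos (v j * t) • D₀ᵀ j + Real.sin (v j * t) • Wᵀ j := by
  ext i
  simp [curve, mul_comm]

namespace CurveData

lemma dot_dir (h : CurveData D₀ W v t k) (j : Fin p) : D₀ᵀ j ⬝ᵥ Wᵀ j = 0 := by
  rw [dotProduct_comm]; exact h.dir.1 j

lemma dir_unit (h : CurveData D₀ W v t k) (j : Fin p) : Wᵀ j ⬝ᵥ Wᵀ j = 1 := h.dir.2 j

lemma euclNorm_dir (h : CurveData D₀ W v t k) (j : Fin p) : euclNorm (Wᵀ j) = 1 :=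
  euclNorm_eq_of_dot zero_le_one (by rw [h.dir_unit]; norm_num)

lemma sum_sq (h : CurveData D₀ W v t k) : ∑ j, v j ^ 2 = 1 := h.sphere

lemma abs_le_one (h : CurveData D₀ W v t k) (j : Fin p) : |v j| ≤ 1 := by
  rw [abs_le_one_iff_mul_self_le_one, ← sq, ← h.sum_sq]
  exact Finset.single_le_sum (f := fun j => v j ^ 2) (fun i _ => sq_nonneg _) (Finset.mem_univ j)

lemma sum_abs_le (h : CurveData D₀ W v t k) : ∑ j, |v j| ≤ √p := by
  have h1 := sum_abs_le_sqrt_card_mul v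
  have h2 : euclNorm v = 1 :=
    euclNorm_eq_of_dot zero_le_one (by rw [dot_self_eq_sum, h.sum_sq]; norm_num)
  simpa [h2] using h1

lemma abs_arg_le (h : CurveData D₀ W v t k) (j : Fin p) : |v j * t| ≤ 1 / 6 := by
  rw [abs_mul, abs_of_pos h.pos]
  have := lt_of_small h.one_le h.small
  nlinarith [h.abs_le_one j, h.pos]

lemma cos_ge (h : CurveData D₀ W v t k) (j : Fin p) : 71 / 72 ≤ Real.cos (v j * t) := by
  have h1 := Real.one_sub_sq_div_two_le_cos (x := v j * t)
  have h2 := sq_le_sq' (abs_le.1 (h.abs_arg_le j)).1 (abs_le.1 (h.abs_arg_le j)).2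
  linarith

lemma cos_pos (h : CurveData D₀ W v t k) (j : Fin p) : 0 < Real.cos (v j * t) :=
  lt_of_lt_of_le (by norm_num) (h.cos_ge j)

/-- The factor 11/10 is a round bound for 72/71, the reciprocal of the lower bound on the cosine. -/
lemma abs_tan_le (h : CurveData D₀ W v t k) (j : Fin p) :
    |Real.tan (v j * t)| ≤ 11 / 10 * (t * |v j|) := by
  rw [Real.tan_eq_sin_div_cos, abs_div, abs_of_pos (h.cos_pos j), div_le_iff₀ (h.cos_pos j)]
  have h1 : |Real.sin (v j * t)| ≤ |v j * t| := Real.abs_sin_le_abs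
  rw [abs_mul, abs_of_pos h.pos] at h1
  have h2 : 0 ≤ t * |v j| := mul_nonneg h.pos.le (abs_nonneg _)
  nlinarith [h.cos_ge j]

lemma sq_le_tan_sq (h : CurveData D₀ W v t k) (j : Fin p) :
    (v j * t) ^ 2 ≤ Real.tan (v j * t) ^ 2 := by
  have key : ∀ x : ℝ, 0 ≤ x → x ≤ 1 / 6 → x ^ 2 ≤ Real.tan x ^ 2 := by
    intro x hx hx6
    have := Real.le_tan hx (by linarith [Real.pi_gt_three])
    gcongr
  have h1 := h.abs_arg_le j
  rcases abs_cases (v j * t) with ⟨h2, h3⟩ | ⟨h2, h3⟩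
  · exact key _ h3 (by linarith)
  · have := key (-(v j * t)) (by linarith) (by linarith)
    rwa [Real.tan_neg, neg_sq, neg_sq] at this

lemma unit (h : CurveData D₀ W v t k) (j : Fin p) :
    (curve D₀ W v t)ᵀ j ⬝ᵥ (curve D₀ W v t)ᵀ j = 1 := by
  rw [curve_col]
  simp only [add_dotProduct, dotProduct_add, smul_dotProduct, dotProduct_smul, smul_eq_mul,
    h.dict.unit, h.dir_unit, h.dot_dir, dotProduct_comm (Wᵀ j) (D₀ᵀ j)]
  linarith [Real.sin_sq_add_cos_sq (v j * t)]

lemma col_dot_dir (h : CurveData D₀ W v t k) (j : Fin p) :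
    (curve D₀ W v t)ᵀ j ⬝ᵥ Wᵀ j = Real.sin (v j * t) := by
  rw [curve_col]
  simp [add_dotProduct, h.dir_unit, h.dot_dir]

/-- The squared distance is 2 - 2 cos(v j t) ≤ (v j t)². -/
lemma euclNorm_sub_col (h : CurveData D₀ W v t k) (j : Fin p) :
    euclNorm ((curve D₀ W v t - D₀)ᵀ j) ≤ t * |v j| := by
  apply euclNorm_le_of_dot (mul_nonneg h.pos.le (abs_nonneg _))
  have h1 : (curve D₀ W v t - D₀)ᵀ j
      = (Real.cos (v j * t) - 1) • D₀ᵀ j + Real.sin (v j * t) • Wᵀ j := by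
    have : (curve D₀ W v t - D₀)ᵀ j = (curve D₀ W v t)ᵀ j - D₀ᵀ j := rfl
    rw [this, curve_col, sub_smul, one_smul]; abel
  rw [h1]
  simp only [add_dotProduct, dotProduct_add, smul_dotProduct, dotProduct_smul, smul_eq_mul,
    h.dict.unit, h.dir_unit, h.dot_dir, dotProduct_comm (Wᵀ j) (D₀ᵀ j)]
  rw [mul_pow, sq_abs]
  have h2 := Real.one_sub_sq_div_two_le_cos (x := v j * t)
  linarith [Real.sin_sq_add_cos_sq (v j * t)]

lemma euclNorm_sub_col_le (h : CurveData D₀ W v t k) (j : Fin p) :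
    euclNorm ((curve D₀ W v t - D₀)ᵀ j) ≤ t :=
  (h.euclNorm_sub_col j).trans (mul_le_of_le_one_right h.pos.le (h.abs_le_one j))

lemma coherent_zero (h : CurveData D₀ W v t k) : IsCoherentDict D₀ (coherenceAt D₀ t) :=
  h.dict.isCoherentDict.mono (by rw [coherenceAt]; linarith [h.pos])

lemma gram_sub (i j : Fin p) :
    (curve D₀ W v t)ᵀ i ⬝ᵥ (curve D₀ W v t)ᵀ j - D₀ᵀ i ⬝ᵥ D₀ᵀ j
      = (curve D₀ W v t - D₀)ᵀ i ⬝ᵥ (curve D₀ W v t)ᵀ j + D₀ᵀ i ⬝ᵥ (curve D₀ W v t - D₀)ᵀ j := by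
  have : ∀ i, (curve D₀ W v t - D₀)ᵀ i = (curve D₀ W v t)ᵀ i - D₀ᵀ i := fun i => rfl
  rw [this, this, sub_dotProduct, dotProduct_sub]; ring

/-- Moving two unit atoms by at most t each changes their inner product by at most 2t, within the 3t
of `coherenceAt`. -/
lemma coherent (h : CurveData D₀ W v t k) :
    IsCoherentDict (curve D₀ W v t) (coherenceAt D₀ t) where
  unit := h.unit
  off i j hij := by
    have h1 := gram_sub (D₀ := D₀) (W := W) (v := v) (t := t) i j
    have h2 := h.dict.isCoherentDict.off i j hij
    have h3 := abs_dot_le ((curve D₀ W v t - D₀)ᵀ i) ((curve D₀ W v t)ᵀ j)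
    have h4 := abs_dot_le (D₀ᵀ i) ((curve D₀ W v t - D₀)ᵀ j)
    have h5 : euclNorm ((curve D₀ W v t)ᵀ j) = 1 :=
      euclNorm_eq_of_dot zero_le_one (by rw [h.unit]; norm_num)
    rw [h5, mul_one] at h3
    rw [h.dict.isCoherentDict.euclNorm_eq, one_mul] at h4
    have h6 : (curve D₀ W v t)ᵀ i ⬝ᵥ (curve D₀ W v t)ᵀ j = D₀ᵀ i ⬝ᵥ D₀ᵀ j
      + ((curve D₀ W v t - D₀)ᵀ i ⬝ᵥ (curve D₀ W v t)ᵀ j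
        + D₀ᵀ i ⬝ᵥ (curve D₀ W v t - D₀)ᵀ j) := by rw [← h1]; ring
    rw [h6, coherenceAt]
    have h7 := abs_add_le (D₀ᵀ i ⬝ᵥ D₀ᵀ j) ((curve D₀ W v t - D₀)ᵀ i ⬝ᵥ (curve D₀ W v t)ᵀ j
        + D₀ᵀ i ⬝ᵥ (curve D₀ W v t - D₀)ᵀ j)
    have h8 := abs_add_le ((curve D₀ W v t - D₀)ᵀ i ⬝ᵥ (curve D₀ W v t)ᵀ j)
      (D₀ᵀ i ⬝ᵥ (curve D₀ W v t - D₀)ᵀ j)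
    linarith [h.euclNorm_sub_col_le i, h.euclNorm_sub_col_le j, h.pos]

/-- The adjoint of the displacement moves a vector by at most `t` times its norm. -/
lemma euclNorm_sub_transpose_mulVec (h : CurveData D₀ W v t k) (w : Fin m → ℝ) :
    euclNorm ((curve D₀ W v t - D₀)ᵀ *ᵥ w) ≤ t * euclNorm w := by
  apply euclNorm_le_of_dot (mul_nonneg h.pos.le (euclNorm_nonneg _))
  rw [dot_self_eq_sum]
  calc ∑ j, ((curve D₀ W v t - D₀)ᵀ *ᵥ w) j ^ 2 ≤ ∑ j, (t * |v j| * euclNorm w) ^ 2 := by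
        refine Finset.sum_le_sum fun j _ => ?_
        rw [← sq_abs]
        have h1 : |((curve D₀ W v t - D₀)ᵀ *ᵥ w) j|
          ≤ euclNorm ((curve D₀ W v t - D₀)ᵀ j) * euclNorm w := abs_dot_le _ _
        have := mul_le_mul_of_nonneg_right (h.euclNorm_sub_col j) (euclNorm_nonneg w)
        exact pow_le_pow_left₀ (abs_nonneg _) (h1.trans this) 2
    _ = (t * euclNorm w) ^ 2 * ∑ j, v j ^ 2 := by
        rw [Finset.mul_sum]
        refine Finset.sum_congr rfl fun j _ => ?_
        rw [mul_pow, mul_pow, sq_abs]; ring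
    _ = _ := by rw [h.sum_sq, mul_one]

lemma euclNorm_transpose_mulVec (h : CurveData D₀ W v t k) (w : Fin m → ℝ) :
    euclNorm ((curve D₀ W v t)ᵀ *ᵥ w) ≤ (opNorm D₀ + t) * euclNorm w := by
  have h1 : (curve D₀ W v t)ᵀ *ᵥ w = D₀ᵀ *ᵥ w + (curve D₀ W v t - D₀)ᵀ *ᵥ w := by
    rw [transpose_sub, sub_mulVec]; abel
  rw [h1, add_mul]
  exact (euclNorm_add_le _ _).trans
    (add_le_add (euclNorm_transpose_mulVec_le _ _) (h.euclNorm_sub_transpose_mulVec w))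

lemma sum_abs_col_dot_le (h : CurveData D₀ W v t k) (w : Fin m → ℝ) :
    ∑ j, |(curve D₀ W v t)ᵀ j ⬝ᵥ w| ≤ √p * ((opNorm D₀ + t) * euclNorm w) := by
  have h1 := sum_abs_le_sqrt_card_mul ((curve D₀ W v t)ᵀ *ᵥ w)
  rw [Fintype.card_fin] at h1
  exact h1.trans (mul_le_mul_of_nonneg_left (h.euclNorm_transpose_mulVec w) (Real.sqrt_nonneg _))

/-- Cauchy–Schwarz pairs the coefficients with v, and |v| = 1, so no factor √k appears. -/
lemma euclNorm_sub_mulVec (h : CurveData D₀ W v t k) {J : Finset (Fin p)} (a : J → ℝ) :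
    euclNorm ((subDict (curve D₀ W v t) J - subDict D₀ J) *ᵥ a) ≤ t * euclNorm a := by
  have h1 : (subDict (curve D₀ W v t) J - subDict D₀ J) *ᵥ a
      = ∑ j, a j • (curve D₀ W v t - D₀)ᵀ j := by
    ext i
    simp [mulVec, dotProduct, Finset.sum_apply, mul_comm, subDict]
  rw [h1]
  refine (euclNorm_sum_le _).trans ?_
  calc ∑ j : J, euclNorm (a j • (curve D₀ W v t - D₀)ᵀ j)
      ≤ ∑ j : J, t * (|a j| * |v j|) := by
        refine Finset.sum_le_sum fun j _ => ?_
        rw [euclNorm_smul]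
        have := mul_le_mul_of_nonneg_left (h.euclNorm_sub_col j) (abs_nonneg (a j))
        linarith
    _ = t * ∑ j : J, |a j| * |v j| := by rw [Finset.mul_sum]
    _ ≤ t * euclNorm a := by
        refine mul_le_mul_of_nonneg_left ?_ h.pos.le
        apply le_of_sq_le_sq _ (euclNorm_nonneg _)
        rw [euclNorm_sq, dot_self_eq_sum]
        refine (Finset.sum_mul_sq_le_sq_mul_sq _ _ _).trans ?_
        simp only [sq_abs]
        have h2 : ∑ j : J, v j ^ 2 ≤ 1 := by
          rw [← h.sum_sq, ← Finset.sum_subtype J (fun x => Iff.rfl) (f := fun j => v j ^ 2)]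
          exact Finset.sum_le_sum_of_subset_of_nonneg (Finset.subset_univ J)
            fun i _ _ => sq_nonneg _
        exact mul_le_of_le_one_right (Finset.sum_nonneg fun i _ => sq_nonneg _) h2

lemma sqrt_sub_pos (h : CurveData D₀ W v t k) {J : Finset (Fin p)} (hJ : J.card = k) :
    0 < √(1 - ripConst D₀ k) - t := by
  have h1 := h.dict.ripConst_le h.one_le hJ
  have h2 := lt_of_small h.one_le h.small
  have h3 := h.small
  rw [coherenceAt, mul_add] at h3
  have h4 : (0 : ℝ) ≤ k * (3 * t) := by have := h.pos; positivity
  have : t < √(1 - ripConst D₀ k) := by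
    apply Real.lt_sqrt_of_sq_lt
    nlinarith [h.pos]
  linarith

/-- Restricted isometry at D₀ minus a displacement of norm at most t; the factor is the reciprocal
of `constC`. -/
lemma subDict_lower (h : CurveData D₀ W v t k) {J : Finset (Fin p)} (hJ : J.card = k)
    (a : J → ℝ) :
    (√(1 - ripConst D₀ k) - t) * euclNorm a ≤ euclNorm (subDict (curve D₀ W v t) J *ᵥ a) := by
  have h1 : √(1 - ripConst D₀ k) * euclNorm a ≤ euclNorm (subDict D₀ J *ᵥ a) := by
    have h2 := h.sqrt_sub_pos hJ
    have h3 : 0 < √(1 - ripConst D₀ k) := by linarith [h.pos]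
    apply le_of_sq_le_sq _ (euclNorm_nonneg _)
    rw [mul_pow, Real.sq_sqrt (Real.sqrt_pos.1 h3).le, euclNorm_sq, euclNorm_sq]
    exact h.dict.ripConst_mul_le hJ a
  have h2 : subDict D₀ J *ᵥ a = subDict (curve D₀ W v t) J *ᵥ a
      - (subDict (curve D₀ W v t) J - subDict D₀ J) *ᵥ a := by
    rw [sub_mulVec]; abel
  have h3 := euclNorm_sub_le (subDict (curve D₀ W v t) J *ᵥ a)
    ((subDict (curve D₀ W v t) J - subDict D₀ J) *ᵥ a)
  rw [← h2] at h3
  linarith [h.euclNorm_sub_mulVec a]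

end CurveData

end Dictionary

/-! ### Averages over the random support -/

section SupportAverage

variable {p k : ℕ} {π : PMF (Finset (Fin p))}

/-- The average of `F` over a random support. -/
noncomputable def supportAvg (π : PMF (Finset (Fin p))) (F : Finset (Fin p) → ℝ) : ℝ :=
  ∑ J, (π J).toReal * F J

lemma supportAvg_add (F H : Finset (Fin p) → ℝ) :
    supportAvg π (fun J => F J + H J) = supportAvg π F + supportAvg π H := by
  simp [supportAvg, mul_add, Finset.sum_add_distrib]

lemma supportAvg_sub (F H : Finset (Fin p) → ℝ) :
    supportAvg π (fun J => F J - H J) = supportAvg π F - supportAvg π H := by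
  simp [supportAvg, mul_sub, Finset.sum_sub_distrib]

lemma supportAvg_const_mul (c : ℝ) (F : Finset (Fin p) → ℝ) :
    supportAvg π (fun J => c * F J) = c * supportAvg π F := by
  simp only [supportAvg, Finset.mul_sum]
  exact Finset.sum_congr rfl fun J _ => by ring

lemma supportAvg_one (π : PMF (Finset (Fin p))) : ∑ J, (π J).toReal = 1 := by
  rw [← ENNReal.toReal_sum (fun J _ => π.apply_ne_top J), ← tsum_fintype (L := .unconditional _),
    π.tsum_coe, ENNReal.toReal_one]

lemma supportAvg_const (c : ℝ) : supportAvg π (fun _ => c) = c := by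
  rw [supportAvg, ← Finset.sum_mul, supportAvg_one, one_mul]

lemma IsSupportLaw.avg_mono (hπ : IsSupportLaw π k) {F H : Finset (Fin p) → ℝ}
    (h : ∀ J, J.card = k → F J ≤ H J) : supportAvg π F ≤ supportAvg π H := by
  refine Finset.sum_le_sum fun J _ => ?_
  by_cases h0 : π J = 0
  · simp [h0]
  · exact mul_le_mul_of_nonneg_left (h J (hπ.card_eq J h0)) ENNReal.toReal_nonneg

lemma IsSupportLaw.exists_card (hπ : IsSupportLaw π k) : ∃ J : Finset (Fin p), J.card = k := by
  by_contra! h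
  have h1 := supportAvg_one π
  rw [Finset.sum_eq_zero] at h1
  · exact zero_ne_one h1
  · intro J _
    have : π J = 0 := by
      by_contra h0
      exact h J (hπ.card_eq J h0)
    simp [this]

lemma IsSupportLaw.le (hπ : IsSupportLaw π k) : k ≤ p := by
  obtain ⟨J, rfl⟩ := hπ.exists_card
  simpa using Finset.card_le_univ J

lemma IsSupportLaw.avg_sum (hπ : IsSupportLaw π k) (f : Fin p → ℝ) :
    supportAvg π (fun J => ∑ i ∈ J, f i) = k / p * ∑ i, f i := by
  have h1 : ∀ J : Finset (Fin p), ∑ i ∈ J, f i = ∑ i, if i ∈ J then f i else 0 := by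
    intro J; rw [Finset.sum_ite_mem, Finset.univ_inter]
  simp only [supportAvg, h1, Finset.mul_sum]
  rw [Finset.sum_comm]
  refine Finset.sum_congr rfl fun i _ => ?_
  rw [← hπ.prob_mem i, Finset.sum_filter, Finset.sum_mul]
  exact Finset.sum_congr rfl fun J _ => by split_ifs <;> simp

/-- A pair of distinct indices is selected with probability k(k - 1)/(p(p - 1)) ≤ (k/p)². The double
sum over J is thus replaced by one over the whole matrix, where the spectral norm can act. -/
lemma IsSupportLaw.avg_sum_pairs_le (hπ : IsSupportLaw π k) (hk : 1 ≤ k) {g : Fin p → Fin p → ℝ}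
    (hg : ∀ i j, 0 ≤ g i j) :
    supportAvg π (fun J => ∑ i ∈ J, ∑ j ∈ J with j ≠ i, g i j)
      ≤ ((k : ℝ) / p) ^ 2 * ∑ i, ∑ j, g i j := by
  have hkp := hπ.le
  have hp : 1 ≤ p := hk.trans hkp
  have h1 : ∀ J : Finset (Fin p), ∑ i ∈ J, ∑ j ∈ J with j ≠ i, g i j
      = ∑ i, ∑ j, if i ∈ J ∧ j ∈ J ∧ j ≠ i then g i j else 0 := by
    intro J
    rw [← Finset.univ_inter J, ← Finset.sum_ite_mem, Finset.univ_inter]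
    refine Finset.sum_congr rfl fun i _ => ?_
    by_cases hi : i ∈ J
    · simp only [hi, if_true, true_and, Finset.sum_filter]
      rw [← Finset.univ_inter J, ← Finset.sum_ite_mem, Finset.univ_inter]
      refine Finset.sum_congr rfl fun j _ => ?_
      by_cases hj : j ∈ J <;> simp [hj]
    · simp [hi]
  have h2 : (k : ℝ) * (k - 1) / (p * (p - 1)) ≤ ((k : ℝ) / p) ^ 2 := by
    have hk' : (1 : ℝ) ≤ k := by exact_mod_cast hk
    have hp' : (1 : ℝ) ≤ p := by exact_mod_cast hp
    have hkp' : (k : ℝ) ≤ p := by exact_mod_cast hkp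
    rcases hp'.eq_or_lt with h | h
    -- For p = 1 the denominator p(p - 1) is 0 and the quotient has the default value 0.
    · rw [← h]; norm_num
    · rw [div_pow, div_le_div_iff₀ (by nlinarith) (by positivity)]
      have h3 : (0 : ℝ) ≤ k * p := by positivity
      have h4 : (k : ℝ) * (k - 1) * p ^ 2 = k * p * ((k - 1) * p) := by ring
      have h5 : (k : ℝ) ^ 2 * (p * (p - 1)) = k * p * (k * (p - 1)) := by ring
      rw [h4, h5]
      exact mul_le_mul_of_nonneg_left (by nlinarith) h3
  simp only [supportAvg, h1, Finset.mul_sum]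
  rw [Finset.sum_comm]
  refine Finset.sum_le_sum fun i _ => ?_
  rw [Finset.sum_comm]
  refine Finset.sum_le_sum fun j _ => ?_
  by_cases hij : j = i
  · simp only [hij, ne_eq, not_true_eq_false, and_false, if_false, mul_zero, Finset.sum_const_zero]
    exact mul_nonneg (by positivity) (hg i i)
  · have h3 : ∑ J, (π J).toReal * (if i ∈ J ∧ j ∈ J ∧ j ≠ i then g i j else 0)
        = (k : ℝ) * (k - 1) / (p * (p - 1)) * g i j := by
      rw [← hπ.prob_pair i j (Ne.symm hij), Finset.sum_filter, Finset.sum_mul]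
      exact Finset.sum_congr rfl fun J _ => by simp [hij]
    rw [h3]
    exact mul_le_mul_of_nonneg_right h2 (hg i j)

end SupportAverage

/-! ### Average geometry of the moved atoms -/

section CurveEstimates

variable {m p k : ℕ} {D₀ W : Matrix (Fin m) (Fin p) ℝ} {v : Fin p → ℝ} {t : ℝ}
  {J : Finset (Fin p)}

namespace CurveData

lemma card_mul_lt (h : CurveData D₀ W v t k) (hJ : J.card = k) :
    (J.card : ℝ) * coherenceAt D₀ t < 1 := by
  rw [hJ]; linarith [h.small]

lemma isUnit (h : CurveData D₀ W v t k) (hJ : J.card = k) :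
    IsUnit ((subDict (curve D₀ W v t) J)ᵀ * subDict (curve D₀ W v t) J).det :=
  h.coherent.isUnit (coherenceAt_pos h.pos).le (h.card_mul_lt hJ)

lemma isUnit_zero (h : CurveData D₀ W v t k) (hJ : J.card = k) :
    IsUnit ((subDict D₀ J)ᵀ * subDict D₀ J).det :=
  h.coherent_zero.isUnit (coherenceAt_pos h.pos).le (h.card_mul_lt hJ)

lemma constQ_eq (h : CurveData D₀ W v t k) (hJ : J.card = k) :
    1 / (1 - Fintype.card J * coherenceAt D₀ t) = constQ D₀ k t ^ 2 := by
  rw [constQ_sq h.small, Fintype.card_coe, hJ]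

/-- Modulo the moved atom, the original one is -tan(v j t) times its direction, so a projection off
the moved span sees only W. -/
lemma col_zero_eq (h : CurveData D₀ W v t k) (j : Fin p) :
    D₀ᵀ j = (1 / Real.cos (v j * t)) • (curve D₀ W v t)ᵀ j - Real.tan (v j * t) • Wᵀ j := by
  rw [curve_col, smul_add, smul_smul, smul_smul, Real.tan_eq_sin_div_cos,
    one_div_mul_cancel (h.cos_pos j).ne', one_smul, one_div_mul_eq_div]
  abel

lemma projCompl_col (h : CurveData D₀ W v t k) (hJ : J.card = k) (i : J) :
    projCompl (subDict (curve D₀ W v t) J) *ᵥ (curve D₀ W v t)ᵀ i = 0 := by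
  have h1 := projCompl_mul (h.isUnit hJ)
  ext a
  exact congrFun (congrFun h1 a) i

lemma inv_mulVec_col (h : CurveData D₀ W v t k) (hJ : J.card = k) (i : J) :
    ((((subDict (curve D₀ W v t) J)ᵀ * subDict (curve D₀ W v t) J)⁻¹
      * (subDict (curve D₀ W v t) J)ᵀ) *ᵥ (curve D₀ W v t)ᵀ i) i = 1 := by
  have h1 := nonsing_inv_mul _ (h.isUnit hJ)
  rw [← Matrix.mul_assoc] at h1
  have h2 := congrFun (congrFun h1 i) i
  rw [Matrix.one_apply_eq] at h2
  exact h2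

/-- With a = (AᵀA)⁻¹c one has |Aa|² = c·a; then |a| ≤ C_t|Aa| and Cauchy–Schwarz give |Aa| ≤ C_t|c|.
-/
lemma dot_inv_le (h : CurveData D₀ W v t k) (hJ : J.card = k) (c : J → ℝ) :
    c ⬝ᵥ (((subDict (curve D₀ W v t) J)ᵀ * subDict (curve D₀ W v t) J)⁻¹ *ᵥ c)
      ≤ constC D₀ k t ^ 2 * (c ⬝ᵥ c) := by
  set A := subDict (curve D₀ W v t) J with hA
  set a := (Aᵀ * A)⁻¹ *ᵥ c with ha
  have h1 : (A *ᵥ a) ⬝ᵥ (A *ᵥ a) = c ⬝ᵥ a := by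
    rw [dot_mulVec_eq A, mulVec_mulVec, ha, mulVec_mulVec, mul_nonsing_inv _ (h.isUnit hJ),
      one_mulVec]
  have hs := h.sqrt_sub_pos hJ
  have h2 : euclNorm a ≤ constC D₀ k t * euclNorm (A *ᵥ a) := by
    rw [constC, one_div, inv_mul_eq_div, le_div_iff₀ hs, mul_comm]
    exact h.subDict_lower hJ a
  have hC : 0 < constC D₀ k t := one_div_pos.2 hs
  have h3 : euclNorm (A *ᵥ a) ^ 2 ≤ euclNorm c * euclNorm a := by
    rw [euclNorm_sq, h1]
    exact (le_abs_self _).trans (abs_dot_le _ _)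
  have h4 : euclNorm (A *ᵥ a) ≤ constC D₀ k t * euclNorm c := by
    by_cases h0 : euclNorm (A *ᵥ a) = 0
    · rw [h0]; exact mul_nonneg hC.le (euclNorm_nonneg _)
    have h5 : euclNorm (A *ᵥ a) * euclNorm (A *ᵥ a)
        ≤ constC D₀ k t * euclNorm c * euclNorm (A *ᵥ a) := by
      have := mul_le_mul_of_nonneg_left h2 (euclNorm_nonneg c)
      nlinarith
    exact le_of_mul_le_mul_right h5 (lt_of_le_of_ne (euclNorm_nonneg _) (Ne.symm h0))
  rw [← h1, ← euclNorm_sq, ← euclNorm_sq, ← mul_pow]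
  exact pow_le_pow_left₀ (euclNorm_nonneg _) h4 2

/-- The part of an atom that leaves the span of the displaced atoms. -/
lemma dot_projCompl_ge (h : CurveData D₀ W v t k) (hJ : J.card = k) (i : J) :
    Real.tan (v i * t) ^ 2 * (1 - constC D₀ k t ^ 2
        * (√(∑ j ∈ J with j ≠ ↑i, (D₀ᵀ j ⬝ᵥ Wᵀ i) ^ 2) + t) ^ 2)
      ≤ D₀ᵀ i ⬝ᵥ (projCompl (subDict (curve D₀ W v t) J) *ᵥ D₀ᵀ i) := by
  set A := subDict (curve D₀ W v t) J with hA
  have hU := h.isUnit hJ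
  have h1 : projCompl A *ᵥ D₀ᵀ i = -(Real.tan (v i * t) • (projCompl A *ᵥ Wᵀ i)) := by
    rw [h.col_zero_eq i, mulVec_sub, mulVec_smul, mulVec_smul, h.projCompl_col hJ]
    simp
  have h2 : D₀ᵀ i ⬝ᵥ (projCompl A *ᵥ D₀ᵀ i)
      = Real.tan (v i * t) ^ 2 * (Wᵀ i ⬝ᵥ (projCompl A *ᵥ Wᵀ i)) := by
    rw [dot_projCompl hU, h1, dot_projCompl hU]
    simp only [neg_dotProduct, dotProduct_neg, smul_dotProduct, dotProduct_smul, smul_eq_mul]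
    ring
  have h3 : Wᵀ i ⬝ᵥ (projCompl A *ᵥ Wᵀ i)
      = 1 - (Aᵀ *ᵥ Wᵀ i) ⬝ᵥ ((Aᵀ * A)⁻¹ *ᵥ (Aᵀ *ᵥ Wᵀ i)) := by
    rw [projCompl, sub_mulVec, one_mulVec, dotProduct_sub, h.dir_unit, Matrix.mul_assoc,
      ← mulVec_mulVec, dot_mulVec_eq, ← mulVec_mulVec]
  rw [h2, h3]
  refine mul_le_mul_of_nonneg_left (sub_le_sub_left ?_ _) (sq_nonneg _)
  refine (h.dot_inv_le hJ _).trans (mul_le_mul_of_nonneg_left ?_ (sq_nonneg _))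
  rw [← euclNorm_sq]
  refine pow_le_pow_left₀ (euclNorm_nonneg _) ?_ 2
  have h4 : Aᵀ *ᵥ Wᵀ i = (subDict D₀ J)ᵀ *ᵥ Wᵀ i
      + (subDict (curve D₀ W v t - D₀) J)ᵀ *ᵥ Wᵀ i := by
    rw [← add_mulVec, ← transpose_add]
    congr 2
    ext a b
    simp [hA, subDict]
  rw [h4]
  refine (euclNorm_add_le _ _).trans (add_le_add ?_ ?_)
  · refine euclNorm_le_of_dot (Real.sqrt_nonneg _) ?_
    rw [Real.sq_sqrt (Finset.sum_nonneg fun _ _ => sq_nonneg _), dot_self_eq_sum]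
    have h5 : ∑ j : J, ((subDict D₀ J)ᵀ *ᵥ Wᵀ i) j ^ 2 = ∑ j ∈ J, (D₀ᵀ j ⬝ᵥ Wᵀ i) ^ 2 := by
      rw [← Finset.sum_attach J]; rfl
    rw [h5, ← Finset.add_sum_erase J _ i.2, ← Finset.filter_ne', h.dot_dir]
    simp
  · have h6 := h.euclNorm_sub_transpose_mulVec (Wᵀ i)
    rw [h.euclNorm_dir, mul_one] at h6
    refine le_trans ?_ h6
    refine euclNorm_le_of_dot (euclNorm_nonneg _) ?_
    rw [euclNorm_sq, dot_self_eq_sum, dot_self_eq_sum]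
    have h5 : ∑ j : J, ((subDict (curve D₀ W v t - D₀) J)ᵀ *ᵥ Wᵀ i) j ^ 2
        = ∑ j ∈ J, (((curve D₀ W v t - D₀)ᵀ *ᵥ Wᵀ i) j) ^ 2 := by
      rw [← Finset.sum_attach J]; rfl
    rw [h5]
    exact Finset.sum_le_sum_of_subset_of_nonneg (Finset.subset_univ J) fun i _ _ => sq_nonneg _

/-- The average energy of the atoms off the span of the displaced atoms. -/
lemma avg_projCompl_ge (h : CurveData D₀ W v t k) {π : PMF (Finset (Fin p))}
    (hπ : IsSupportLaw π k) :
    (1 - constK D₀ k t ^ 2) * (k / p) * t ^ 2 ≤ supportAvg π (fun J => ∑ i : J,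
      D₀ᵀ i ⬝ᵥ (projCompl (subDict (curve D₀ W v t) J) *ᵥ D₀ᵀ i)) := by
  have hkp := hπ.le
  have hk0 : (0 : ℝ) < k := by exact_mod_cast h.one_le
  have hp0 : (0 : ℝ) < p := by exact_mod_cast h.one_le.trans hkp
  -- If 1 - 𝒦² ≤ 0, the left side is nonpositive and the right side nonnegative. Otherwise its sign
  -- allows ∑ tan² to be replaced by the smaller t².
  rcases le_or_gt (1 - constK D₀ k t ^ 2) 0 with hK | hK
  · have h1 : (1 - constK D₀ k t ^ 2) * (k / p) * t ^ 2 ≤ 0 := by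
      rw [mul_assoc]
      exact mul_nonpos_of_nonpos_of_nonneg hK (by positivity)
    refine h1.trans ?_
    rw [← supportAvg_const (π := π) 0]
    refine hπ.avg_mono fun J hJ => Finset.sum_nonneg fun i _ => ?_
    rw [dot_projCompl (h.isUnit hJ)]
    exact dot_self_nonneg _
  set T : Fin p → ℝ := fun i => Real.tan (v i * t) ^ 2 with hT
  set C := constC D₀ k t with hC
  set N := opNorm D₀ with hN
  set β := N * √((k : ℝ) / p) with hβ
  have hN1 : 1 ≤ N := h.dict.one_le_opNorm ⟨0, h.one_le.trans hkp⟩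
  have hβ0 : 0 < β := mul_pos (by linarith) (Real.sqrt_pos.2 (by positivity))
  have hβsq : β ^ 2 = N ^ 2 * (k / p) := by
    rw [hβ, mul_pow, Real.sq_sqrt (by positivity)]
  have ht := h.pos
  have h1 : ∀ J : Finset (Fin p), J.card = k →
      ∑ i ∈ J, T i * (1 - C ^ 2 * (t * β + t ^ 2))
        - C ^ 2 * (1 + t / β) * ∑ i ∈ J, ∑ j ∈ J with j ≠ i, T i * (D₀ᵀ j ⬝ᵥ Wᵀ i) ^ 2
      ≤ ∑ i : J, D₀ᵀ i ⬝ᵥ (projCompl (subDict (curve D₀ W v t) J) *ᵥ D₀ᵀ i) := by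
    intro J hJ
    rw [← Finset.sum_attach J, Finset.mul_sum, ← Finset.sum_attach J (fun i => _ * _),
      ← Finset.sum_sub_distrib]
    refine Finset.sum_le_sum fun i _ => ?_
    refine le_trans ?_ (h.dot_projCompl_ge hJ i)
    rw [← Finset.mul_sum]
    set b := √(∑ j ∈ J with j ≠ ↑i, (D₀ᵀ j ⬝ᵥ Wᵀ i) ^ 2) with hb
    have hb2 : ∑ j ∈ J with j ≠ ↑i, (D₀ᵀ j ⬝ᵥ Wᵀ i) ^ 2 = b ^ 2 := by
      rw [hb, Real.sq_sqrt (Finset.sum_nonneg fun _ _ => sq_nonneg _)]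
    rw [hb2]
    -- AM–GM weighted by β = ‖D₀‖√(k/p), chosen because β² bounds b² on average: the right side then
    -- averages to at most (β + t)², and no mean of a square root has to be estimated.
    have h2 : (b + t) ^ 2 ≤ b ^ 2 * (1 + t / β) + (t * β + t ^ 2) := by
      have h3 : 2 * b ≤ b ^ 2 / β + β := by
        rw [div_add' _ _ _ hβ0.ne', le_div_iff₀ hβ0]
        nlinarith [sq_nonneg (b - β)]
      have h4 := mul_le_mul_of_nonneg_right h3 ht.le
      have h5 : b ^ 2 * (1 + t / β) = b ^ 2 + b ^ 2 / β * t := by ring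
      rw [h5]; linarith
    have h6 := mul_le_mul_of_nonneg_left h2 (mul_nonneg (sq_nonneg C) (sq_nonneg (Real.tan (v i * t))))
    simp only [hT]
    linarith
  refine le_trans ?_ (hπ.avg_mono h1)
  rw [supportAvg_sub, supportAvg_const_mul, hπ.avg_sum, ← Finset.sum_mul]
  have h2 := hπ.avg_sum_pairs_le h.one_le (g := fun i j => T i * (D₀ᵀ j ⬝ᵥ Wᵀ i) ^ 2)
    (fun i j => mul_nonneg (sq_nonneg _) (sq_nonneg _))
  have h3 : ∑ i, ∑ j, T i * (D₀ᵀ j ⬝ᵥ Wᵀ i) ^ 2 ≤ N ^ 2 * ∑ i, T i := by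
    rw [Finset.mul_sum]
    refine Finset.sum_le_sum fun i _ => ?_
    rw [← Finset.mul_sum, mul_comm]
    refine mul_le_mul_of_nonneg_right ?_ (sq_nonneg _)
    have h4 := euclNorm_transpose_mulVec_le D₀ (Wᵀ i)
    rw [h.euclNorm_dir, mul_one] at h4
    have h5 := pow_le_pow_left₀ (euclNorm_nonneg _) h4 2
    rw [euclNorm_sq, dot_self_eq_sum] at h5
    exact h5
  have hT1 : t ^ 2 ≤ ∑ i, T i := by
    calc t ^ 2 = ∑ i, (v i * t) ^ 2 := by
          simp only [mul_pow]; rw [← Finset.sum_mul, h.sum_sq, one_mul]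
      _ ≤ ∑ i, T i := Finset.sum_le_sum fun i _ => h.sq_le_tan_sq i
  set ST := ∑ i, T i with hST
  have hCb : 0 ≤ C ^ 2 * (1 + t / β) := by positivity
  have h7 := mul_le_mul_of_nonneg_left (h2.trans (mul_le_mul_of_nonneg_left h3 (sq_nonneg _))) hCb
  have h8 : C ^ 2 * (1 + t / β) * (((k : ℝ) / p) ^ 2 * (N ^ 2 * ST))
      = k / p * ST * (C ^ 2 * (β ^ 2 + t * β)) := by
    have : ((k : ℝ) / p) ^ 2 * (N ^ 2 * ST) = k / p * ST * β ^ 2 := by rw [hβsq]; ring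
    rw [this]; field_simp
  rw [h8] at h7
  have h9 : constK D₀ k t ^ 2 = C ^ 2 * (β ^ 2 + 2 * (t * β) + t ^ 2) := by
    rw [constK, mul_pow, ← hC, ← hN, ← hβ]; ring
  have h10 : (1 - constK D₀ k t ^ 2) * (k / p) * t ^ 2 ≤ (1 - constK D₀ k t ^ 2) * (k / p) * ST :=
    mul_le_mul_of_nonneg_left hT1 (mul_nonneg hK.le (by positivity))
  rw [h9] at h10 ⊢
  linarith

/-- The diagonal of the products of pseudo-inverses with the original atoms. -/
lemma trace_pinv_ge (h : CurveData D₀ W v t k) (hJ : J.card = k) :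
    -(∑ i ∈ J, (t ^ 2 * v i ^ 2) * (1 / 2 + 11 / 10 * (coherenceAt D₀ t * constQ D₀ k t ^ 2))
      + ∑ i ∈ J, ∑ j ∈ J with j ≠ i, coherenceAt D₀ t * constQ D₀ k t ^ 2
        * (11 / 10 * (t * |v i|)) * |(curve D₀ W v t)ᵀ j ⬝ᵥ Wᵀ i|)
    ≤ ∑ i : J, (((((subDict (curve D₀ W v t) J)ᵀ * subDict (curve D₀ W v t) J)⁻¹
      * (subDict (curve D₀ W v t) J)ᵀ) *ᵥ D₀ᵀ i) i - 1) := by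
  set A := subDict (curve D₀ W v t) J with hA
  set M := coherenceAt D₀ t * constQ D₀ k t ^ 2 with hM
  have hM0 : 0 ≤ M := mul_nonneg (coherenceAt_pos h.pos).le (sq_nonneg _)
  rw [← Finset.sum_add_distrib, ← Finset.sum_neg_distrib, ← Finset.sum_attach J]
  refine Finset.sum_le_sum fun i _ => ?_
  set x := v i * t with hx
  -- The pseudo-inverse has entry 1 at the atom's own index. Splitting off the identity from the
  -- inverse Gram matrix leaves cos x, which is only quadratically below 1, and a term with a factor
  -- μ.
  have h1 : (((Aᵀ * A)⁻¹ * Aᵀ) *ᵥ D₀ᵀ i) i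
      = 1 / Real.cos x - Real.tan x * (Real.sin x + (((Aᵀ * A)⁻¹ - 1) *ᵥ (Aᵀ *ᵥ Wᵀ i)) i) := by
    rw [h.col_zero_eq i, mulVec_sub, mulVec_smul, mulVec_smul, Pi.sub_apply, Pi.smul_apply,
      Pi.smul_apply, h.inv_mulVec_col hJ, smul_eq_mul, mul_one, smul_eq_mul]
    congr 2
    rw [sub_mulVec, one_mulVec, Pi.sub_apply, mulVec_mulVec]
    have : (Aᵀ *ᵥ Wᵀ i) i = Real.sin x := h.col_dot_dir i
    rw [this]; ring
  have h2 : |(((Aᵀ * A)⁻¹ - 1) *ᵥ (Aᵀ *ᵥ Wᵀ i)) i|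
      ≤ ∑ j ∈ J, M * |(curve D₀ W v t)ᵀ j ⬝ᵥ Wᵀ i| := by
    rw [← Finset.sum_attach J]
    refine (Finset.abs_sum_le_sum_abs _ _).trans (Finset.sum_le_sum fun j _ => ?_)
    rw [abs_mul]
    refine mul_le_mul_of_nonneg_right ?_ (abs_nonneg _)
    have := (h.coherent.gram J).abs_inv_sub_one_le (coherenceAt_pos h.pos).le
      (by simpa using h.card_mul_lt hJ) i j
    rwa [h.constQ_eq hJ] at this
  rw [← Finset.add_sum_erase J _ i.2, ← Finset.filter_ne', h.col_dot_dir, ← Finset.mul_sum] at h2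
  rw [← Finset.mul_sum, h1]
  set R := ∑ j ∈ J with j ≠ ↑i, |(curve D₀ W v t)ᵀ j ⬝ᵥ Wᵀ i| with hR
  have hR0 : 0 ≤ R := Finset.sum_nonneg fun _ _ => abs_nonneg _
  have htan := h.abs_tan_le i
  have hsin : |Real.sin x| ≤ t * |v i| := by
    calc |Real.sin x| ≤ |x| := Real.abs_sin_le_abs
      _ = t * |v i| := by rw [hx, abs_mul, abs_of_pos h.pos, mul_comm]
  have h3 : 1 / Real.cos x - Real.tan x * Real.sin x = Real.cos x := by
    rw [Real.tan_eq_sin_div_cos]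
    rw [div_mul_eq_mul_div, ← sub_div, div_eq_iff (h.cos_pos i).ne']
    linarith [Real.sin_sq_add_cos_sq x]
  have h4 := Real.one_sub_sq_div_two_le_cos (x := x)
  have h5 : x ^ 2 = t ^ 2 * v i ^ 2 := by rw [hx]; ring
  have h6 : Real.tan x * (((Aᵀ * A)⁻¹ - 1) *ᵥ (Aᵀ *ᵥ Wᵀ i)) i
      ≤ 11 / 10 * (t * |v i|) * (M * (t * |v i|) + M * R) := by
    refine (le_abs_self _).trans ?_
    rw [abs_mul]
    refine mul_le_mul htan (h2.trans ?_) (abs_nonneg _) ((abs_nonneg _).trans htan)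
    have := mul_le_mul_of_nonneg_left hsin hM0
    linarith
  have h7 : (t * |v i|) * (t * |v i|) = t ^ 2 * v i ^ 2 := by
    rw [← sq_abs (v i)]; ring
  have h8 : 11 / 10 * (t * |v i|) * (M * (t * |v i|) + M * R)
      = 11 / 10 * M * (t ^ 2 * v i ^ 2) + M * (11 / 10 * (t * |v i|)) * R := by
    rw [← h7]; ring
  rw [h8] at h6
  rw [mul_add]
  linarith

lemma avg_trace_pinv_ge (h : CurveData D₀ W v t k) {π : PMF (Finset (Fin p))}
    (hπ : IsSupportLaw π k) :
    -(3 * constQ D₀ k t ^ 2 * (t * (k / p) * opNorm D₀ * (k * coherenceAt D₀ t)))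
    ≤ supportAvg π (fun J =>
      ∑ i : J, (((((subDict (curve D₀ W v t) J)ᵀ * subDict (curve D₀ W v t) J)⁻¹
      * (subDict (curve D₀ W v t) J)ᵀ) *ᵥ D₀ᵀ i) i - 1)) := by
  refine le_trans ?_ (hπ.avg_mono fun J hJ => h.trace_pinv_ge hJ)
  have hneg : ∀ F : Finset (Fin p) → ℝ, supportAvg π (fun J => -F J) = -supportAvg π F := by
    intro F; simp [supportAvg]
  rw [hneg, neg_le_neg_iff, supportAvg_add, hπ.avg_sum]
  have hkp := hπ.le
  have hk1 : (1 : ℝ) ≤ k := by exact_mod_cast h.one_le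
  have hp0 : (0 : ℝ) < p := by exact_mod_cast h.one_le.trans hkp
  set N := opNorm D₀ with hN
  have hN1 : 1 ≤ N := h.dict.one_le_opNorm ⟨0, h.one_le.trans hkp⟩
  set μ := coherenceAt D₀ t with hμ
  have hμ0 : 0 < μ := coherenceAt_pos h.pos
  set q := constQ D₀ k t ^ 2 with hq
  have hq1 : 1 ≤ q := one_le_constQ_sq h.pos h.small
  have ht := h.pos
  have ht6 := lt_of_small h.one_le h.small
  have hμt : 3 * t ≤ μ := by rw [hμ, coherenceAt]; linarith [coherence_nonneg D₀]
  have h1 := hπ.avg_sum_pairs_le h.one_le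
    (g := fun i j => μ * q * (11 / 10 * (t * |v i|)) * |(curve D₀ W v t)ᵀ j ⬝ᵥ Wᵀ i|)
    (fun i j => by positivity)
  have h2 : ∑ i, ∑ j, μ * q * (11 / 10 * (t * |v i|)) * |(curve D₀ W v t)ᵀ j ⬝ᵥ Wᵀ i|
      ≤ p * (μ * q * (11 / 10 * t) * (N + t)) := by
    calc _ ≤ ∑ i, μ * q * (11 / 10 * (t * |v i|)) * (√p * (N + t)) := by
          refine Finset.sum_le_sum fun i _ => ?_
          rw [← Finset.mul_sum]
          refine mul_le_mul_of_nonneg_left ?_ (by positivity)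
          have := h.sum_abs_col_dot_le (Wᵀ i)
          rwa [h.euclNorm_dir, mul_one] at this
      _ = μ * q * (11 / 10 * t) * (N + t) * √p * ∑ i, |v i| := by
          rw [Finset.mul_sum]; exact Finset.sum_congr rfl fun i _ => by ring
      _ ≤ μ * q * (11 / 10 * t) * (N + t) * √p * √p :=
          mul_le_mul_of_nonneg_left h.sum_abs_le (by positivity)
      _ = _ := by rw [mul_assoc _ (√p), Real.mul_self_sqrt hp0.le]; ring
  have h3 : ∑ i, t ^ 2 * v i ^ 2 * (1 / 2 + 11 / 10 * (μ * q))
      = t ^ 2 * (1 / 2 + 11 / 10 * (μ * q)) := by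
    rw [← Finset.sum_mul, ← Finset.mul_sum, h.sum_sq, mul_one]
  rw [h3]
  have h4 := h1.trans (mul_le_mul_of_nonneg_left h2 (sq_nonneg _))
  have h5 : ((k : ℝ) / p) ^ 2 * (p * (μ * q * (11 / 10 * t) * (N + t)))
      = k / p * t * (11 / 10 * (k * μ * q) * (N + t)) := by field_simp
  rw [h5] at h4
  set X := k * μ * q with hX
  have hX1 : 3 * t ≤ X := by
    calc 3 * t ≤ 1 * μ * 1 := by linarith
      _ ≤ k * μ * q := by gcongr
  have hX2 : μ * q ≤ X := by
    rw [hX, mul_assoc]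
    exact le_mul_of_one_le_left (by positivity) hk1
  have hX0 : 0 < X := by linarith
  -- Since t ≤ X/3 and t < 1/6, all contributions, including the one quadratic in t, are multiples
  -- of X‖D₀‖ with total factor below 3.
  have h6 : t * (1 / 2 + 11 / 10 * (μ * q)) + 11 / 10 * X * (N + t) ≤ 3 * (X * N) := by
    have h7 : X ≤ X * N := le_mul_of_one_le_right hX0.le hN1
    have h8 : t * (μ * q) ≤ 1 / 6 * X := mul_le_mul ht6.le hX2 (by positivity) (by norm_num)
    have h9 : X * t ≤ X * (1 / 6) := mul_le_mul_of_nonneg_left ht6.le hX0.le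
    nlinarith
  have h10 := mul_le_mul_of_nonneg_left h6 (by positivity : 0 ≤ (k : ℝ) / p * t)
  have h11 : 3 * q * (t * (k / p) * N * (k * μ)) = k / p * t * (3 * (X * N)) := by
    rw [hX]; ring
  rw [h11]
  linarith

/-- The change of the trace of the inverse Gram matrix. -/
lemma trace_inv_sub_le (h : CurveData D₀ W v t k) (hJ : J.card = k) :
    (((subDict (curve D₀ W v t) J)ᵀ * subDict (curve D₀ W v t) J)⁻¹
      - ((subDict D₀ J)ᵀ * subDict D₀ J)⁻¹).trace
    ≤ ∑ i ∈ J, ∑ j ∈ J with j ≠ i, 2 * coherenceAt D₀ t * (constQ D₀ k t ^ 2) ^ 2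
        * (|(curve D₀ W v t)ᵀ j ⬝ᵥ (curve D₀ W v t - D₀)ᵀ i|
          + |D₀ᵀ i ⬝ᵥ (curve D₀ W v t - D₀)ᵀ j|) := by
  set A := subDict (curve D₀ W v t) J with hA
  set A₀ := subDict D₀ J with hA₀
  set μ := coherenceAt D₀ t with hμ
  have hμ0 : 0 ≤ μ := (coherenceAt_pos h.pos).le
  set q := constQ D₀ k t ^ 2 with hq
  have hq1 : 1 ≤ q := one_le_constQ_sq h.pos h.small
  have hc : (Fintype.card J : ℝ) * μ < 1 := by simpa using h.card_mul_lt hJ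
  have hU := h.isUnit hJ
  have hU₀ := h.isUnit_zero hJ
  -- Resolvent identity. Under the trace, G₀ - G is paired with G₀⁻¹G⁻¹. The former has zero
  -- diagonal because atoms keep unit norm, and the latter has off-diagonal entries O(μ), so every
  -- surviving term carries a factor μ.
  have h1 : (Aᵀ * A)⁻¹ - (A₀ᵀ * A₀)⁻¹
      = (Aᵀ * A)⁻¹ * (A₀ᵀ * A₀ - Aᵀ * A) * (A₀ᵀ * A₀)⁻¹ := by
    rw [Matrix.mul_sub, nonsing_inv_mul _ hU, Matrix.sub_mul, Matrix.mul_assoc,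
      mul_nonsing_inv _ hU₀, Matrix.mul_one, Matrix.one_mul]
  have h2 : ∀ i j : J, |((A₀ᵀ * A₀)⁻¹ * (Aᵀ * A)⁻¹ - 1) i j| ≤ 2 * μ * q ^ 2 := by
    intro i j
    have h3 : (A₀ᵀ * A₀)⁻¹ * (Aᵀ * A)⁻¹ - 1
        = ((Aᵀ * A)⁻¹ * ((A₀ᵀ * A₀)⁻¹ - 1))ᵀ + ((Aᵀ * A)⁻¹ - 1) := by
      rw [transpose_mul, transpose_sub, gram_inv_transpose, gram_inv_transpose, transpose_one,
        Matrix.sub_mul, Matrix.one_mul]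
      abel
    have h4 := (h.coherent_zero.gram J).abs_inv_sub_one_le hμ0 hc
    have h5 := (h.coherent.gram J).abs_inv_mul_le hμ0 hc h4 j i
    have h6 := (h.coherent.gram J).abs_inv_sub_one_le hμ0 hc i j
    rw [h.constQ_eq hJ] at h5 h6
    rw [h3, Matrix.add_apply]
    refine (abs_add_le _ _).trans ((add_le_add h5 h6).trans ?_)
    have h7 : μ * q * 1 ≤ μ * q * q := mul_le_mul_of_nonneg_left hq1 (by positivity)
    rw [← hq]
    nlinarith
  have h3 : ∀ i j : J, (A₀ᵀ * A₀ - Aᵀ * A) i j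
      = -((curve D₀ W v t)ᵀ j ⬝ᵥ (curve D₀ W v t - D₀)ᵀ i
        + D₀ᵀ i ⬝ᵥ (curve D₀ W v t - D₀)ᵀ j) := by
    intro i j
    rw [dotProduct_comm ((curve D₀ W v t)ᵀ j), ← gram_sub, neg_sub]
    rfl
  rw [h1, trace_mul_comm, ← Matrix.mul_assoc, trace_mul_comm]
  have h4 : ((A₀ᵀ * A₀ - Aᵀ * A) * ((A₀ᵀ * A₀)⁻¹ * (Aᵀ * A)⁻¹)).trace
      = ∑ i : J, ∑ j : J, (A₀ᵀ * A₀ - Aᵀ * A) i j * ((A₀ᵀ * A₀)⁻¹ * (Aᵀ * A)⁻¹) j i := rfl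
  rw [h4, ← Finset.sum_attach J]
  refine Finset.sum_le_sum fun i _ => ?_
  rw [Finset.sum_filter, ← Finset.sum_attach J]
  refine Finset.sum_le_sum fun j _ => ?_
  by_cases hij : j = i
  · subst hij
    have h5 : (A₀ᵀ * A₀ - Aᵀ * A) j j = 0 := by
      rw [Matrix.sub_apply, (h.coherent.gram J).diag, (h.coherent_zero.gram J).diag, sub_self]
    simp [h5]
  · have hij' : (j : Fin p) ≠ i := fun hh => hij (Subtype.ext hh)
    rw [if_pos hij']
    have h5 := h2 j i
    rw [Matrix.sub_apply, Matrix.one_apply_ne hij, sub_zero] at h5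
    refine (le_abs_self _).trans ?_
    rw [abs_mul, mul_comm]
    refine mul_le_mul h5 ?_ (abs_nonneg _) (by positivity)
    rw [h3, abs_neg]
    exact abs_add_le _ _

/-- Row sums of inner products are at most √p times a spectral norm, and ∑|v| ≤ √p; the resulting p
cancels one of the two factors 1/p of the pair average. -/
lemma avg_trace_inv_sub_le (h : CurveData D₀ W v t k) {π : PMF (Finset (Fin p))}
    (hπ : IsSupportLaw π k) :
    supportAvg π (fun J => (((subDict (curve D₀ W v t) J)ᵀ * subDict (curve D₀ W v t) J)⁻¹
      - ((subDict D₀ J)ᵀ * subDict D₀ J)⁻¹).trace)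
    ≤ 8 * (constQ D₀ k t ^ 2) ^ 2 * (t * (k / p) * opNorm D₀ * (k * coherenceAt D₀ t)) := by
  refine (hπ.avg_mono fun J hJ => h.trace_inv_sub_le hJ).trans ?_
  have hkp := hπ.le
  have hk1 : (1 : ℝ) ≤ k := by exact_mod_cast h.one_le
  have hp0 : (0 : ℝ) < p := by exact_mod_cast h.one_le.trans hkp
  set N := opNorm D₀ with hN
  have hN1 : 1 ≤ N := h.dict.one_le_opNorm ⟨0, h.one_le.trans hkp⟩
  set μ := coherenceAt D₀ t with hμ
  have hμ0 : 0 < μ := coherenceAt_pos h.pos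
  set q := constQ D₀ k t ^ 2 with hq
  have hq1 : 1 ≤ q := one_le_constQ_sq h.pos h.small
  have ht := h.pos
  have ht6 := lt_of_small h.one_le h.small
  refine (hπ.avg_sum_pairs_le h.one_le (fun i j => by positivity)).trans ?_
  have h1 : ∑ i, ∑ j, |(curve D₀ W v t)ᵀ j ⬝ᵥ (curve D₀ W v t - D₀)ᵀ i| ≤ p * (t * (N + t)) := by
    calc _ ≤ ∑ i, √p * ((N + t) * (t * |v i|)) := by
          refine Finset.sum_le_sum fun i _ => ?_
          refine (h.sum_abs_col_dot_le _).trans ?_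
          have := h.euclNorm_sub_col i
          gcongr
      _ = √p * ((N + t) * t) * ∑ i, |v i| := by
          rw [Finset.mul_sum]; exact Finset.sum_congr rfl fun i _ => by ring
      _ ≤ √p * ((N + t) * t) * √p := mul_le_mul_of_nonneg_left h.sum_abs_le (by positivity)
      _ = (√p * √p) * (t * (N + t)) := by ring
      _ = _ := by rw [Real.mul_self_sqrt hp0.le]
  have h2 : ∑ i, ∑ j, |D₀ᵀ i ⬝ᵥ (curve D₀ W v t - D₀)ᵀ j| ≤ p * (t * N) := by
    rw [Finset.sum_comm]
    calc _ ≤ ∑ j, √p * (N * (t * |v j|)) := by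
          refine Finset.sum_le_sum fun j _ => ?_
          have h3 := sum_abs_le_sqrt_card_mul (D₀ᵀ *ᵥ (curve D₀ W v t - D₀)ᵀ j)
          rw [Fintype.card_fin] at h3
          refine h3.trans (mul_le_mul_of_nonneg_left ?_ (Real.sqrt_nonneg _))
          exact (euclNorm_transpose_mulVec_le _ _).trans
            (mul_le_mul_of_nonneg_left (h.euclNorm_sub_col j) (by linarith))
      _ = √p * (N * t) * ∑ i, |v i| := by
          rw [Finset.mul_sum]; exact Finset.sum_congr rfl fun i _ => by ring
      _ ≤ √p * (N * t) * √p := mul_le_mul_of_nonneg_left h.sum_abs_le (by positivity)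
      _ = (√p * √p) * (t * N) := by ring
      _ = _ := by rw [Real.mul_self_sqrt hp0.le]
  simp only [← Finset.mul_sum, Finset.sum_add_distrib]
  calc ((k : ℝ) / p) ^ 2 * (2 * μ * q ^ 2 * (_ + _))
      ≤ ((k : ℝ) / p) ^ 2 * (2 * μ * q ^ 2 * (p * (t * (N + t)) + p * (t * N))) := by gcongr
    _ = k / p * (2 * (k * μ) * q ^ 2 * t) * (2 * N + t) := by field_simp; ring
    _ ≤ k / p * (2 * (k * μ) * q ^ 2 * t) * (4 * N) := by gcongr; linarith
    _ = _ := by ring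

end CurveData

end CurveEstimates

/-! ### Exponential moments of sub-Gaussian squares -/

section SubGaussian

open scoped NNReal ENNReal

lemma lintegral_exp_sq_gaussianReal {θ : ℝ} (hθ : θ < 1) :
    ∫⁻ g, ENNReal.ofReal (Real.exp (θ * g ^ 2 / 2)) ∂(gaussianReal 0 1)
      = ENNReal.ofReal (1 / √(1 - θ)) := by
  have h1 : ∀ g : ℝ, gaussianPDFReal 0 1 g * Real.exp (θ * g ^ 2 / 2)
      = (√(2 * Real.pi))⁻¹ * Real.exp (-((1 - θ) / 2) * g ^ 2) := by
    intro g
    rw [gaussianPDFReal, mul_assoc, ← Real.exp_add]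
    simp only [NNReal.coe_one, mul_one, sub_zero]
    ring_nf
  have h2 : 0 < (1 - θ) / 2 := by linarith
  rw [gaussianReal_of_var_ne_zero _ one_ne_zero,
    lintegral_withDensity_eq_lintegral_mul _ (measurable_gaussianPDF 0 1) (by fun_prop)]
  have h3 : ∀ g : ℝ, (gaussianPDF 0 1 * fun g => ENNReal.ofReal (Real.exp (θ * g ^ 2 / 2))) g
      = ENNReal.ofReal ((√(2 * Real.pi))⁻¹ * Real.exp (-((1 - θ) / 2) * g ^ 2)) := by
    intro g
    rw [← h1, ENNReal.ofReal_mul (gaussianPDFReal_nonneg _ _ _)]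
    rfl
  simp_rw [h3]
  rw [← ofReal_integral_eq_lintegral_ofReal ((integrable_exp_neg_mul_sq h2).const_mul _)
    (Filter.Eventually.of_forall fun g => by positivity), integral_const_mul, integral_gaussian]
  congr 1
  rw [← Real.sqrt_inv, ← Real.sqrt_mul (by positivity), one_div, ← Real.sqrt_inv]
  congr 1
  have : (1 - θ) ≠ 0 := by linarith
  field_simp

variable {Ω : Type*} [MeasurableSpace Ω] {P : Measure Ω} [IsProbabilityMeasure P]

/-- The square is linearized: exp(u²y²/2) is the Gaussian mean of exp(uyg), and Tonelli reduces the
claim to the moment generating function of Y. For c = 0 the quotient is 0 and the integrand 1. -/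
lemma lintegral_exp_sq_le {Y : Ω → ℝ} {c : ℝ≥0} (hY : HasSubgaussianMGF Y c P) {θ : ℝ}
    (hθ0 : 0 ≤ θ) (hθ : θ < 1) :
    ∫⁻ ω, ENNReal.ofReal (Real.exp (θ * Y ω ^ 2 / (2 * c))) ∂P
      ≤ ENNReal.ofReal (1 / √(1 - θ)) := by
  rcases eq_or_ne c 0 with rfl | hc
  · have h1 : 1 ≤ 1 / √(1 - θ) := by
      rw [le_div_iff₀ (Real.sqrt_pos.2 (by linarith)), one_mul]
      exact Real.sqrt_le_one.2 (by linarith)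
    simpa using h1
  have hc0 : (0 : ℝ) < c := lt_of_le_of_ne c.2 (fun h => hc (by exact_mod_cast h.symm))
  set u := √(θ / c) with hu
  have hu2 : u ^ 2 = θ / c := Real.sq_sqrt (by positivity)
  have h1 : ∀ y : ℝ, ENNReal.ofReal (Real.exp (θ * y ^ 2 / (2 * c)))
      = ∫⁻ g, ENNReal.ofReal (Real.exp (u * y * g)) ∂(gaussianReal 0 1) := by
    intro y
    rw [← ofReal_integral_eq_lintegral_ofReal (integrable_exp_mul_gaussianReal _)
      (Filter.Eventually.of_forall fun g => (Real.exp_pos _).le)]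
    have h2 := mgf_gaussianReal (p := gaussianReal 0 1) (X := id) (μ := 0) (v := 1)
      (Measure.map_id) (u * y)
    rw [mgf] at h2
    simp only [id] at h2
    rw [h2, mul_pow, hu2]
    congr 2
    push_cast
    field_simp
    ring
  simp_rw [h1]
  rw [lintegral_lintegral_swap]
  · rw [← lintegral_exp_sq_gaussianReal hθ]
    refine lintegral_mono fun g => ?_
    have h2 : ∀ ω, u * Y ω * g = (u * g) * Y ω := fun ω => by ring
    simp_rw [h2]
    rw [← ofReal_integral_eq_lintegral_ofReal (hY.integrable_exp_mul _)
      (Filter.Eventually.of_forall fun g => (Real.exp_pos _).le)]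
    refine ENNReal.ofReal_le_ofReal ((hY.mgf_le (u * g)).trans (le_of_eq ?_))
    rw [mul_pow, hu2]
    congr 1
    field_simp
  · have hYm : AEMeasurable (fun q : Ω × ℝ => Y q.1) (P.prod (gaussianReal 0 1)) :=
      hY.aemeasurable.comp_quasiMeasurePreserving Measure.quasiMeasurePreserving_fst
    exact ((hYm.const_mul u).mul measurable_snd.aemeasurable).exp.ennreal_ofReal

/-- Exponential moments of a sum of squares of sub-Gaussian variables; no independence is
needed. -/
lemma lintegral_exp_sum_sq_le {ι : Type*} [Fintype ι] {Y : ι → Ω → ℝ} {c : ι → ℝ≥0} {S : ℝ}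
    (hS : 0 < S) (hcS : ∑ l, (c l : ℝ) ≤ S) (hY : ∀ l, HasSubgaussianMGF (Y l) (c l) P) {θ : ℝ}
    (hθ0 : 0 ≤ θ) (hθ : θ < 1) :
    ∫⁻ ω, ENNReal.ofReal (Real.exp (θ / (2 * S) * ∑ l, Y l ω ^ 2)) ∂P
      ≤ ENNReal.ofReal (1 / √(1 - θ)) := by
  -- Jensen with weights c l / S; the extra index `none` carries the missing mass, with exponent 0.
  set z : Option ι → Ω → ℝ := fun o ω => o.elim 0 fun l => θ * Y l ω ^ 2 / (2 * c l) with hz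
  set w : Option ι → ℝ := fun o => o.elim (1 - ∑ l, (c l : ℝ) / S) fun l => c l / S with hw
  have hw0 : ∀ o, 0 ≤ w o := by
    rintro (_ | l)
    · simp only [hw, Option.elim_none, sub_nonneg]
      rw [← Finset.sum_div]
      exact (div_le_one hS).2 hcS
    · simp only [hw, Option.elim_some]; positivity
  have hw1 : ∑ o, w o = 1 := by simp [hw, Fintype.sum_option]
  have hK : 1 ≤ 1 / √(1 - θ) := by
    rw [le_div_iff₀ (Real.sqrt_pos.2 (by linarith)), one_mul]
    exact Real.sqrt_le_one.2 (by linarith)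
  -- If c l = 0 then Y l vanishes almost surely, so the division by zero is harmless.
  have hae : ∀ᵐ ω ∂P, ∀ l, Y l ω ^ 2 = c l * (Y l ω ^ 2 / c l) := by
    rw [ae_all_iff]
    intro l
    rcases eq_or_ne (c l) 0 with h0 | h0
    · have := hY l
      rw [h0] at this
      filter_upwards [this.ae_eq_zero_of_hasSubgaussianMGF_zero] with ω hω
      simp [hω]
    · refine Filter.Eventually.of_forall fun ω => ?_
      have : (c l : ℝ) ≠ 0 := by exact_mod_cast h0
      field_simp
  have hzm : ∀ o, AEMeasurable (fun ω => ENNReal.ofReal (w o * Real.exp (z o ω))) P := by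
    rintro (_ | l)
    · simp only [hz, Option.elim_none]; fun_prop
    · have := (hY l).aemeasurable
      simp only [hz, Option.elim_some]; fun_prop
  calc ∫⁻ ω, ENNReal.ofReal (Real.exp (θ / (2 * S) * ∑ l, Y l ω ^ 2)) ∂P
      ≤ ∫⁻ ω, ∑ o, ENNReal.ofReal (w o * Real.exp (z o ω)) ∂P := by
        refine lintegral_mono_ae ?_
        filter_upwards [hae] with ω hω
        rw [← ENNReal.ofReal_sum_of_nonneg fun o _ => mul_nonneg (hw0 o) (Real.exp_pos _).le]
        refine ENNReal.ofReal_le_ofReal ?_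
        have h1 := convexOn_exp.map_sum_le (t := Finset.univ) (w := w) (p := fun o => z o ω)
          (fun o _ => hw0 o) hw1 (fun o _ => Set.mem_univ _)
        simp only [smul_eq_mul] at h1
        refine le_trans (le_of_eq ?_) h1
        congr 1
        rw [Fintype.sum_option, Finset.mul_sum]
        simp only [hz, hw, Option.elim_none, Option.elim_some, mul_zero, zero_add]
        refine Finset.sum_congr rfl fun l _ => ?_
        conv_lhs => rw [hω l]
        ring
    _ = ∑ o, ∫⁻ ω, ENNReal.ofReal (w o * Real.exp (z o ω)) ∂P :=
        lintegral_finsetSum' _ fun o _ => hzm o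
    _ ≤ ∑ o, ENNReal.ofReal (w o) * ENNReal.ofReal (1 / √(1 - θ)) := by
        refine Finset.sum_le_sum fun o _ => ?_
        simp_rw [ENNReal.ofReal_mul (hw0 o)]
        rw [lintegral_const_mul' _ _ ENNReal.ofReal_ne_top]
        refine mul_le_mul_right ?_ _
        rcases o with _ | l
        · simpa [hz] using hK
        · exact lintegral_exp_sq_le (hY l) hθ0 hθ
    _ = ENNReal.ofReal (1 / √(1 - θ)) := by
        rw [← Finset.sum_mul, ← ENNReal.ofReal_sum_of_nonneg fun o _ => hw0 o, hw1]
        simp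

/-- The tail of a sum of squares of sub-Gaussian variables. -/
lemma measure_sum_sq_ge_le {ι : Type*} [Fintype ι] {Y : ι → Ω → ℝ} {c : ι → ℝ≥0} {S r : ℝ}
    (hS : 0 < S) (hcS : ∑ l, (c l : ℝ) ≤ S) (hY : ∀ l, HasSubgaussianMGF (Y l) (c l) P) :
    P {ω | 5 * r ^ 2 * S < ∑ l, Y l ω ^ 2} ≤ ENNReal.ofReal (√5 * Real.exp (-2 * r ^ 2)) := by
  -- θ = 4/5 makes the exponent at the threshold 5r²S equal to 2r², and the prefactor √5.
  have h1 := lintegral_exp_sum_sq_le hS hcS hY (θ := 4 / 5) (by norm_num) (by norm_num)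
  have h2 : 1 / √(1 - 4 / 5) = √5 := by
    rw [one_div, ← Real.sqrt_inv]; norm_num
  rw [h2] at h1
  have h3 : AEMeasurable (fun ω => ENNReal.ofReal (Real.exp (4 / 5 / (2 * S) * ∑ l, Y l ω ^ 2))) P := by
    have : ∀ l, AEMeasurable (Y l) P := fun l => (hY l).aemeasurable
    fun_prop
  have h4 := mul_meas_ge_le_lintegral₀ h3 (ENNReal.ofReal (Real.exp (2 * r ^ 2)))
  have h5 : P {ω | 5 * r ^ 2 * S < ∑ l, Y l ω ^ 2} ≤ P {ω | ENNReal.ofReal (Real.exp (2 * r ^ 2))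
      ≤ ENNReal.ofReal (Real.exp (4 / 5 / (2 * S) * ∑ l, Y l ω ^ 2))} := by
    refine measure_mono fun ω hω => ?_
    refine ENNReal.ofReal_le_ofReal (Real.exp_le_exp.2 ?_)
    have h6 : 5 * r ^ 2 * S < ∑ l, Y l ω ^ 2 := hω
    rw [div_div, div_mul_eq_mul_div, le_div_iff₀ (by positivity)]
    linarith
  refine h5.trans ?_
  have h7 : Real.exp (-2 * r ^ 2) = (Real.exp (2 * r ^ 2))⁻¹ := by
    rw [← Real.exp_neg]; ring_nf
  rw [h7, ← div_eq_mul_inv, ENNReal.ofReal_div_of_pos (Real.exp_pos _),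
    ENNReal.le_div_iff_mul_le (Or.inl (by simp [Real.exp_pos])) (Or.inl ENNReal.ofReal_ne_top),
    mul_comm]
  exact h4.trans h1

end SubGaussian

/-! ### First and second moments -/

section Moments

open scoped NNReal ENNReal

variable {Ω : Type*} [MeasurableSpace Ω] {P : Measure Ω} [IsProbabilityMeasure P]

/-- The moment generating function touches its Gaussian majorant at 0, so their derivatives there,
the mean and 0, agree. -/
lemma integral_eq_zero_of_hasSubgaussianMGF {Y : Ω → ℝ} {c : ℝ≥0} (hY : HasSubgaussianMGF Y c P) :
    ∫ ω, Y ω ∂P = 0 := by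
  have h0 : (0 : ℝ) ∈ interior (integrableExpSet Y P) := by
    simp [hY.integrableExpSet_eq_univ]
  have h1 := hasDerivAt_mgf h0
  simp only [zero_mul, Real.exp_zero, mul_one] at h1
  have h2 : HasDerivAt (fun s : ℝ => Real.exp (c * s ^ 2 / 2)) 0 0 := by
    have : HasDerivAt (fun s : ℝ => (c : ℝ) * s ^ 2 / 2) 0 0 := by
      have := ((hasDerivAt_pow 2 (0 : ℝ)).const_mul (c : ℝ)).div_const 2
      simpa using this
    simpa using this.exp
  have h3 : IsLocalMax (fun s => mgf Y P s - Real.exp (c * s ^ 2 / 2)) 0 := by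
    refine Filter.Eventually.of_forall fun s => ?_
    have := hY.mgf_le s
    simp only [mgf_zero]
    norm_num
    exact this
  have := h3.hasDerivAt_eq_zero (h1.sub h2)
  simpa using this

lemma integral_dot_mulVec {ι κ : Type*} [Fintype ι] [Fintype κ] (M : Matrix ι κ ℝ)
    {a : Ω → ι → ℝ} {b : Ω → κ → ℝ} {c : ι → κ → ℝ}
    (h : ∀ i j, Integrable (fun ω => a ω i * b ω j) P ∧ ∫ ω, a ω i * b ω j ∂P = c i j) :
    Integrable (fun ω => a ω ⬝ᵥ (M *ᵥ b ω)) P ∧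
      ∫ ω, a ω ⬝ᵥ (M *ᵥ b ω) ∂P = ∑ i, ∑ j, M i j * c i j := by
  have h1 : ∀ ω, a ω ⬝ᵥ (M *ᵥ b ω) = ∑ i, ∑ j, M i j * (a ω i * b ω j) := by
    intro ω
    simp only [dotProduct, mulVec, Finset.mul_sum]
    exact Finset.sum_congr rfl fun i _ => Finset.sum_congr rfl fun j _ => by ring
  have h2 : ∀ i j, Integrable (fun ω => M i j * (a ω i * b ω j)) P :=
    fun i j => (h i j).1.const_mul _
  simp_rw [h1]
  refine ⟨integrable_finsetSum _ fun i _ => integrable_finsetSum _ fun j _ => h2 i j, ?_⟩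
  rw [integral_finsetSum _ fun i _ => integrable_finsetSum _ fun j _ => h2 i j]
  refine Finset.sum_congr rfl fun i _ => ?_
  rw [integral_finsetSum _ fun j _ => h2 i j]
  refine Finset.sum_congr rfl fun j _ => ?_
  rw [integral_const_mul, (h i j).2]

lemma sum_mul_diag {ι : Type*} [Fintype ι] [DecidableEq ι] (M : Matrix ι ι ℝ) (c : ℝ) :
    ∑ i, ∑ j, M i j * (if i = j then c else 0) = c * M.trace := by
  rw [Matrix.trace, Finset.mul_sum]
  refine Finset.sum_congr rfl fun i _ => ?_
  simp [mul_comm]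

end Moments

/-! ### Latent variables: independent coefficients and noise -/

section Latent

lemma integral_comp_measurePreserving {Ω Ω' : Type*} [MeasurableSpace Ω] [MeasurableSpace Ω']
    {P : Measure Ω} {P' : Measure Ω'} {g : Ω → Ω'} (hg : MeasurePreserving g P P') {f : Ω' → ℝ}
    (hf : AEStronglyMeasurable f P') : ∫ ω, f (g ω) ∂P = ∫ x, f x ∂P' := by
  rw [← hg.map_eq, integral_map hg.aemeasurable (by rwa [hg.map_eq])]

variable {m p k : ℕ}

/-- The joint law of `p` independent coefficients and `m` independent noise variables. -/
noncomputable def latent (m p : ℕ) (ν η : Measure ℝ) : Measure ((Fin p → ℝ) × (Fin m → ℝ)) :=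
  (Measure.pi fun _ : Fin p => ν).prod (Measure.pi fun _ : Fin m => η)

variable {ν η : Measure ℝ} [IsProbabilityMeasure ν] [IsProbabilityMeasure η]

instance : IsProbabilityMeasure (latent m p ν η) := by
  rw [latent]; infer_instance

lemma measurePreserving_coef (j : Fin p) :
    MeasurePreserving (fun ω : (Fin p → ℝ) × (Fin m → ℝ) => ω.1 j) (latent m p ν η) ν :=
  (measurePreserving_eval (fun _ : Fin p => ν) j).comp measurePreserving_fst

lemma measurePreserving_noise (i : Fin m) :
    MeasurePreserving (fun ω : (Fin p → ℝ) × (Fin m → ℝ) => ω.2 i) (latent m p ν η) η :=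
  (measurePreserving_eval (fun _ : Fin m => η) i).comp measurePreserving_snd

lemma integral_pi_mul {ι : Type*} [Fintype ι] [DecidableEq ι] {f g : ℝ → ℝ} (hf : MemLp f 2 ν)
    (hg : MemLp g 2 ν) (i j : ι) :
    Integrable (fun z : ι → ℝ => f (z i) * g (z j)) (Measure.pi fun _ => ν) ∧
    ∫ z : ι → ℝ, f (z i) * g (z j) ∂(Measure.pi fun _ => ν)
      = if i = j then ∫ a, f a * g a ∂ν else (∫ a, f a ∂ν) * ∫ a, g a ∂ν := by
  have hmp := fun i : ι => measurePreserving_eval (fun _ : ι => ν) i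
  refine ⟨(hf.comp_measurePreserving (hmp i)).integrable_mul (hg.comp_measurePreserving (hmp j)), ?_⟩
  split_ifs with hij
  · subst hij
    exact integral_comp_measurePreserving (hmp i) (f := fun a => f a * g a) (hf.1.mul hg.1)
  · have hind := (iIndepFun_pi (μ := fun _ : ι => ν) (X := fun _ => id)
      (fun _ => aemeasurable_id)).indepFun hij
    have h1 := (hind.comp₀ (φ := f) (ψ := g) (hmp i).aemeasurable (hmp j).aemeasurable
      (by rw [show (fun ω : ι → ℝ => id (ω i)) = Function.eval i from rfl, (hmp i).map_eq]
          exact hf.1.aemeasurable)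
      (by rw [show (fun ω : ι → ℝ => id (ω j)) = Function.eval j from rfl, (hmp j).map_eq]
          exact hg.1.aemeasurable)).integral_fun_mul_eq_mul_integral
      ((hf.comp_measurePreserving (hmp i)).1) ((hg.comp_measurePreserving (hmp j)).1)
    refine h1.trans ?_
    congr 1
    · exact integral_comp_measurePreserving (hmp i) hf.1
    · exact integral_comp_measurePreserving (hmp j) hg.1

lemma integral_coef_mul_coef {f g : ℝ → ℝ} (hf : MemLp f 2 ν) (hg : MemLp g 2 ν) (i j : Fin p) :
    Integrable (fun ω => f (ω.1 i) * g (ω.1 j)) (latent m p ν η) ∧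
    ∫ ω, f (ω.1 i) * g (ω.1 j) ∂(latent m p ν η)
      = if i = j then ∫ a, f a * g a ∂ν else (∫ a, f a ∂ν) * ∫ a, g a ∂ν := by
  obtain ⟨h1, h2⟩ := integral_pi_mul hf hg i j
  have hmp : MeasurePreserving Prod.fst (latent m p ν η) (Measure.pi fun _ : Fin p => ν) :=
    measurePreserving_fst
  exact ⟨hmp.integrable_comp_of_integrable h1, (integral_comp_measurePreserving hmp h1.1).trans h2⟩

lemma integral_noise_mul_noise {f g : ℝ → ℝ} (hf : MemLp f 2 η) (hg : MemLp g 2 η) (i j : Fin m) :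
    Integrable (fun ω => f (ω.2 i) * g (ω.2 j)) (latent m p ν η) ∧
    ∫ ω, f (ω.2 i) * g (ω.2 j) ∂(latent m p ν η)
      = if i = j then ∫ a, f a * g a ∂η else (∫ a, f a ∂η) * ∫ a, g a ∂η := by
  obtain ⟨h1, h2⟩ := integral_pi_mul hf hg i j
  have hmp : MeasurePreserving Prod.snd (latent m p ν η) (Measure.pi fun _ : Fin m => η) :=
    measurePreserving_snd
  exact ⟨hmp.integrable_comp_of_integrable h1, (integral_comp_measurePreserving hmp h1.1).trans h2⟩

lemma integral_coef_mul_noise {f g : ℝ → ℝ} (hf : MemLp f 2 ν) (hg : MemLp g 2 η) (i : Fin p)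
    (j : Fin m) :
    Integrable (fun ω => f (ω.1 i) * g (ω.2 j)) (latent m p ν η) ∧
    ∫ ω, f (ω.1 i) * g (ω.2 j) ∂(latent m p ν η) = (∫ a, f a ∂ν) * ∫ a, g a ∂η := by
  have hi := measurePreserving_eval (fun _ : Fin p => ν) i
  have hj := measurePreserving_eval (fun _ : Fin m => η) j
  refine ⟨(hf.comp_measurePreserving (measurePreserving_coef i)).integrable_mul
    (hg.comp_measurePreserving (measurePreserving_noise j)), ?_⟩
  have h1 := integral_prod_mul (μ := Measure.pi fun _ : Fin p => ν)
    (ν := Measure.pi fun _ : Fin m => η) (fun z => f (z i)) (fun z => g (z j))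
  refine h1.trans ?_
  congr 1
  · exact integral_comp_measurePreserving hi hf.1
  · exact integral_comp_measurePreserving hj hg.1

lemma hasSubgaussianMGF_coef {c : NNReal} (h : HasSubgaussianMGF id c ν) (j : Fin p) :
    HasSubgaussianMGF (fun ω : (Fin p → ℝ) × (Fin m → ℝ) => ω.1 j) c (latent m p ν η) := by
  rw [← HasSubgaussianMGF.id_map_iff (measurePreserving_coef j).aemeasurable,
    (measurePreserving_coef j).map_eq]
  exact h

lemma hasSubgaussianMGF_noise {c : NNReal} (h : HasSubgaussianMGF id c η) (i : Fin m) :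
    HasSubgaussianMGF (fun ω : (Fin p → ℝ) × (Fin m → ℝ) => ω.2 i) c (latent m p ν η) := by
  rw [← HasSubgaussianMGF.id_map_iff (measurePreserving_noise i).aemeasurable,
    (measurePreserving_noise i).map_eq]
  exact h

/-- Each coordinate of the deviation has this form. Independence is used inside one coordinate,
never across coordinates. -/
lemma hasSubgaussianMGF_linear {c d : NNReal} (hν : HasSubgaussianMGF id c ν)
    (hη : HasSubgaussianMGF id d η) (J : Finset (Fin p)) (e : Fin p → ℝ) (i : Fin m) :
    HasSubgaussianMGF (fun ω : (Fin p → ℝ) × (Fin m → ℝ) => ∑ j ∈ J, e j * ω.1 j + ω.2 i)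
      (∑ j ∈ J, ⟨e j ^ 2, sq_nonneg _⟩ * c + d) (latent m p ν η) := by
  have h1 : HasSubgaussianMGF (fun z : Fin p → ℝ => ∑ j ∈ J, e j * z j)
      (∑ j ∈ J, ⟨e j ^ 2, sq_nonneg _⟩ * c) (Measure.pi fun _ => ν) := by
    refine HasSubgaussianMGF.sum_of_iIndepFun (X := fun j (z : Fin p → ℝ) => e j * z j) ?_ fun j _ => ?_
    · exact iIndepFun_pi (μ := fun _ : Fin p => ν) (X := fun j z => e j * z) (by fun_prop)
    · refine HasSubgaussianMGF.const_mul ?_ (e j)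
      rw [← HasSubgaussianMGF.id_map_iff (measurable_pi_apply j).aemeasurable]
      rw [show (Measure.pi fun _ : Fin p => ν).map (fun ω => ω j) = ν from
        (measurePreserving_eval (fun _ : Fin p => ν) j).map_eq]
      exact hν
  have hmp : MeasurePreserving Prod.fst (latent m p ν η) (Measure.pi fun _ : Fin p => ν) :=
    measurePreserving_fst
  have h2 : HasSubgaussianMGF (fun ω : (Fin p → ℝ) × (Fin m → ℝ) => ∑ j ∈ J, e j * ω.1 j)
      (∑ j ∈ J, ⟨e j ^ 2, sq_nonneg _⟩ * c) (latent m p ν η) := by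
    rw [← hmp.map_eq] at h1
    exact HasSubgaussianMGF.of_map (X := fun z : Fin p → ℝ => ∑ j ∈ J, e j * z j) hmp.aemeasurable h1
  refine h2.add_of_indepFun (hasSubgaussianMGF_noise hη i) ?_
  exact indepFun_prod (X := fun z : Fin p → ℝ => ∑ j ∈ J, e j * z j)
    (Y := fun z : Fin m → ℝ => z i) (by fun_prop) (by fun_prop)

end Latent

/-! ### Expectation of the restricted least squares value -/

section ExpectedValue

variable {m p k : ℕ} {ν η : Measure ℝ} [IsProbabilityMeasure ν] [IsProbabilityMeasure η]

lemma lsqVal_expand {ι κ : Type*} [Fintype ι] [Fintype κ] [DecidableEq ι] [DecidableEq κ]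
    (A A₀ : Matrix κ ι ℝ) (a s : ι → ℝ) (e : κ → ℝ) (lam : ℝ) :
    lsqVal A (A₀ *ᵥ a + e) (lam • s)
      = 1 / 2 * (a ⬝ᵥ ((A₀ᵀ * projCompl A * A₀) *ᵥ a)) + a ⬝ᵥ ((A₀ᵀ * projCompl A) *ᵥ e)
        + 1 / 2 * (e ⬝ᵥ (projCompl A *ᵥ e))
        + lam * (s ⬝ᵥ (((Aᵀ * A)⁻¹ * Aᵀ * A₀) *ᵥ a)) + lam * (s ⬝ᵥ (((Aᵀ * A)⁻¹ * Aᵀ) *ᵥ e))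
        - lam ^ 2 / 2 * (s ⬝ᵥ ((Aᵀ * A)⁻¹ *ᵥ s)) := by
  have h1 : (A₀ *ᵥ a) ⬝ᵥ (projCompl A *ᵥ (A₀ *ᵥ a)) = a ⬝ᵥ ((A₀ᵀ * projCompl A * A₀) *ᵥ a) := by
    rw [dotProduct_comm, dot_mulVec_eq A₀, dotProduct_comm]
    simp only [mulVec_mulVec, Matrix.mul_assoc]
  have h2 : (A₀ *ᵥ a) ⬝ᵥ (projCompl A *ᵥ e) = a ⬝ᵥ ((A₀ᵀ * projCompl A) *ᵥ e) := by
    rw [dotProduct_comm, dot_mulVec_eq A₀, dotProduct_comm]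
    simp only [mulVec_mulVec]
  have h3 : e ⬝ᵥ (projCompl A *ᵥ (A₀ *ᵥ a)) = a ⬝ᵥ ((A₀ᵀ * projCompl A) *ᵥ e) := by
    rw [dot_mulVec_eq (projCompl A), projCompl_transpose, dotProduct_comm, h2]
  rw [lsqVal]
  simp only [mulVec_add, dotProduct_add, add_dotProduct, h1, h2, h3, mulVec_smul, dotProduct_smul,
    smul_dotProduct, smul_eq_mul]
  rw [mulVec_mulVec]
  ring

lemma trace_projCompl {ι κ : Type*} [Fintype ι] [Fintype κ] [DecidableEq ι] [DecidableEq κ]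
    {A : Matrix κ ι ℝ} (h : IsUnit (Aᵀ * A).det) :
    (projCompl A).trace = Fintype.card κ - Fintype.card ι := by
  rw [projCompl, trace_sub, trace_one, Matrix.mul_assoc, trace_mul_comm, Matrix.mul_assoc,
    nonsing_inv_mul _ h, trace_one]

lemma measurable_realSign : Measurable Real.sign := by
  unfold Real.sign
  exact Measurable.ite measurableSet_Iio measurable_const
    (Measurable.ite measurableSet_Ioi measurable_const measurable_const)

lemma memLp_sign : MemLp Real.sign 2 ν := by
  refine MemLp.of_bound measurable_realSign.aestronglyMeasurable 1 ?_
  refine Filter.Eventually.of_forall fun a => ?_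
  rcases Real.sign_apply_eq a with h | h | h <;> simp [h]

lemma sign_mul_self_eq_abs (a : ℝ) : Real.sign a * a = |a| := by
  rcases lt_trichotomy a 0 with h | h | h
  · rw [Real.sign_of_neg h, abs_of_neg h]; ring
  · simp [h]
  · rw [Real.sign_of_pos h, abs_of_pos h]; ring

lemma integral_add₅_sub {Ω : Type*} [MeasurableSpace Ω] {P : Measure Ω}
    {f₁ f₂ f₃ f₄ f₅ f₆ : Ω → ℝ} (h₁ : Integrable f₁ P) (h₂ : Integrable f₂ P)
    (h₃ : Integrable f₃ P) (h₄ : Integrable f₄ P) (h₅ : Integrable f₅ P) (h₆ : Integrable f₆ P) :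
    Integrable (fun ω => f₁ ω + f₂ ω + f₃ ω + f₄ ω + f₅ ω - f₆ ω) P ∧
    ∫ ω, f₁ ω + f₂ ω + f₃ ω + f₄ ω + f₅ ω - f₆ ω ∂P = ∫ ω, f₁ ω ∂P + ∫ ω, f₂ ω ∂P + ∫ ω, f₃ ω ∂P
      + ∫ ω, f₄ ω ∂P + ∫ ω, f₅ ω ∂P - ∫ ω, f₆ ω ∂P :=
  ⟨((((h₁.add h₂).add h₃).add h₄).add h₅).sub h₆, by
    rw [integral_sub (f := fun ω => f₁ ω + f₂ ω + f₃ ω + f₄ ω + f₅ ω)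
        ((((h₁.add h₂).add h₃).add h₄).add h₅) h₆,
      integral_add (f := fun ω => f₁ ω + f₂ ω + f₃ ω + f₄ ω) (((h₁.add h₂).add h₃).add h₄) h₅,
      integral_add (f := fun ω => f₁ ω + f₂ ω + f₃ ω) ((h₁.add h₂).add h₃) h₄,
      integral_add (f := fun ω => f₁ ω + f₂ ω) (h₁.add h₂) h₃, integral_add h₁ h₂]⟩

/-- The expected value of the restricted least squares problem for a random signal. -/
lemma integral_lsqVal {J : Finset (Fin p)} {A A₀ : Matrix (Fin m) J ℝ}
    (hU : IsUnit (Aᵀ * A).det)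
    (hν2 : MemLp id 2 ν) (hη2 : MemLp id 2 η) (hν0 : ∫ a, a ∂ν = 0) (hη0 : ∫ a, a ∂η = 0)
    (hne : ∀ᵐ a ∂ν, a ≠ 0) (hsign : 2 ≤ J.card → ∫ a, Real.sign a ∂ν = 0) (lam : ℝ) :
    Integrable (fun ω => lsqVal A (A₀ *ᵥ (fun j : J => ω.1 j) + ω.2)
      (lam • fun j : J => Real.sign (ω.1 j))) (latent m p ν η) ∧
    ∫ ω, lsqVal A (A₀ *ᵥ (fun j : J => ω.1 j) + ω.2)
      (lam • fun j : J => Real.sign (ω.1 j)) ∂(latent m p ν η)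
      = 1 / 2 * ((∫ a, a ^ 2 ∂ν) * (A₀ᵀ * projCompl A * A₀).trace)
        + 1 / 2 * ((∫ a, a ^ 2 ∂η) * (m - J.card))
        + lam * ((∫ a, |a| ∂ν) * ((Aᵀ * A)⁻¹ * Aᵀ * A₀).trace)
        - lam ^ 2 / 2 * ((Aᵀ * A)⁻¹).trace := by
  set P := latent m p ν η with hP
  have h1 := integral_dot_mulVec (P := P) (A₀ᵀ * projCompl A * A₀)
    (a := fun ω j => ω.1 j) (b := fun ω j => ω.1 j)
    (c := fun i j => if i = j then ∫ a, a ^ 2 ∂ν else 0) (fun i j => by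
      have := integral_coef_mul_coef (m := m) (η := η) hν2 hν2 (i : Fin p) j
      simpa only [id, hν0, Subtype.ext_iff, sq, mul_zero] using this)
  have h2 := integral_dot_mulVec (P := P) (A₀ᵀ * projCompl A)
    (a := fun ω j => ω.1 j) (b := fun ω => ω.2)
    (c := fun i j => 0) (fun i j => by
      have := integral_coef_mul_noise hν2 hη2 (i : Fin p) j
      simpa [hν0] using this)
  have h3 := integral_dot_mulVec (P := P) (projCompl A)
    (a := fun ω => ω.2) (b := fun ω => ω.2)
    (c := fun i j => if i = j then ∫ a, a ^ 2 ∂η else 0) (fun i j => by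
      have := integral_noise_mul_noise (p := p) (ν := ν) hη2 hη2 i j
      simpa only [id, hη0, sq, mul_zero] using this)
  have h4 := integral_dot_mulVec (P := P) ((Aᵀ * A)⁻¹ * Aᵀ * A₀)
    (a := fun ω j => Real.sign (ω.1 j)) (b := fun ω j => ω.1 j)
    (c := fun i j => if i = j then ∫ a, |a| ∂ν else 0) (fun i j => by
      have := integral_coef_mul_coef (m := m) (η := η) memLp_sign hν2 (i : Fin p) j
      simpa only [id, hν0, Subtype.ext_iff, sign_mul_self_eq_abs, mul_zero] using this)
  have h5 := integral_dot_mulVec (P := P) ((Aᵀ * A)⁻¹ * Aᵀ)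
    (a := fun ω j => Real.sign (ω.1 j)) (b := fun ω => ω.2)
    (c := fun i j => 0) (fun i j => by
      have := integral_coef_mul_noise (ν := ν) memLp_sign hη2 (i : Fin p) j
      simpa [hη0] using this)
  have hs1 : ∫ a, Real.sign a * Real.sign a ∂ν = 1 := by
    have : ∫ a, Real.sign a * Real.sign a ∂ν = ∫ a, (1 : ℝ) ∂ν := by
      refine integral_congr_ae ?_
      filter_upwards [hne] with a ha
      rcases Real.sign_apply_eq_of_ne_zero a ha with h | h <;> simp [h]
    simpa using this
  -- The only place for balanced signs: the other off-diagonal terms vanish by centred coefficients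
  -- or noise. Distinct indices exist only if |J| ≥ 2, and the diagonal is 1 since α ≠ 0 almost
  -- surely.
  have h6 := integral_dot_mulVec (P := P) ((Aᵀ * A)⁻¹)
    (a := fun ω j => Real.sign (ω.1 j)) (b := fun ω j => Real.sign (ω.1 j))
    (c := fun i j => if i = j then 1 else 0) (fun i j => by
      have := integral_coef_mul_coef (m := m) (η := η) (memLp_sign (ν := ν)) memLp_sign (i : Fin p) j
      rw [hs1] at this
      refine ⟨this.1, this.2.trans ?_⟩
      by_cases hij : i = j
      · simp [hij]
      · rw [if_neg (fun h => hij (Subtype.ext h)), if_neg hij, hsign, zero_mul]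
        exact Finset.one_lt_card.2 ⟨i, i.2, j, j.2, fun h => hij (Subtype.ext h)⟩)
  simp only [lsqVal_expand]
  rw [sum_mul_diag] at h1 h3 h4 h6
  simp only [mul_zero, Finset.sum_const_zero] at h2 h5
  obtain ⟨hi, he⟩ := integral_add₅_sub (h1.1.const_mul (1 / 2)) h2.1 (h3.1.const_mul (1 / 2))
    (h4.1.const_mul lam) (h5.1.const_mul lam) (h6.1.const_mul (lam ^ 2 / 2))
  refine ⟨hi, he.trans ?_⟩
  simp only [integral_const_mul]
  rw [h1.2, h2.2, h3.2, h4.2, h5.2, h6.2, trace_projCompl hU]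
  simp

end ExpectedValue

/-! ### The signal model, the bad event and its cost -/

section Model

variable {m p k : ℕ}

/-- The assumptions on the parameters and on the laws of the coefficients and of the noise. -/
structure ModelData (D₀ : Matrix (Fin m) (Fin p) ℝ) (k : ℕ) (t σα αmin σ lam : ℝ)
    (ν η : Measure ℝ) : Prop where
  dict : IsDictionary D₀
  one_le : 1 ≤ k
  pos : 0 < t
  small : k * coherenceAt D₀ t < 1 / 2
  subGaussian_coef : HasSubgaussianMGF id ⟨σα ^ 2, sq_nonneg σα⟩ ν
  subGaussian_noise : HasSubgaussianMGF id ⟨σ ^ 2, sq_nonneg σ⟩ η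
  σα_pos : 0 < σα
  αmin_pos : 0 < αmin
  bound : ∀ᵐ a ∂ν, αmin ≤ |a|
  sign : 2 ≤ k → ∫ a, Real.sign a ∂ν = 0
  adm : Admissible D₀ k t σα αmin σ lam

/-- The common scale of the costs of a signal. -/
noncomputable def costScale (m k : ℕ) (σα σ lam : ℝ) : ℝ := m * σ ^ 2 + lam * k * σα

/-- A bound on the cost of a signal along a curve, in terms of its coefficients and noise. -/
noncomputable def costBound (t lam : ℝ) (J : Finset (Fin p)) (ω : (Fin p → ℝ) × (Fin m → ℝ)) : ℝ :=
  t ^ 2 * ∑ j : J, ω.1 j ^ 2 + 2 * ∑ i, ω.2 i ^ 2 + 2 * lam * ∑ j : J, |ω.1 j|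

/-- The signal with support `J` and latent variables `ω`. -/
noncomputable def signal (D₀ : Matrix (Fin m) (Fin p) ℝ) (J : Finset (Fin p))
    (ω : (Fin p → ℝ) × (Fin m → ℝ)) : Fin m → ℝ :=
  D₀ *ᵥ maskVec J ω.1 + ω.2

/-- The deviation of the signal from its representation in the dictionary `D`. -/
noncomputable def deviation (D₀ D : Matrix (Fin m) (Fin p) ℝ) (J : Finset (Fin p))
    (ω : (Fin p → ℝ) × (Fin m → ℝ)) : Fin m → ℝ :=
  ω.2 - (subDict D J - subDict D₀ J) *ᵥ fun j : J => ω.1 j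

lemma signal_eq (D₀ D : Matrix (Fin m) (Fin p) ℝ) (J : Finset (Fin p))
    (ω : (Fin p → ℝ) × (Fin m → ℝ)) :
    signal D₀ J ω = subDict D J *ᵥ (fun j : J => ω.1 j) + deviation D₀ D J ω := by
  rw [signal, mulVec_maskVec, deviation, sub_mulVec]; abel

lemma signal_eq_zero (D₀ : Matrix (Fin m) (Fin p) ℝ) (J : Finset (Fin p))
    (ω : (Fin p → ℝ) × (Fin m → ℝ)) :
    signal D₀ J ω = subDict D₀ J *ᵥ (fun j : J => ω.1 j) + ω.2 := by
  rw [signal, mulVec_maskVec]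

lemma measurable_signal (D₀ : Matrix (Fin m) (Fin p) ℝ) (J : Finset (Fin p)) :
    Measurable (signal D₀ J) := by
  have : signal D₀ J = fun ω => (subDict D₀ J *ᵥ fun j : J => ω.1 j) + ω.2 :=
    funext fun ω => signal_eq_zero D₀ J ω
  rw [this]
  unfold mulVec dotProduct
  fun_prop

lemma measurable_deviation (D₀ D : Matrix (Fin m) (Fin p) ℝ) (J : Finset (Fin p)) :
    Measurable (deviation D₀ D J) := by
  unfold deviation mulVec dotProduct
  fun_prop

variable {D₀ W : Matrix (Fin m) (Fin p) ℝ} {v : Fin p → ℝ} {t σα αmin σ lam : ℝ}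
  {ν η : Measure ℝ} {J : Finset (Fin p)}

namespace ModelData

lemma three_mul_sqrt_le (M : ModelData D₀ k t σα αmin σ lam ν η) :
    3 * √(t ^ 2 * σα ^ 2 + m * σ ^ 2) ≤ lam := by
  refine le_trans ?_ M.adm.1
  have h1 := one_le_constQ_sq M.pos M.small
  have h2 := constQ_sq_lt_two M.small
  refine mul_le_mul_of_nonneg_right ?_ (Real.sqrt_nonneg _)
  rw [le_div_iff₀ (by linarith)]
  linarith

lemma three_mul_le (M : ModelData D₀ k t σα αmin σ lam ν η) : 3 * (t * σα) ≤ lam := by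
  refine le_trans ?_ M.three_mul_sqrt_le
  refine mul_le_mul_of_nonneg_left ?_ (by norm_num)
  apply Real.le_sqrt_of_sq_le
  have : 0 ≤ (m : ℝ) * σ ^ 2 := by positivity
  nlinarith

lemma lam_pos (M : ModelData D₀ k t σα αmin σ lam ν η) : 0 < lam :=
  lt_of_lt_of_le (by have := M.pos; have := M.σα_pos; positivity) M.three_mul_le

lemma t_lt (M : ModelData D₀ k t σα αmin σ lam ν η) : t < 1 / 6 :=
  lt_of_small M.one_le M.small

lemma scale_pos (M : ModelData D₀ k t σα αmin σ lam ν η) : 0 < costScale m k σα σ lam := by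
  have h1 := M.lam_pos
  have h2 := M.σα_pos
  have h3 : (0 : ℝ) < k := by exact_mod_cast M.one_le
  rw [costScale]; positivity

lemma tau_pos (M : ModelData D₀ k t σα αmin σ lam ν η) : 0 < t ^ 2 * σα ^ 2 + m * σ ^ 2 := by
  have h1 := M.pos
  have h2 := M.σα_pos
  positivity

/-- γ is normalized so that the squared radius λ²(2 - Q_t²)² is the threshold of
`measure_sum_sq_ge_le` with r = γ. -/
lemma gamma_mul (M : ModelData D₀ k t σα αmin σ lam ν η) :
    (lam * (2 - constQ D₀ k t ^ 2)) ^ 2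
      = 5 * constGamma D₀ k t σα σ lam ^ 2 * (t ^ 2 * σα ^ 2 + m * σ ^ 2) := by
  have h1 := M.tau_pos
  rw [constGamma, div_pow, mul_pow (√5), Real.sq_sqrt h1.le, Real.sq_sqrt (by norm_num)]
  field_simp

lemma gamma_sq_ge (M : ModelData D₀ k t σα αmin σ lam ν η) :
    9 / 5 ≤ constGamma D₀ k t σα σ lam ^ 2 := by
  have h1 := M.tau_pos
  have h2 := constQ_sq_lt_two M.small
  have h3 := M.adm.1
  rw [div_mul_eq_mul_div, div_le_iff₀ (by linarith)] at h3
  have h4 : (3 * √(t ^ 2 * σα ^ 2 + m * σ ^ 2)) ^ 2 ≤ (lam * (2 - constQ D₀ k t ^ 2)) ^ 2 :=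
    pow_le_pow_left₀ (by positivity) h3 2
  rw [M.gamma_mul, mul_pow, Real.sq_sqrt h1.le] at h4
  have h5 : 9 ≤ 5 * constGamma D₀ k t σα σ lam ^ 2 := by
    rw [← mul_le_mul_iff_of_pos_right h1]; linarith
  linarith

lemma costBound_nonneg (M : ModelData D₀ k t σα αmin σ lam ν η)
    (ω : (Fin p → ℝ) × (Fin m → ℝ)) : 0 ≤ costBound t lam J ω := by
  have h1 := M.lam_pos
  have h2 : 0 ≤ ∑ j : J, ω.1 j ^ 2 := Finset.sum_nonneg fun _ _ => sq_nonneg _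
  have h3 : 0 ≤ ∑ i, ω.2 i ^ 2 := Finset.sum_nonneg fun _ _ => sq_nonneg _
  have h4 : 0 ≤ ∑ j : J, |ω.1 j| := Finset.sum_nonneg fun _ _ => abs_nonneg _
  rw [costBound]; positivity

lemma lassoVal_zero_le (M : ModelData D₀ k t σα αmin σ lam ν η)
    (ω : (Fin p → ℝ) × (Fin m → ℝ)) :
    lassoVal lam (signal D₀ J ω) D₀ ≤ 1 / 2 * ∑ i, ω.2 i ^ 2 + lam * ∑ j : J, |ω.1 j| := by
  rw [signal_eq_zero, ← dot_self_eq_sum]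
  exact lassoVal_signal_le M.lam_pos.le _ _ _

lemma lassoVal_zero_le_bound (M : ModelData D₀ k t σα αmin σ lam ν η)
    (ω : (Fin p → ℝ) × (Fin m → ℝ)) : lassoVal lam (signal D₀ J ω) D₀ ≤ costBound t lam J ω := by
  refine (M.lassoVal_zero_le ω).trans ?_
  have h1 := M.lam_pos
  have h2 : 0 ≤ ∑ j : J, ω.1 j ^ 2 := Finset.sum_nonneg fun _ _ => sq_nonneg _
  have h3 : 0 ≤ ∑ i, ω.2 i ^ 2 := Finset.sum_nonneg fun _ _ => sq_nonneg _
  have h4 : 0 ≤ lam * ∑ j : J, |ω.1 j| :=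
    mul_nonneg h1.le (Finset.sum_nonneg fun _ _ => abs_nonneg _)
  have h5 : 0 ≤ t ^ 2 * ∑ j : J, ω.1 j ^ 2 := by positivity
  rw [costBound]; linarith

lemma half_deviation_le (h : CurveData D₀ W v t k) (ω : (Fin p → ℝ) × (Fin m → ℝ)) :
    1 / 2 * (deviation D₀ (curve D₀ W v t) J ω ⬝ᵥ deviation D₀ (curve D₀ W v t) J ω)
      ≤ t ^ 2 * ∑ j : J, ω.1 j ^ 2 + ∑ i, ω.2 i ^ 2 := by
  have h1 : euclNorm (deviation D₀ (curve D₀ W v t) J ω)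
      ≤ euclNorm ω.2 + t * euclNorm (fun j : J => ω.1 j) :=
    (euclNorm_sub_le _ _).trans (by gcongr; exact h.euclNorm_sub_mulVec _)
  have h2 := pow_le_pow_left₀ (euclNorm_nonneg _) h1 2
  have h3 : euclNorm ω.2 ^ 2 = ∑ i, ω.2 i ^ 2 := by rw [euclNorm_sq, dot_self_eq_sum]
  have h4 : euclNorm (fun j : J => ω.1 j) ^ 2 = ∑ j : J, ω.1 j ^ 2 := by
    rw [euclNorm_sq, dot_self_eq_sum]
  rw [euclNorm_sq] at h2
  rw [← h3, ← h4]
  nlinarith [sq_nonneg (euclNorm ω.2 - t * euclNorm (fun j : J => ω.1 j))]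

lemma lassoVal_le_bound (M : ModelData D₀ k t σα αmin σ lam ν η) (h : CurveData D₀ W v t k)
    (ω : (Fin p → ℝ) × (Fin m → ℝ)) :
    lassoVal lam (signal D₀ J ω) (curve D₀ W v t) ≤ costBound t lam J ω := by
  have h1 := lassoVal_signal_le M.lam_pos.le (curve D₀ W v t) (fun j : J => ω.1 j)
    (deviation D₀ (curve D₀ W v t) J ω)
  rw [← signal_eq] at h1
  have h2 := half_deviation_le (J := J) h ω
  have h3 : 0 ≤ ∑ i, ω.2 i ^ 2 := Finset.sum_nonneg fun _ _ => sq_nonneg _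
  have h4 : 0 ≤ lam * ∑ j : J, |ω.1 j| :=
    mul_nonneg M.lam_pos.le (Finset.sum_nonneg fun _ _ => abs_nonneg _)
  rw [costBound]; linarith

lemma abs_lassoVal_sub_le (M : ModelData D₀ k t σα αmin σ lam ν η) (h : CurveData D₀ W v t k)
    (ω : (Fin p → ℝ) × (Fin m → ℝ)) :
    |lassoVal lam (signal D₀ J ω) (curve D₀ W v t) - lassoVal lam (signal D₀ J ω) D₀|
      ≤ costBound t lam J ω := by
  have h1 := M.lassoVal_le_bound (J := J) h ω
  have h2 := M.lassoVal_zero_le_bound (J := J) ω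
  have h3 := lassoVal_nonneg M.lam_pos.le (signal D₀ J ω) (curve D₀ W v t)
  have h4 := lassoVal_nonneg M.lam_pos.le (signal D₀ J ω) D₀
  rw [abs_le]; constructor <;> linarith

/-- The event on which sign recovery may fail. -/
def badSet (D₀ D : Matrix (Fin m) (Fin p) ℝ) (J : Finset (Fin p)) (r : ℝ) :
    Set ((Fin p → ℝ) × (Fin m → ℝ)) :=
  {ω | r < euclNorm (deviation D₀ D J ω)} ∪ {ω | r < euclNorm ω.2}

/-- The increment of the Lasso value is bounded below by the increment of the restricted least
squares value, up to an error on the bad event. -/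
lemma lsqVal_sub_le (M : ModelData D₀ k t σα αmin σ lam ν η) (h : CurveData D₀ W v t k)
    (hJ : J.card = k) {ω : (Fin p → ℝ) × (Fin m → ℝ)} (hω : ∀ j ∈ J, αmin ≤ |ω.1 j|) :
    lsqVal (subDict (curve D₀ W v t) J) (subDict D₀ J *ᵥ (fun j : J => ω.1 j) + ω.2)
        (lam • fun j : J => Real.sign (ω.1 j))
      - lsqVal (subDict D₀ J) (subDict D₀ J *ᵥ (fun j : J => ω.1 j) + ω.2)
        (lam • fun j : J => Real.sign (ω.1 j))
      ≤ lassoVal lam (signal D₀ J ω) (curve D₀ W v t) - lassoVal lam (signal D₀ J ω) D₀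
        + (badSet D₀ (curve D₀ W v t) J (lam * (2 - constQ D₀ k t ^ 2))).indicator
          (costBound t lam J) ω := by
  set D := curve D₀ W v t with hD
  set s : J → ℝ := fun j => Real.sign (ω.1 j) with hs
  set a : J → ℝ := fun j => ω.1 j with ha
  have hlam := M.lam_pos
  have hμ := (coherenceAt_pos (D₀ := D₀) M.pos).le
  have hne : ∀ j : J, ω.1 j ≠ 0 := by
    intro j h0
    have := hω j j.2
    rw [h0, abs_zero] at this
    linarith [M.αmin_pos]
  have hs1 : ∀ j, |s j| = 1 := by
    intro j
    rcases Real.sign_apply_eq_of_ne_zero _ (hne j) with h | h <;> simp [hs, h]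
  have hsa : ∀ j, s j * a j = |a j| := fun j => sign_mul_self_eq_abs _
  have ha1 : ∀ j, 9 / 4 * lam ≤ |a j| := fun j => by
    have := hω j j.2
    have := M.adm.2
    linarith
  have hq : constQ D₀ k t ^ 2 = 1 / (1 - J.card * coherenceAt D₀ t) := by
    rw [constQ_sq M.small, hJ]
  by_cases hbad : ω ∈ badSet D₀ D J (lam * (2 - constQ D₀ k t ^ 2))
  -- Here Lasso values are only known to be nonnegative. The quadratic sign term is at most λ∑|α|,
  -- because Q_t² < 2 and 2λ ≤ (9/4)λ ≤ |α|. The errors then sum exactly to `costBound`.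
  · rw [Set.indicator_of_mem hbad]
    have h1 := lsqVal_le (h.isUnit hJ) (deviation D₀ D J ω) a (lam • s)
    rw [← signal_eq, signal_eq_zero] at h1
    have h2 := dot_le_lsqVal (h.isUnit_zero hJ) ω.2 a (lam • s)
    have h3 : (lam • s) ⬝ᵥ a = lam * ∑ j : J, |ω.1 j| := by
      rw [smul_dotProduct, smul_eq_mul]
      congr 1
      exact Finset.sum_congr rfl fun j _ => hsa j
    have h4 : (lam • s) ⬝ᵥ (((subDict D₀ J)ᵀ * subDict D₀ J)⁻¹ *ᵥ (lam • s))
        ≤ lam * ∑ j : J, |ω.1 j| := by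
      rw [mulVec_smul, smul_dotProduct, dotProduct_smul, smul_eq_mul, smul_eq_mul]
      refine mul_le_mul_of_nonneg_left ?_ hlam.le
      rw [dotProduct, Finset.mul_sum]
      refine Finset.sum_le_sum fun j _ => ?_
      have h5 := (h.coherent_zero.gram J).abs_inv_mulVec_le hμ
        (by simpa using h.card_mul_lt hJ) (fun j => (hs1 j).le) j
      rw [h.constQ_eq hJ, one_mul] at h5
      have h6 : s j * (((subDict D₀ J)ᵀ * subDict D₀ J)⁻¹ *ᵥ s) j ≤ 2 := by
        refine (le_abs_self _).trans ?_
        rw [abs_mul, hs1, one_mul]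
        exact h5.trans (constQ_sq_lt_two M.small).le
      have h7 := ha1 j
      simp only [ha] at h7
      nlinarith
    have h5 := half_deviation_le (J := J) h ω
    have h6 := M.lassoVal_zero_le (J := J) ω
    have h7 := lassoVal_nonneg hlam.le (signal D₀ J ω) D
    rw [h3] at h1 h2
    rw [dot_self_eq_sum ω.2] at h2
    rw [costBound]
    linarith
  · rw [Set.indicator_of_notMem hbad, add_zero]
    rw [badSet, Set.mem_union, not_or] at hbad
    have h1 := h.coherent.lsqVal_le_lassoVal hμ (h.card_mul_lt hJ) hq hlam.le
      (fun j => (hs1 j).le) a (deviation D₀ D J ω) (not_lt.1 hbad.1)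
    have h2 := h.coherent_zero.lassoVal_le_lsqVal hμ (h.card_mul_lt hJ) hq.symm.le hlam.le
      hs1 hsa ha1 (not_lt.1 hbad.2)
    rw [← signal_eq, signal_eq_zero] at h1
    rw [signal_eq_zero]
    linarith

lemma measurable_costBound : Measurable (costBound (m := m) t lam J) := by
  unfold costBound
  fun_prop

variable [IsProbabilityMeasure ν] [IsProbabilityMeasure η]

lemma lintegral_exp_costBound_le (M : ModelData D₀ k t σα αmin σ lam ν η) (hJ : J.card = k) :
    ∫⁻ ω, ENNReal.ofReal (Real.exp (costBound t lam J ω / (8 * costScale m k σα σ lam)))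
      ∂(latent m p ν η) ≤ 2 := by
  set S := costScale m k σα σ lam with hS
  have hS0 : 0 < S := M.scale_pos
  have hlam := M.lam_pos
  have hσα := M.σα_pos
  -- This scaling gives each coefficient the variance proxy λσ_α, so coefficients and noise together
  -- have total proxy exactly S.
  set c := √(lam / σα) with hc
  have hc2 : c ^ 2 = lam / σα := Real.sq_sqrt (by positivity)
  have h1 := lintegral_exp_sum_sq_le (P := latent m p ν η) (ι := J ⊕ Fin m)
    (Y := Sum.elim (fun j ω => c * ω.1 j) (fun i ω => ω.2 i))
    (c := Sum.elim (fun _ => ⟨c ^ 2, sq_nonneg c⟩ * ⟨σα ^ 2, sq_nonneg σα⟩)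
      (fun _ => ⟨σ ^ 2, sq_nonneg σ⟩)) (S := S) (θ := 1 / 2) hS0
    (by
      rw [Fintype.sum_sum_type]
      refine le_of_eq ?_
      change (∑ _j : J, c ^ 2 * σα ^ 2) + ∑ _i : Fin m, σ ^ 2 = S
      simp only [Finset.sum_const, Finset.card_univ, Fintype.card_coe, hJ, nsmul_eq_mul,
        Fintype.card_fin]
      rw [hc2, hS, costScale]
      field_simp
      ring)
    (by
      rintro (j | i)
      · exact (hasSubgaussianMGF_coef M.subGaussian_coef _).const_mul c
      · exact hasSubgaussianMGF_noise M.subGaussian_noise i)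
    (by norm_num) (by norm_num)
  have hsqrt : 1 / √(1 - 1 / 2) = √2 := by
    rw [one_div, ← Real.sqrt_inv]; norm_num
  rw [hsqrt] at h1
  have h2 : ∀ ω : (Fin p → ℝ) × (Fin m → ℝ),
      ENNReal.ofReal (Real.exp (costBound t lam J ω / (8 * S)))
      ≤ ENNReal.ofReal (Real.exp (1 / 8)) * ENNReal.ofReal (Real.exp (1 / 2 / (2 * S)
        * ∑ l, (Sum.elim (fun (j : J) (ω : (Fin p → ℝ) × (Fin m → ℝ)) => c * ω.1 j)
          (fun i ω => ω.2 i) l ω) ^ 2)) := by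
    intro ω
    rw [← ENNReal.ofReal_mul (Real.exp_pos _).le, ← Real.exp_add]
    refine ENNReal.ofReal_le_ofReal (Real.exp_le_exp.2 ?_)
    simp only [Fintype.sum_sum_type, Sum.elim_inl, Sum.elim_inr, mul_pow, ← Finset.mul_sum, hc2]
    have h3 : costBound t lam J ω
        ≤ 2 * (lam / σα * ∑ j : J, ω.1 j ^ 2 + ∑ i, ω.2 i ^ 2) + S := by
      -- 2|α| ≤ α²/σ_α + σ_α turns the ℓ¹ term into squares plus a constant at most S. Divided by
      -- 8S, that constant leaves the factor exp(1/8), and exp(1/8)·√2 ≤ 2.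
      have h4 : 2 * lam * ∑ j : J, |ω.1 j| ≤ lam / σα * ∑ j : J, ω.1 j ^ 2 + lam * k * σα := by
        have h5 : lam * k * σα = ∑ _j : J, lam * σα := by
          simp [hJ]; ring
        rw [h5, Finset.mul_sum, Finset.mul_sum, ← Finset.sum_add_distrib]
        refine Finset.sum_le_sum fun j _ => ?_
        rw [← sq_abs (ω.1 j), div_mul_eq_mul_div, div_add' _ _ _ hσα.ne', le_div_iff₀ hσα]
        nlinarith [mul_nonneg hlam.le (sq_nonneg (|ω.1 j| - σα))]
      have h5 : t ^ 2 ≤ lam / σα := by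
        rw [le_div_iff₀ hσα]
        have := M.three_mul_le
        have := M.t_lt
        have h6 : t ^ 2 * σα ≤ t * σα := by
          have := mul_pos M.pos hσα
          nlinarith [M.pos]
        nlinarith [mul_pos M.pos hσα]
      have h6 : 0 ≤ ∑ j : J, ω.1 j ^ 2 := Finset.sum_nonneg fun _ _ => sq_nonneg _
      have h7 := mul_le_mul_of_nonneg_right h5 h6
      have h8 : lam * k * σα ≤ S := by
        rw [hS, costScale]
        have : 0 ≤ (m : ℝ) * σ ^ 2 := by positivity
        linarith
      rw [costBound]
      linarith
    rw [div_le_iff₀ (by positivity)]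
    calc _ ≤ _ := h3
      _ = _ := by field_simp; ring
  refine (lintegral_mono h2).trans ?_
  rw [lintegral_const_mul' _ _ ENNReal.ofReal_ne_top]
  refine (mul_le_mul_right h1 _).trans ?_
  rw [← ENNReal.ofReal_mul (Real.exp_pos _).le]
  have h9 : Real.exp (1 / 8) * √2 ≤ 2 := by
    have h10 : Real.exp (1 / 8) ≤ √2 := by
      apply Real.le_sqrt_of_sq_le
      rw [← Real.exp_nat_mul]
      have h11 := Real.exp_one_lt_d9
      have h12 : Real.exp ((2 : ℕ) * (1 / 8)) ^ 4 = Real.exp 1 := by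
        rw [← Real.exp_nat_mul]; norm_num
      by_contra! hcon
      have := pow_lt_pow_left₀ hcon (by norm_num) (n := 4) (by norm_num)
      rw [h12] at this
      norm_num at this
      linarith
    calc _ ≤ √2 * √2 := by gcongr
      _ = 2 := Real.mul_self_sqrt (by norm_num)
  calc _ ≤ ENNReal.ofReal 2 := ENNReal.ofReal_le_ofReal h9
    _ = 2 := by simp

/-- The squared displacements of the columns in J sum to at most t², so the coordinates of the
deviation have total variance proxy at most t²σ_α² + mσ². Noise and deviation contribute one tail
each. -/
lemma measure_badSet_le (M : ModelData D₀ k t σα αmin σ lam ν η) (h : CurveData D₀ W v t k) :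
    latent m p ν η (badSet D₀ (curve D₀ W v t) J (lam * (2 - constQ D₀ k t ^ 2)))
      ≤ ENNReal.ofReal (2 * √5 * Real.exp (-2 * constGamma D₀ k t σα σ lam ^ 2)) := by
  set γ := constGamma D₀ k t σα σ lam with hγ
  set r := lam * (2 - constQ D₀ k t ^ 2) with hr
  have hr0 : 0 ≤ r := mul_nonneg M.lam_pos.le (by linarith [constQ_sq_lt_two M.small])
  have hsq : ∀ y : Fin m → ℝ, r < euclNorm y →
      5 * γ ^ 2 * (t ^ 2 * σα ^ 2 + m * σ ^ 2) < ∑ i, y i ^ 2 := by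
    intro y hy
    rw [← M.gamma_mul, ← dot_self_eq_sum, ← euclNorm_sq]
    exact pow_lt_pow_left₀ hy hr0 (by norm_num)
  have h1 : latent m p ν η {ω | r < euclNorm (deviation D₀ (curve D₀ W v t) J ω)}
      ≤ ENNReal.ofReal (√5 * Real.exp (-2 * γ ^ 2)) := by
    have h2 := measure_sum_sq_ge_le (P := latent m p ν η) (ι := Fin m) (r := γ)
      (Y := fun i ω => ∑ j ∈ J, (-(curve D₀ W v t - D₀) i j) * ω.1 j + ω.2 i)
      (c := fun i => ∑ j ∈ J, ⟨(-(curve D₀ W v t - D₀) i j) ^ 2, sq_nonneg _⟩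
        * ⟨σα ^ 2, sq_nonneg σα⟩ + ⟨σ ^ 2, sq_nonneg σ⟩)
      (S := t ^ 2 * σα ^ 2 + m * σ ^ 2) M.tau_pos
      (by
        have hcoe : ∀ i, ((∑ j ∈ J, ⟨(-(curve D₀ W v t - D₀) i j) ^ 2, sq_nonneg _⟩
            * ⟨σα ^ 2, sq_nonneg σα⟩ + ⟨σ ^ 2, sq_nonneg σ⟩ : NNReal) : ℝ)
            = ∑ j ∈ J, (curve D₀ W v t - D₀) i j ^ 2 * σα ^ 2 + σ ^ 2 := by
          intro i
          refine (NNReal.coe_add _ _).trans (congrArg₂ _ ((NNReal.coe_sum _ _).trans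
            (Finset.sum_congr rfl fun j _ => ?_)) rfl)
          rw [← neg_sq ((curve D₀ W v t - D₀) i j)]
          rfl
        rw [Finset.sum_congr rfl fun i _ => hcoe i]
        simp only [Finset.sum_add_distrib, Finset.sum_const, Finset.card_univ,
          Fintype.card_fin, nsmul_eq_mul]
        refine add_le_add ?_ le_rfl
        rw [Finset.sum_comm]
        have h3 : ∀ j, ∑ i, (curve D₀ W v t - D₀) i j ^ 2 * σα ^ 2 ≤ t ^ 2 * v j ^ 2 * σα ^ 2 := by
          intro j
          rw [← Finset.sum_mul]
          refine mul_le_mul_of_nonneg_right ?_ (sq_nonneg _)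
          have := pow_le_pow_left₀ (euclNorm_nonneg _) (h.euclNorm_sub_col j) 2
          rw [euclNorm_sq, dot_self_eq_sum, mul_pow, sq_abs] at this
          exact this
        calc _ ≤ ∑ j ∈ J, t ^ 2 * v j ^ 2 * σα ^ 2 := Finset.sum_le_sum fun j _ => h3 j
          _ ≤ ∑ j, t ^ 2 * v j ^ 2 * σα ^ 2 :=
            Finset.sum_le_sum_of_subset_of_nonneg (Finset.subset_univ J) fun _ _ _ => by positivity
          _ = t ^ 2 * σα ^ 2 := by
            rw [← Finset.sum_mul, ← Finset.mul_sum, h.sum_sq, mul_one])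
      (fun i => hasSubgaussianMGF_linear M.subGaussian_coef M.subGaussian_noise J _ i)
    refine le_trans (measure_mono fun ω hω => ?_) h2
    have h4 := hsq _ hω
    have h5 : ∀ i, ∑ j ∈ J, (-(curve D₀ W v t - D₀) i j) * ω.1 j + ω.2 i
        = deviation D₀ (curve D₀ W v t) J ω i := by
      intro i
      change _ = ω.2 i - ∑ j : J, (curve D₀ W v t - D₀) i j * ω.1 j
      rw [add_comm, sub_eq_add_neg (ω.2 i), ← Finset.sum_neg_distrib, ← Finset.sum_attach J]
      congr 1
      exact Finset.sum_congr rfl fun j _ => neg_mul _ _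
    change _ < ∑ i, (∑ j ∈ J, (-(curve D₀ W v t - D₀) i j) * ω.1 j + ω.2 i) ^ 2
    simp_rw [h5]
    exact h4
  have h2 : latent m p ν η {ω | r < euclNorm ω.2} ≤ ENNReal.ofReal (√5 * Real.exp (-2 * γ ^ 2)) := by
    have h2 := measure_sum_sq_ge_le (P := latent m p ν η) (ι := Fin m) (r := γ)
      (Y := fun i ω => ω.2 i) (c := fun i => ⟨σ ^ 2, sq_nonneg σ⟩)
      (S := t ^ 2 * σα ^ 2 + m * σ ^ 2) M.tau_pos
      (by
        change ∑ _i : Fin m, σ ^ 2 ≤ _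
        simp only [Finset.sum_const, Finset.card_univ, Fintype.card_fin, nsmul_eq_mul]
        have : 0 ≤ t ^ 2 * σα ^ 2 := by positivity
        linarith)
      (fun i => hasSubgaussianMGF_noise M.subGaussian_noise i)
    exact le_trans (measure_mono fun ω hω => hsq _ hω) h2
  refine (measure_union_le _ _).trans ((add_le_add h1 h2).trans (le_of_eq ?_))
  rw [← ENNReal.ofReal_add (by positivity) (by positivity)]
  congr 1
  ring

lemma measurableSet_badSet (D : Matrix (Fin m) (Fin p) ℝ) (r : ℝ) :
    MeasurableSet (badSet D₀ D J r) := by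
  have hE : Measurable (euclNorm : (Fin m → ℝ) → ℝ) := by
    have : (euclNorm : (Fin m → ℝ) → ℝ) = fun x => √(∑ i, x i ^ 2) := by
      ext x
      rw [← dot_self_eq_sum, ← euclNorm_sq, Real.sqrt_sq (euclNorm_nonneg x)]
    rw [this]; fun_prop
  exact (measurableSet_lt measurable_const (hE.comp (measurable_deviation D₀ D J))).union
    (measurableSet_lt measurable_const (hE.comp measurable_snd))

lemma integrable_exp_costBound (M : ModelData D₀ k t σα αmin σ lam ν η) (hJ : J.card = k) :
    Integrable (fun ω => Real.exp (costBound t lam J ω / (8 * costScale m k σα σ lam)))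
      (latent m p ν η) := by
  refine ⟨(measurable_costBound.div_const _).exp.aestronglyMeasurable, ?_⟩
  rw [hasFiniteIntegral_iff_ofReal (Filter.Eventually.of_forall fun _ => (Real.exp_pos _).le)]
  exact lt_of_le_of_lt (M.lintegral_exp_costBound_le hJ) (by simp)

lemma integral_exp_costBound_le (M : ModelData D₀ k t σα αmin σ lam ν η) (hJ : J.card = k) :
    ∫ ω, Real.exp (costBound t lam J ω / (8 * costScale m k σα σ lam)) ∂(latent m p ν η) ≤ 2 := by
  have h1 := M.lintegral_exp_costBound_le hJ
  rw [← ofReal_integral_eq_lintegral_ofReal (M.integrable_exp_costBound hJ)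
    (Filter.Eventually.of_forall fun _ => (Real.exp_pos _).le)] at h1
  rw [← ENNReal.ofReal_le_ofReal_iff (by norm_num)]
  simpa using h1

lemma integrable_costBound (M : ModelData D₀ k t σα αmin σ lam ν η) (hJ : J.card = k) :
    Integrable (costBound t lam J) (latent m p ν η) := by
  have hS := M.scale_pos
  refine ((M.integrable_exp_costBound hJ).const_mul (8 * costScale m k σα σ lam)).mono'
    measurable_costBound.aestronglyMeasurable (Filter.Eventually.of_forall fun ω => ?_)
  rw [Real.norm_of_nonneg (M.costBound_nonneg ω)]
  have h1 := Real.add_one_le_exp (costBound t lam J ω / (8 * costScale m k σα σ lam))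
  calc costBound t lam J ω = 8 * costScale m k σα σ lam
        * (costBound t lam J ω / (8 * costScale m k σα σ lam)) := by field_simp
    _ ≤ _ := by gcongr; linarith

lemma sq_le_exp {x : ℝ} (hx : 0 ≤ x) : x ^ 2 ≤ Real.exp x := by
  have h1 := Real.quadratic_le_exp_of_nonneg (x := x / 2) (by positivity)
  have h2 : Real.exp x = Real.exp (x / 2) ^ 2 := by
    rw [← Real.exp_nat_mul]; congr 1; push_cast; ring
  rw [h2]
  refine pow_le_pow_left₀ hx ?_ 2
  nlinarith [sq_nonneg (x - 2)]

lemma integral_indicator_costBound_le (M : ModelData D₀ k t σα αmin σ lam ν η)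
    (h : CurveData D₀ W v t k) (hJ : J.card = k) :
    ∫ ω, (badSet D₀ (curve D₀ W v t) J (lam * (2 - constQ D₀ k t ^ 2))).indicator
        (costBound t lam J) ω ∂(latent m p ν η)
      ≤ 26 * costScale m k σα σ lam * Real.exp (-constGamma D₀ k t σα σ lam ^ 2) := by
  set P := latent m p ν η with hP
  set S := costScale m k σα σ lam with hS
  have hS0 : 0 < S := M.scale_pos
  set B := badSet D₀ (curve D₀ W v t) J (lam * (2 - constQ D₀ k t ^ 2)) with hB
  have hBm : MeasurableSet B := measurableSet_badSet _ _
  set γ := constGamma D₀ k t σα σ lam with hγ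
  have h1 : ∀ ω, B.indicator (costBound t lam J) ω ≤ 4 * S * (Real.exp (-γ ^ 2)
      * Real.exp (costBound t lam J ω / (8 * S))) + 4 * S * (Real.exp (γ ^ 2)
      * B.indicator (fun _ => (1 : ℝ)) ω) := by
    intro ω
    by_cases hω : ω ∈ B
    · rw [Set.indicator_of_mem hω, Set.indicator_of_mem hω, mul_one]
      set V := costBound t lam J ω / (8 * S) with hV
      have hV0 : 0 ≤ V := div_nonneg (M.costBound_nonneg ω) (by positivity)
      have h2 := sq_le_exp hV0
      -- These weights balance the two terms: the first integrates to O(e^{-γ²}), the second to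
      -- e^{γ²} times the probability of the bad event, again O(e^{-γ²}). The final 26 is 4(2 +
      -- 9/2).
      have h3 : 2 * V ≤ Real.exp (-γ ^ 2) * V ^ 2 + Real.exp (γ ^ 2) := by
        have h4 : Real.exp (-γ ^ 2) * Real.exp (γ ^ 2) = 1 := by
          rw [← Real.exp_add]; simp
        have h5 : 0 < Real.exp (γ ^ 2) := Real.exp_pos _
        have h6 : Real.exp (-γ ^ 2) * (V - Real.exp (γ ^ 2)) ^ 2
            = Real.exp (-γ ^ 2) * V ^ 2 - 2 * V + Real.exp (γ ^ 2) := by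
          linear_combination (Real.exp (γ ^ 2) - 2 * V) * h4
        have h7 : 0 ≤ Real.exp (-γ ^ 2) * (V - Real.exp (γ ^ 2)) ^ 2 := by positivity
        linarith
      have h4 := mul_le_mul_of_nonneg_left h2 (Real.exp_pos (-γ ^ 2)).le
      have h5 : costBound t lam J ω = 4 * S * (2 * V) := by rw [hV]; field_simp; ring
      rw [h5, ← mul_add]
      exact mul_le_mul_of_nonneg_left (by linarith) (by positivity)
    · rw [Set.indicator_of_notMem hω, Set.indicator_of_notMem hω]
      positivity
  have i1 : Integrable (fun ω => 4 * S * (Real.exp (-γ ^ 2)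
      * Real.exp (costBound t lam J ω / (8 * S)))) P :=
    ((M.integrable_exp_costBound hJ).const_mul _).const_mul _
  have i2 : Integrable (fun ω => 4 * S * (Real.exp (γ ^ 2)
      * B.indicator (fun _ => (1 : ℝ)) ω)) P :=
    (((integrable_const 1).indicator hBm).const_mul _).const_mul _
  refine (integral_mono ((M.integrable_costBound hJ).indicator hBm) (i1.add i2) h1).trans ?_
  simp only [Pi.add_apply]
  rw [integral_add i1 i2]
  simp only [integral_const_mul]
  rw [integral_indicator_const _ hBm, smul_eq_mul, mul_one]
  have h2 : P.real B ≤ 2 * √5 * Real.exp (-2 * γ ^ 2) :=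
    ENNReal.toReal_le_of_le_ofReal (by positivity) (M.measure_badSet_le h)
  have h3 := M.integral_exp_costBound_le hJ
  have h4 : Real.exp (γ ^ 2) * Real.exp (-2 * γ ^ 2) = Real.exp (-γ ^ 2) := by
    rw [← Real.exp_add]; ring_nf
  have h5 : √5 ≤ 9 / 4 := by
    rw [Real.sqrt_le_left (by norm_num)]; norm_num
  have h6 : Real.exp (γ ^ 2) * P.real B ≤ 9 / 2 * Real.exp (-γ ^ 2) := by
    calc _ ≤ Real.exp (γ ^ 2) * (2 * √5 * Real.exp (-2 * γ ^ 2)) := by gcongr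
      _ = 2 * √5 * Real.exp (-γ ^ 2) := by rw [← h4]; ring
      _ ≤ _ := by gcongr; linarith
  have h7 := mul_le_mul_of_nonneg_left h3 (Real.exp_pos (-γ ^ 2)).le
  calc _ ≤ 4 * S * (Real.exp (-γ ^ 2) * 2) + 4 * S * (9 / 2 * Real.exp (-γ ^ 2)) := by gcongr
    _ = _ := by ring

end ModelData

end Model

/-! ### Expected increment along a curve -/

section ExpectedIncrement

variable {m p k : ℕ} {D₀ W : Matrix (Fin m) (Fin p) ℝ} {v : Fin p → ℝ} {t σα αmin σ lam : ℝ}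
  {ν η : Measure ℝ} {J : Finset (Fin p)} [IsProbabilityMeasure ν] [IsProbabilityMeasure η]

lemma lintegral_signalLaw (π : PMF (Finset (Fin p))) {g : (Fin m → ℝ) → ENNReal}
    (hg : Measurable g) : ∫⁻ x, g x ∂(signalLaw D₀ π ν η)
      = ∑ J, π J * ∫⁻ ω, g (signal D₀ J ω) ∂(latent m p ν η) := by
  rw [signalLaw, lintegral_finsetSum_measure]
  refine Finset.sum_congr rfl fun J _ => ?_
  rw [lintegral_smul_measure, smul_eq_mul]
  congr 1
  exact lintegral_map hg (measurable_signal D₀ J)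

lemma integral_signalLaw (π : PMF (Finset (Fin p))) {g : (Fin m → ℝ) → ℝ} (hg : Measurable g)
    (hi : ∀ J, π J ≠ 0 → Integrable (fun ω => g (signal D₀ J ω)) (latent m p ν η)) :
    ∫ x, g x ∂(signalLaw D₀ π ν η)
      = supportAvg π fun J => ∫ ω, g (signal D₀ J ω) ∂(latent m p ν η) := by
  rw [signalLaw, integral_finsetSum_measure]
  · refine Finset.sum_congr rfl fun J _ => ?_
    rw [integral_smul_measure, smul_eq_mul]
    congr 1
    exact integral_map (measurable_signal D₀ J).aemeasurable hg.aestronglyMeasurable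
  · intro J _
    by_cases h0 : π J = 0
    · rw [h0, zero_smul]; exact integrable_zero_measure
    · refine Integrable.smul_measure ?_ (π.apply_ne_top J)
      exact (integrable_map_measure (μ := latent m p ν η) (f := signal D₀ J)
        hg.aestronglyMeasurable (measurable_signal D₀ J).aemeasurable).2 (hi J h0)

lemma lintegral_signalLaw_le {π : PMF (Finset (Fin p))} (hπ : IsSupportLaw π k)
    {g : (Fin m → ℝ) → ENNReal} (hg : Measurable g) {c : ENNReal}
    (h : ∀ J, J.card = k → ∫⁻ ω, g (signal D₀ J ω) ∂(latent m p ν η) ≤ c) :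
    ∫⁻ x, g x ∂(signalLaw D₀ π ν η) ≤ c := by
  rw [lintegral_signalLaw π hg]
  calc _ ≤ ∑ J, π J * c := by
        refine Finset.sum_le_sum fun J _ => ?_
        by_cases h0 : π J = 0
        · simp [h0]
        · exact mul_le_mul_right (h J (hπ.card_eq J h0)) _
    _ = c := by
        rw [← Finset.sum_mul, ← tsum_fintype (L := .unconditional _), π.tsum_coe, one_mul]

namespace ModelData

lemma lintegral_exp_abs_increment_le (M : ModelData D₀ k t σα αmin σ lam ν η)
    (h : CurveData D₀ W v t k) {π : PMF (Finset (Fin p))} (hπ : IsSupportLaw π k) :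
    ∫⁻ x, ENNReal.ofReal (Real.exp |(lassoVal lam x (curve D₀ W v t) - lassoVal lam x D₀)
      / (8 * costScale m k σα σ lam)|) ∂(signalLaw D₀ π ν η) ≤ 2 := by
  have hS := M.scale_pos
  have hm1 := measurable_lassoVal M.lam_pos.le (curve D₀ W v t)
  have hm2 := measurable_lassoVal M.lam_pos.le D₀
  refine lintegral_signalLaw_le hπ ?_ fun J hJ => ?_
  · exact (((hm1.sub hm2).div_const _).abs).exp.ennreal_ofReal
  · refine le_trans (lintegral_mono fun ω => ?_) (M.lintegral_exp_costBound_le hJ)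
    refine ENNReal.ofReal_le_ofReal (Real.exp_le_exp.2 ?_)
    rw [abs_div, abs_of_pos (by positivity : 0 < 8 * costScale m k σα σ lam)]
    gcongr
    exact M.abs_lassoVal_sub_le h ω

lemma lintegral_exp_lassoVal_le (M : ModelData D₀ k t σα αmin σ lam ν η)
    (h : CurveData D₀ W v t k) {π : PMF (Finset (Fin p))} (hπ : IsSupportLaw π k) :
    ∫⁻ x, ENNReal.ofReal (Real.exp (lassoVal lam x (curve D₀ W v t)
      / (8 * costScale m k σα σ lam))) ∂(signalLaw D₀ π ν η) ≤ 2 := by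
  have hS := M.scale_pos
  have hm1 := measurable_lassoVal M.lam_pos.le (curve D₀ W v t)
  refine lintegral_signalLaw_le hπ ?_ fun J hJ => ?_
  · exact (hm1.div_const _).exp.ennreal_ofReal
  · refine le_trans (lintegral_mono fun ω => ?_) (M.lintegral_exp_costBound_le hJ)
    refine ENNReal.ofReal_le_ofReal (Real.exp_le_exp.2 ?_)
    gcongr
    exact M.lassoVal_le_bound h ω

lemma integrable_increment (M : ModelData D₀ k t σα αmin σ lam ν η)
    (h : CurveData D₀ W v t k) (hJ : J.card = k) :
    Integrable (fun ω => lassoVal lam (signal D₀ J ω) (curve D₀ W v t)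
      - lassoVal lam (signal D₀ J ω) D₀) (latent m p ν η) :=
  (M.integrable_costBound hJ).mono'
    (((measurable_lassoVal M.lam_pos.le _).comp (measurable_signal D₀ J)).sub
      ((measurable_lassoVal M.lam_pos.le _).comp (measurable_signal D₀ J))).aestronglyMeasurable
    (Filter.Eventually.of_forall fun ω => M.abs_lassoVal_sub_le h ω)

lemma ae_coef_ge (M : ModelData D₀ k t σα αmin σ lam ν η) (J : Finset (Fin p)) :
    ∀ᵐ ω ∂(latent m p ν η), ∀ j ∈ J, αmin ≤ |ω.1 j| := by
  have h1 : ∀ j : Fin p, ∀ᵐ ω ∂(latent m p ν η), αmin ≤ |ω.1 j| := fun j =>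
    (measurePreserving_coef (m := m) (ν := ν) (η := η) j).quasiMeasurePreserving.ae M.bound
  filter_upwards [ae_all_iff.2 h1] with ω hω j _ using hω j

/-- The expected increment for a given support. -/
lemma le_integral_increment (M : ModelData D₀ k t σα αmin σ lam ν η)
    (h : CurveData D₀ W v t k) (hJ : J.card = k) :
    (∫ a, a ^ 2 ∂ν) / 2 * ∑ i : J,
        D₀ᵀ i ⬝ᵥ (projCompl (subDict (curve D₀ W v t) J) *ᵥ D₀ᵀ i)
      + lam * (∫ a, |a| ∂ν) * ∑ i : J, (((((subDict (curve D₀ W v t) J)ᵀ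
        * subDict (curve D₀ W v t) J)⁻¹ * (subDict (curve D₀ W v t) J)ᵀ) *ᵥ D₀ᵀ i) i - 1)
      - lam ^ 2 / 2 * (((subDict (curve D₀ W v t) J)ᵀ * subDict (curve D₀ W v t) J)⁻¹
        - ((subDict D₀ J)ᵀ * subDict D₀ J)⁻¹).trace
      - 26 * costScale m k σα σ lam * Real.exp (-constGamma D₀ k t σα σ lam ^ 2)
    ≤ ∫ ω, lassoVal lam (signal D₀ J ω) (curve D₀ W v t)
      - lassoVal lam (signal D₀ J ω) D₀ ∂(latent m p ν η) := by
  have hν2 : MemLp id 2 ν := M.subGaussian_coef.memLp 2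
  have hη2 : MemLp id 2 η := M.subGaussian_noise.memLp 2
  have hν0 : ∫ a, a ∂ν = 0 := integral_eq_zero_of_hasSubgaussianMGF M.subGaussian_coef
  have hη0 : ∫ a, a ∂η = 0 := integral_eq_zero_of_hasSubgaussianMGF M.subGaussian_noise
  have hne : ∀ᵐ a ∂ν, a ≠ 0 := by
    filter_upwards [M.bound] with a ha h0
    rw [h0, abs_zero] at ha
    linarith [M.αmin_pos]
  have hsign : 2 ≤ J.card → ∫ a, Real.sign a ∂ν = 0 := by rw [hJ]; exact M.sign
  obtain ⟨i1, e1⟩ := integral_lsqVal (A := subDict (curve D₀ W v t) J) (A₀ := subDict D₀ J)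
    (h.isUnit hJ) hν2 hη2 hν0 hη0 hne hsign lam
  obtain ⟨i2, e2⟩ := integral_lsqVal (A := subDict D₀ J) (A₀ := subDict D₀ J)
    (h.isUnit_zero hJ) hν2 hη2 hν0 hη0 hne hsign lam
  have i3 := (M.integrable_costBound hJ (m := m) (η := η)).indicator
    (measurableSet_badSet (D₀ := D₀) (J := J) (curve D₀ W v t) (lam * (2 - constQ D₀ k t ^ 2)))
  have i4 := M.integrable_increment (η := η) h hJ
  have h1 := integral_mono_ae (i1.sub i2) (i4.add i3) (by
    filter_upwards [M.ae_coef_ge J] with ω hω using M.lsqVal_sub_le h hJ hω)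
  simp only [Pi.sub_apply, Pi.add_apply] at h1
  rw [integral_sub i1 i2, integral_add i4 i3, e1, e2] at h1
  have h2 := M.integral_indicator_costBound_le h hJ
  have h3 : (subDict D₀ J)ᵀ * projCompl (subDict D₀ J) * subDict D₀ J = 0 := by
    rw [Matrix.mul_assoc, projCompl_mul (h.isUnit_zero hJ), Matrix.mul_zero]
  have h4 : ((subDict D₀ J)ᵀ * subDict D₀ J)⁻¹ * (subDict D₀ J)ᵀ * subDict D₀ J = 1 := by
    rw [Matrix.mul_assoc, nonsing_inv_mul _ (h.isUnit_zero hJ)]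
  -- At D₀ the projection term is 0 and the pseudo-inverse term is |J|; the noise energy,
  -- proportional to m - |J|, is common to both dictionaries and cancels.
  rw [h3, h4, trace_zero, trace_one, Fintype.card_coe, Matrix.mul_assoc] at h1
  rw [trace_sub]
  have h5 : ((subDict D₀ J)ᵀ * (projCompl (subDict (curve D₀ W v t) J) * subDict D₀ J)).trace
      = ∑ i : J, D₀ᵀ i ⬝ᵥ (projCompl (subDict (curve D₀ W v t) J) *ᵥ D₀ᵀ i) := rfl
  have h6 : (((subDict (curve D₀ W v t) J)ᵀ * subDict (curve D₀ W v t) J)⁻¹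
      * (subDict (curve D₀ W v t) J)ᵀ * subDict D₀ J).trace
      = ∑ i : J, (((((subDict (curve D₀ W v t) J)ᵀ
        * subDict (curve D₀ W v t) J)⁻¹ * (subDict (curve D₀ W v t) J)ᵀ) *ᵥ D₀ᵀ i) i - 1)
        + J.card := by
    rw [Finset.sum_sub_distrib]
    simp only [Finset.sum_const, Finset.card_univ, Fintype.card_coe, nsmul_eq_mul, mul_one,
      sub_add_cancel]
    rfl
  rw [h5, h6] at h1
  linarith

/-- The expected increment of the cost of a signal along a curve. -/
lemma le_integral_signalLaw (M : ModelData D₀ k t σα αmin σ lam ν η)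
    (h : CurveData D₀ W v t k) {π : PMF (Finset (Fin p))} (hπ : IsSupportLaw π k) :
    (1 - constK D₀ k t ^ 2) * ((∫ a, a ^ 2 ∂ν) / 2) * (k / p) * t ^ 2
      - constQ D₀ k t ^ 2 * (16 / 9 * constQ D₀ k t ^ 2 + 3) * (∫ a, |a| ∂ν) * t * (k / p)
        * opNorm D₀ * (k * coherenceAt D₀ t) * lam
      - 26 * costScale m k σα σ lam * Real.exp (-constGamma D₀ k t σα σ lam ^ 2)
    ≤ ∫ x, lassoVal lam x (curve D₀ W v t) - lassoVal lam x D₀ ∂(signalLaw D₀ π ν η) := by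
  rw [integral_signalLaw π (g := fun x => lassoVal lam x (curve D₀ W v t) - lassoVal lam x D₀)
    ((measurable_lassoVal M.lam_pos.le _).sub (measurable_lassoVal M.lam_pos.le _))
    fun J h0 => M.integrable_increment h (hπ.card_eq J h0)]
  refine le_trans ?_ (hπ.avg_mono fun J hJ => M.le_integral_increment h hJ)
  rw [supportAvg_sub, supportAvg_sub, supportAvg_add, supportAvg_const_mul, supportAvg_const_mul,
    supportAvg_const_mul, supportAvg_const]
  have hlam := M.lam_pos
  have hp0 : 0 < p := M.one_le.trans hπ.le
  have hY : 0 ≤ t * (k / p) * opNorm D₀ * (k * coherenceAt D₀ t) := by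
    have := M.pos
    have := coherenceAt_pos (D₀ := D₀) M.pos
    have := opNorm_nonneg D₀
    positivity
  have h1 := mul_le_mul_of_nonneg_left (h.avg_projCompl_ge hπ)
    (by positivity : 0 ≤ (∫ a, a ^ 2 ∂ν) / 2)
  have hE : αmin ≤ ∫ a, |a| ∂ν := by
    have h2 := integral_mono_ae (integrable_const αmin) M.subGaussian_coef.integrable.abs M.bound
    simpa using h2
  have hE0 : 0 < ∫ a, |a| ∂ν := lt_of_lt_of_le M.αmin_pos hE
  have h2 := mul_le_mul_of_nonneg_left (h.avg_trace_pinv_ge hπ)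
    (by positivity : 0 ≤ lam * ∫ a, |a| ∂ν)
  have h3 := mul_le_mul_of_nonneg_left (h.avg_trace_inv_sub_le hπ)
    (by positivity : 0 ≤ lam ^ 2 / 2)
  set Y := t * (k / p) * opNorm D₀ * (k * coherenceAt D₀ t) with hYdef
  -- One factor λ is traded for (4/9)E|α|, using λ ≤ (4/9)α_min; this yields 16/9 = 4·(4/9).
  have h4 : lam ^ 2 / 2 * (8 * (constQ D₀ k t ^ 2) ^ 2 * Y)
      ≤ constQ D₀ k t ^ 2 * (16 / 9 * constQ D₀ k t ^ 2) * (∫ a, |a| ∂ν) * Y * lam := by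
    have h5 : lam ≤ 4 / 9 * ∫ a, |a| ∂ν := by linarith [M.adm.2]
    have h6 : 0 ≤ 4 * lam * ((constQ D₀ k t ^ 2) ^ 2 * Y) := by positivity
    have h7 := mul_le_mul_of_nonneg_left h5 h6
    linarith
  linarith

end ModelData

end ExpectedIncrement

/-! ### Deviation bounds from exponential moments -/

section Concentration

variable {Ω : Type*} [MeasurableSpace Ω] {P : Measure Ω} [IsProbabilityMeasure P]

lemma exp_le_one_add_sq_mul_exp (x : ℝ) : Real.exp x ≤ 1 + x + x ^ 2 * Real.exp |x| := by
  have h1 : Real.exp x - 1 ≤ x * Real.exp x := by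
    have h2 := Real.add_one_le_exp (-x)
    have h3 : Real.exp (-x) * Real.exp x = 1 := by rw [← Real.exp_add]; simp
    nlinarith [Real.exp_pos x]
  rcases le_or_gt 0 x with hx | hx
  · rw [abs_of_nonneg hx]
    nlinarith
  · have h2 := Real.add_one_le_exp x
    have h3 : 1 ≤ Real.exp |x| := Real.one_le_exp (abs_nonneg x)
    nlinarith [sq_nonneg x, mul_nonneg (sq_nonneg x) (sub_nonneg.2 h3)]

/-- For θ ≤ 1/2, half of the exponent |u| pays for exp(θ|u|) and the other half for u² ≤ 8
exp(|u|/2). -/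
lemma exp_neg_mul_le {θ : ℝ} (hθ0 : 0 ≤ θ) (hθ : θ ≤ 1 / 2) (u : ℝ) :
    Real.exp (-θ * u) ≤ 1 - θ * u + 8 * θ ^ 2 * Real.exp |u| := by
  have h1 := exp_le_one_add_sq_mul_exp (-θ * u)
  have h2 : |-θ * u| ≤ |u| / 2 := by
    rw [abs_mul, abs_neg, abs_of_nonneg hθ0]
    nlinarith [abs_nonneg u]
  have h3 : u ^ 2 ≤ 8 * Real.exp (|u| / 2) := by
    have := Real.quadratic_le_exp_of_nonneg (x := |u| / 2) (by positivity)
    rw [← sq_abs u]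
    nlinarith [abs_nonneg u]
  have h4 : Real.exp |u| = Real.exp (|u| / 2) * Real.exp (|u| / 2) := by
    rw [← Real.exp_add]; ring_nf
  have h5 : u ^ 2 * Real.exp |-θ * u| ≤ 8 * Real.exp |u| := by
    rw [h4, ← mul_assoc]
    exact mul_le_mul h3 (Real.exp_le_exp.2 h2) (Real.exp_pos _).le (by positivity)
  have h6 := mul_le_mul_of_nonneg_left h5 (sq_nonneg θ)
  nlinarith

lemma integrable_exp_abs {U : Ω → ℝ} (hU : Measurable U)
    (h : ∫⁻ ω, ENNReal.ofReal (Real.exp |U ω|) ∂P ≤ 2) :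
    Integrable (fun ω => Real.exp |U ω|) P ∧ ∫ ω, Real.exp |U ω| ∂P ≤ 2 := by
  have h1 : Integrable (fun ω => Real.exp |U ω|) P := by
    refine ⟨hU.abs.exp.aestronglyMeasurable, ?_⟩
    rw [hasFiniteIntegral_iff_ofReal (Filter.Eventually.of_forall fun _ => (Real.exp_pos _).le)]
    exact lt_of_le_of_lt h (by simp)
  refine ⟨h1, ?_⟩
  rw [← ofReal_integral_eq_lintegral_ofReal h1
    (Filter.Eventually.of_forall fun _ => (Real.exp_pos _).le)] at h
  rw [← ENNReal.ofReal_le_ofReal_iff (by norm_num)]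
  simpa using h

lemma mgf_neg_le {U : Ω → ℝ} (hU : Measurable U)
    (h : ∫⁻ ω, ENNReal.ofReal (Real.exp |U ω|) ∂P ≤ 2) {θ : ℝ} (hθ0 : 0 ≤ θ) (hθ : θ ≤ 1 / 2) :
    Integrable (fun ω => Real.exp (-θ * U ω)) P ∧
      mgf U P (-θ) ≤ Real.exp (-θ * ∫ ω, U ω ∂P + 16 * θ ^ 2) := by
  obtain ⟨i1, e1⟩ := integrable_exp_abs hU h
  have i2 : Integrable U P := i1.mono' hU.aestronglyMeasurable
    (Filter.Eventually.of_forall fun ω => by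
      have := Real.add_one_le_exp |U ω|
      rw [Real.norm_eq_abs]; linarith)
  have i3 : Integrable (fun ω => Real.exp (-θ * U ω)) P := i1.mono'
    (hU.const_mul _).exp.aestronglyMeasurable (Filter.Eventually.of_forall fun ω => by
      rw [Real.norm_of_nonneg (Real.exp_pos _).le]
      refine Real.exp_le_exp.2 ((le_abs_self _).trans ?_)
      rw [abs_mul, abs_neg, abs_of_nonneg hθ0]
      nlinarith [abs_nonneg (U ω)])
  refine ⟨i3, ?_⟩
  have i4 : Integrable (fun ω => 1 - θ * U ω) P := (integrable_const 1).sub (i2.const_mul θ)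
  have h1 : ∫ ω, Real.exp (-θ * U ω) ∂P
      ≤ ∫ ω, (1 - θ * U ω) + 8 * θ ^ 2 * Real.exp |U ω| ∂P :=
    integral_mono i3 (i4.add (i1.const_mul _)) fun ω => exp_neg_mul_le hθ0 hθ (U ω)
  rw [integral_add i4 (i1.const_mul _), integral_sub (integrable_const 1) (i2.const_mul θ),
    integral_const_mul, integral_const_mul] at h1
  simp only [integral_const, probReal_univ, smul_eq_mul, mul_one] at h1
  rw [mgf]
  have h2 := Real.add_one_le_exp (-θ * ∫ ω, U ω ∂P + 16 * θ ^ 2)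
  have h3 := mul_le_mul_of_nonneg_left e1 (by positivity : 0 ≤ 8 * θ ^ 2)
  linarith

/-- A lower deviation bound for a sum of independent sub-exponential variables. -/
lemma measure_sum_le_le {n : ℕ} {U : Fin n → Ω → ℝ} (hU : ∀ i, Measurable (U i))
    (hind : iIndepFun U P) (h : ∀ i, ∫⁻ ω, ENNReal.ofReal (Real.exp |U i ω|) ∂P ≤ 2) {e d θ : ℝ}
    (he : ∀ i, e ≤ ∫ ω, U i ω ∂P) (hθ0 : 0 ≤ θ) (hθ : θ ≤ 1 / 2) :
    P {ω | ∑ i, U i ω ≤ n * (e - d)} ≤ ENNReal.ofReal (Real.exp (n * (16 * θ ^ 2 - θ * d))) := by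
  have i1 : Integrable (fun ω => Real.exp (-θ * (∑ i, U i) ω)) P :=
    hind.integrable_exp_mul_sum hU fun i _ => (mgf_neg_le (hU i) (h i) hθ0 hθ).1
  have h1 := measure_le_le_exp_mul_mgf (X := ∑ i, U i) (n * (e - d)) (neg_nonpos.2 hθ0) i1
  rw [hind.mgf_sum hU] at h1
  have h2 : ∏ i, mgf (U i) P (-θ) ≤ ∏ _i : Fin n, Real.exp (-θ * e + 16 * θ ^ 2) := by
    refine Finset.prod_le_prod (fun i _ => mgf_nonneg) fun i _ => ?_
    refine (mgf_neg_le (hU i) (h i) hθ0 hθ).2.trans (Real.exp_le_exp.2 ?_)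
    have := mul_le_mul_of_nonneg_left (he i) hθ0
    linarith
  rw [Finset.prod_const, Finset.card_univ, Fintype.card_fin, ← Real.exp_nat_mul] at h2
  have h3 : P.real {ω | (∑ i, U i) ω ≤ n * (e - d)} ≤ Real.exp (n * (16 * θ ^ 2 - θ * d)) := by
    refine h1.trans ((mul_le_mul_of_nonneg_left h2 (Real.exp_pos _).le).trans (le_of_eq ?_))
    rw [← Real.exp_add]; ring_nf
  have h4 : {ω | ∑ i, U i ω ≤ n * (e - d)} = {ω | (∑ i, U i) ω ≤ n * (e - d)} := by
    ext ω; simp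
  rw [h4]
  exact (ENNReal.le_ofReal_iff_toReal_le (measure_ne_top _ _) (Real.exp_pos _).le).2 h3

/-- An upper deviation bound for a sum of independent variables with exponential moments. -/
lemma measure_ge_sum_le {n : ℕ} {U : Fin n → Ω → ℝ} (hU : ∀ i, Measurable (U i))
    (hind : iIndepFun U P) (h : ∀ i, ∫⁻ ω, ENNReal.ofReal (Real.exp (U i ω)) ∂P ≤ 2) (c : ℝ) :
    P {ω | n * c ≤ ∑ i, U i ω} ≤ ENNReal.ofReal (Real.exp (n * (1 - c))) := by
  have hi : ∀ i, Integrable (fun ω => Real.exp (1 * U i ω)) P := fun i => by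
    simp only [one_mul]
    refine ⟨(hU i).exp.aestronglyMeasurable, ?_⟩
    rw [hasFiniteIntegral_iff_ofReal (Filter.Eventually.of_forall fun _ => (Real.exp_pos _).le)]
    exact lt_of_le_of_lt (h i) (by simp)
  have he : ∀ i, mgf (U i) P 1 ≤ Real.exp 1 := fun i => by
    have h0 := h i
    have hi' := hi i
    simp only [one_mul] at hi'
    rw [← ofReal_integral_eq_lintegral_ofReal hi'
      (Filter.Eventually.of_forall fun _ => (Real.exp_pos _).le)] at h0
    have h1 : ∫ ω, Real.exp (U i ω) ∂P ≤ 2 := by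
      rw [← ENNReal.ofReal_le_ofReal_iff (by norm_num)]
      simpa using h0
    simp only [mgf, one_mul]
    linarith [Real.exp_one_gt_d9]
  have h1 := measure_ge_le_exp_mul_mgf (X := ∑ i, U i) (n * c) zero_le_one
    (hind.integrable_exp_mul_sum hU fun i _ => hi i)
  rw [hind.mgf_sum hU] at h1
  have h2 : ∏ i, mgf (U i) P 1 ≤ ∏ _i : Fin n, Real.exp 1 :=
    Finset.prod_le_prod (fun i _ => mgf_nonneg) fun i _ => he i
  rw [Finset.prod_const, Finset.card_univ, Fintype.card_fin, ← Real.exp_nat_mul] at h2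
  have h3 : P.real {ω | n * c ≤ (∑ i, U i) ω} ≤ Real.exp (n * (1 - c)) := by
    refine h1.trans ((mul_le_mul_of_nonneg_left h2 (Real.exp_pos _).le).trans (le_of_eq ?_))
    rw [← Real.exp_add]; ring_nf
  have h4 : {ω | n * c ≤ ∑ i, U i ω} = {ω | n * c ≤ (∑ i, U i) ω} := by
    ext ω; simp
  rw [h4]
  exact (ENNReal.le_ofReal_iff_toReal_le (measure_ne_top _ _) (Real.exp_pos _).le).2 h3

end Concentration

/-! ### Grid nets for the reachable dictionaries -/

section Covering

/-- A bounded family of real vectors has a finite subfamily meeting every occupied grid cell. -/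
lemma exists_finset_grid_net {α ι : Type*} [Fintype ι] [DecidableEq ι] (A : Set α)
    (φ : α → ι → ℝ) {t : ℝ} (ht : 0 < t) (hφ : ∀ a ∈ A, ∀ i, |φ a i| ≤ t) {H : ℕ} (hH : 0 < H) :
    ∃ T : Finset α, (↑T ⊆ A) ∧ T.card ≤ (2 * H + 1) ^ Fintype.card ι ∧
      ∀ a ∈ A, ∃ b ∈ T, ∀ i, |φ a i - φ b i| ≤ t / H := by
  classical
  rcases A.eq_empty_or_nonempty with rfl | ⟨a₀, -⟩
  · exact ⟨∅, by simp⟩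
  have : Nonempty α := ⟨a₀⟩
  have hH' : (0 : ℝ) < H := by exact_mod_cast hH
  -- Cells of side t/H: the floor takes at most 2H + 1 values, from -H to H, and equal floors mean
  -- coordinates within t/H.
  set c : α → ι → ℤ := fun a i => ⌊φ a i * H / t⌋ with hc
  have hsub : c '' A ⊆ (Fintype.piFinset fun _ : ι => Finset.Icc (-H : ℤ) H : Finset (ι → ℤ)) := by
    rintro _ ⟨a, ha, rfl⟩
    rw [Finset.mem_coe, Fintype.mem_piFinset]
    intro i
    have h1 := abs_le.1 (hφ a ha i)
    rw [Finset.mem_Icc]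
    constructor
    · rw [Int.le_floor, le_div_iff₀ ht]
      push_cast
      nlinarith
    · have h2 : φ a i * H / t ≤ (H : ℤ) := by
        rw [div_le_iff₀ ht]; push_cast; nlinarith
      exact_mod_cast (Int.floor_le _).trans h2
  have hfin : (c '' A).Finite := (Finset.finite_toSet _).subset hsub
  choose! s hsA hs using fun (y : ι → ℤ) (hy : y ∈ c '' A) => hy
  refine ⟨hfin.toFinset.image s, ?_, ?_, ?_⟩
  · intro b hb
    obtain ⟨y, hy, rfl⟩ := Finset.mem_image.1 (Finset.mem_coe.1 hb)
    exact hsA y (hfin.mem_toFinset.1 hy)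
  · refine Finset.card_image_le.trans ?_
    have h1 : hfin.toFinset ⊆ Fintype.piFinset fun _ : ι => Finset.Icc (-H : ℤ) H :=
      fun y hy => hsub (hfin.mem_toFinset.1 hy)
    refine (Finset.card_le_card h1).trans (le_of_eq ?_)
    rw [Fintype.card_piFinset, Finset.prod_const, Int.card_Icc, Finset.card_univ]
    congr 1
    omega
  · intro a ha
    have hca : c a ∈ c '' A := Set.mem_image_of_mem c ha
    refine ⟨s (c a), Finset.mem_image_of_mem s (hfin.mem_toFinset.2 hca), fun i => ?_⟩
    have h1 : ⌊φ (s (c a)) i * H / t⌋ = ⌊φ a i * H / t⌋ := congrFun (hs (c a) hca) i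
    have h2 := Int.abs_sub_lt_one_of_floor_eq_floor h1
    have h3 : φ a i - φ (s (c a)) i
        = -(φ (s (c a)) i * H / t - φ a i * H / t) * (t / H) := by field_simp; ring
    rw [h3, abs_mul, abs_neg, abs_of_pos (div_pos ht hH')]
    exact mul_le_of_le_one_left (by positivity) h2.le

variable {m p k : ℕ} {D₀ : Matrix (Fin m) (Fin p) ℝ} {t : ℝ}

lemma euclNorm_le_card_mul (x : Fin m → ℝ) {c : ℝ} (hc : 0 ≤ c) (h : ∀ i, |x i| ≤ c) :
    euclNorm x ≤ m * c := by
  apply euclNorm_le_of_dot (by positivity)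
  rw [dot_self_eq_sum]
  calc ∑ i, x i ^ 2 ≤ ∑ _i : Fin m, c ^ 2 := Finset.sum_le_sum fun i _ => by
        rw [← sq_abs]; exact pow_le_pow_left₀ (abs_nonneg _) (h i) 2
    _ = m * c ^ 2 := by simp
    _ ≤ (m : ℝ) ^ 2 * c ^ 2 := by
        refine mul_le_mul_of_nonneg_right ?_ (sq_nonneg c)
        exact_mod_cast Nat.le_self_pow (by norm_num) m
    _ = _ := by ring

/-- A finite set of curves that approximates all dictionaries reached at time `t`. -/
lemma exists_finset_curve_net (hD : IsDictionary D₀) (hk : 1 ≤ k) (ht : 0 < t)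
    (hs : k * coherenceAt D₀ t < 1 / 2) (hm : 0 < m) {n : ℕ} (hn : 0 < n) :
    ∃ T : Finset (Matrix (Fin m) (Fin p) ℝ × (Fin p → ℝ)),
      (∀ q ∈ T, CurveData D₀ q.1 q.2 t k) ∧ T.card ≤ (2 * (40 * n * m) + 1) ^ (m * p) ∧
      ∀ W ∈ directions D₀, ∀ v ∈ unitSphere p, ∃ q ∈ T, ∀ j,
        euclNorm ((curve D₀ W v t - curve D₀ q.1 q.2 t)ᵀ j) ≤ t / (40 * n) := by
  -- The grid is on the mp entries of the displacement, not on (W, v), and its representatives are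
  -- themselves curves, so the pointwise bounds apply to them. Mesh t/(40nm) per entry gives t/(40n)
  -- per column.
  obtain ⟨T, hTA, hT, hnet⟩ := exists_finset_grid_net
    {q : Matrix (Fin m) (Fin p) ℝ × (Fin p → ℝ) | CurveData D₀ q.1 q.2 t k}
    (fun q (ij : Fin m × Fin p) => (curve D₀ q.1 q.2 t - D₀) ij.1 ij.2) ht
    (fun q hq ij => (abs_le_euclNorm ((curve D₀ q.1 q.2 t - D₀)ᵀ ij.2) ij.1).trans
      (CurveData.euclNorm_sub_col_le hq ij.2)) (H := 40 * n * m) (by positivity)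
  refine ⟨T, fun q hq => hTA hq, by simpa using hT, fun W hW v hv => ?_⟩
  obtain ⟨q, hq, h⟩ := hnet (W, v) ⟨hD, hW, hv, hk, ht, hs⟩
  refine ⟨q, hq, fun j => (euclNorm_le_card_mul (c := t / (40 * n * m : ℕ)) _ (by positivity)
    fun i => ?_).trans (le_of_eq ?_)⟩
  · have := h (i, j)
    simpa using this
  · have : (0 : ℝ) < m := by exact_mod_cast hm
    have : (0 : ℝ) < n := by exact_mod_cast hn
    push_cast
    field_simp

end Covering

/-! ### Uniform bound over all curves -/

section Uniform

variable {m p k n : ℕ} {D₀ W : Matrix (Fin m) (Fin p) ℝ} {v : Fin p → ℝ} {t σα αmin σ lam : ℝ}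
  {ν η : Measure ℝ}

namespace ModelData

/-- Uses mσ² ≤ λ²/9, kt < 1/6 and tσ_α ≤ λ/3. It compares the size of the costs with λ², as the
stability bound requires. -/
lemma scale_mul_le (M : ModelData D₀ k t σα αmin σ lam ν η) :
    costScale m k σα σ lam * t ^ 2 ≤ lam ^ 2 / 16 := by
  have hlam := M.lam_pos
  have ht := M.pos
  have ht6 := M.t_lt
  have hkt := mul_lt_of_small M.one_le M.small
  have h1 := pow_le_pow_left₀ (by positivity) M.three_mul_sqrt_le 2
  rw [mul_pow, Real.sq_sqrt M.tau_pos.le] at h1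
  have h2 : 9 * (m * σ ^ 2) ≤ lam ^ 2 := by
    have : 0 ≤ t ^ 2 * σα ^ 2 := by positivity
    linarith
  have h3 : m * σ ^ 2 * t ^ 2 ≤ lam ^ 2 / 9 * (1 / 36) := by
    have h4 : t ^ 2 ≤ 1 / 36 := by nlinarith
    exact mul_le_mul (by linarith) h4 (by positivity) (by positivity)
  have h4 : lam * k * σα * t ^ 2 ≤ lam ^ 2 / 18 := by
    calc lam * k * σα * t ^ 2 = lam * ((k * t) * (t * σα)) := by ring
      _ ≤ lam * (1 / 6 * (lam / 3)) := by
        refine mul_le_mul_of_nonneg_left ?_ hlam.le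
        exact mul_le_mul hkt.le (by linarith [M.three_mul_le])
          (mul_nonneg ht.le M.σα_pos.le) (by norm_num)
      _ = _ := by ring
  rw [costScale, add_mul]
  nlinarith [sq_nonneg lam]

/-- The cost is stable under small changes of the dictionary, as long as it is bounded. -/
lemma sum_lassoVal_le_of_col_close (M : ModelData D₀ k t σα αmin σ lam ν η) (hn : 0 < n)
    (x : Fin n → Fin m → ℝ) {D D' : Matrix (Fin m) (Fin p) ℝ}
    (hD : ∀ j, euclNorm ((D - D')ᵀ j) ≤ t / (40 * n))
    (hF : ∑ i, lassoVal lam (x i) D' ≤ n * (200 * costScale m k σα σ lam)) :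
    ∑ i, lassoVal lam (x i) D'
      ≤ ∑ i, lassoVal lam (x i) D + n * (50 * costScale m k σα σ lam * (1 / √n)) := by
  set S := costScale m k σα σ lam with hSdef
  have hS : 0 < S := M.scale_pos
  have hlam := M.lam_pos
  have ht := M.pos
  have hn0 : (0 : ℝ) < n := by exact_mod_cast hn
  have hsn : 0 < √(n : ℝ) := Real.sqrt_pos.2 hn0
  -- Only a lower bound at D is wanted. If the cost at D is below that at the net point D', it
  -- inherits the bound `hF`; so costs need control on the net only.
  rcases le_or_gt (∑ i, lassoVal lam (x i) D') (∑ i, lassoVal lam (x i) D) with hle | hlt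
  · have : 0 ≤ n * (50 * S * (1 / √n)) := by positivity
    linarith
  set δ := t / (40 * n) with hδ
  have hδ0 : 0 ≤ δ := by positivity
  -- Each Lasso value changes by a relative error of at most 2κ, and 200·2κ = 50/√n.
  set κ := 1 / (8 * √n) with hκ
  have hκ0 : 0 < κ := by positivity
  have hκ2 : κ ^ 2 = 1 / (64 * n) := by
    rw [hκ, div_pow, mul_pow, Real.sq_sqrt hn0.le]; norm_num
  have hκ1 : κ ≤ 1 / 8 := by
    rw [hκ]
    apply one_div_le_one_div_of_le (by norm_num)
    have : 1 ≤ √(n : ℝ) := Real.one_le_sqrt.2 (by exact_mod_cast hn)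
    linarith
  have hnn : ∀ i, 0 ≤ lassoVal lam (x i) D := fun i => lassoVal_nonneg hlam.le _ _
  have hterm : ∀ i, lassoVal lam (x i) D' ≤ lassoVal lam (x i) D * (1 + 2 * κ) := by
    intro i
    refine (lassoVal_le_of_col_close hlam hδ0 hD (x i)).trans
      (mul_le_mul_of_nonneg_left ?_ (hnn i))
    set L := lassoVal lam (x i) D with hL
    have hL0 : 0 ≤ L := hnn i
    have hL1 : L ≤ n * (200 * S) :=
      (Finset.single_le_sum (f := fun i => lassoVal lam (x i) D) (fun i _ => hnn i)
        (Finset.mem_univ i)).trans (hlt.le.trans hF)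
    have h1 : δ ^ 2 * (2 * L) ≤ κ ^ 2 * lam ^ 2 := by
      calc δ ^ 2 * (2 * L) ≤ δ ^ 2 * (2 * (n * (200 * S))) := by gcongr
        _ = S * t ^ 2 * (1 / (4 * n)) := by rw [hδ]; field_simp; ring
        _ ≤ lam ^ 2 / 16 * (1 / (4 * n)) := by
            gcongr; exact M.scale_mul_le
        _ = κ ^ 2 * lam ^ 2 := by rw [hκ2]; field_simp; ring
    have h2 : δ * √(2 * L) / lam ≤ κ := by
      rw [div_le_iff₀ hlam]
      apply le_of_sq_le_sq _ (by positivity)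
      rw [mul_pow, Real.sq_sqrt (by positivity), mul_pow]
      exact h1
    have h3 : δ ^ 2 * L / (2 * lam ^ 2) ≤ κ := by
      rw [div_le_iff₀ (by positivity)]
      have h4 : κ ^ 2 * lam ^ 2 ≤ κ * lam ^ 2 :=
        mul_le_mul_of_nonneg_right (by nlinarith) (sq_nonneg lam)
      nlinarith [mul_nonneg hκ0.le (sq_nonneg lam), mul_nonneg (sq_nonneg δ) hL0]
    linarith
  calc ∑ i, lassoVal lam (x i) D' ≤ ∑ i, lassoVal lam (x i) D * (1 + 2 * κ) :=
        Finset.sum_le_sum fun i _ => hterm i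
    _ = ∑ i, lassoVal lam (x i) D + (∑ i, lassoVal lam (x i) D) * (2 * κ) := by
        rw [← Finset.sum_mul]; ring
    _ ≤ ∑ i, lassoVal lam (x i) D + (n * (200 * S)) * (2 * κ) := by
        gcongr; exact hlt.le.trans hF
    _ = _ := by rw [hκ]; field_simp; ring

variable [IsProbabilityMeasure ν] [IsProbabilityMeasure η]
variable {Ω : Type*} [MeasurableSpace Ω] {P : Measure Ω} [IsProbabilityMeasure P]

lemma measure_sum_increment_le (M : ModelData D₀ k t σα αmin σ lam ν η)
    (h : CurveData D₀ W v t k) {π : PMF (Finset (Fin p))} (hπ : IsSupportLaw π k)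
    {X : Fin n → Ω → Fin m → ℝ} (hX : ∀ i, Measurable (X i)) (hind : iIndepFun X P)
    (hlaw : ∀ i, P.map (X i) = signalLaw D₀ π ν η) {r E : ℝ} (hr0 : 0 ≤ r) (hr : r ≤ 1)
    (hE : E ≤ ∫ x, lassoVal lam x (curve D₀ W v t) - lassoVal lam x D₀ ∂(signalLaw D₀ π ν η)) :
    P {ω | ∑ i, (lassoVal lam (X i ω) (curve D₀ W v t) - lassoVal lam (X i ω) D₀)
        ≤ n * (E - 400 * costScale m k σα σ lam * r)}
      ≤ ENNReal.ofReal (Real.exp (-21 * (n * r ^ 2))) := by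
  set S := costScale m k σα σ lam with hSdef
  have hS : 0 < S := M.scale_pos
  set g : (Fin m → ℝ) → ℝ := fun x =>
    (lassoVal lam x (curve D₀ W v t) - lassoVal lam x D₀) / (8 * S) with hg
  have hgm : Measurable g := ((measurable_lassoVal M.lam_pos.le _).sub
    (measurable_lassoVal M.lam_pos.le _)).div_const _
  -- θ = r/2 and d = 50r give 16θ² - θd = -21r²; undoing the division by 8S turns d into 400Sr.
  have h1 := measure_sum_le_le (P := P) (U := fun i ω => g (X i ω)) (e := E / (8 * S))
    (d := 50 * r) (θ := r / 2) (fun i => hgm.comp (hX i)) (hind.comp (fun _ => g) fun _ => hgm)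
    (fun i => by
      rw [← lintegral_map (f := fun x => ENNReal.ofReal (Real.exp |g x|))
        hgm.abs.exp.ennreal_ofReal (hX i), hlaw i]
      exact M.lintegral_exp_abs_increment_le h hπ)
    (fun i => by
      rw [← integral_map (f := g) (hX i).aemeasurable hgm.aestronglyMeasurable, hlaw i, hg,
        integral_div]
      gcongr)
    (by linarith) (by linarith)
  refine le_trans (measure_mono fun ω hω => ?_) (h1.trans (le_of_eq ?_))
  · change ∑ i, (lassoVal lam (X i ω) (curve D₀ W v t) - lassoVal lam (X i ω) D₀) / (8 * S) ≤ _
    rw [← Finset.sum_div, div_le_iff₀ (by positivity)]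
    refine le_trans hω (le_of_eq ?_)
    field_simp
    ring
  · congr 2; ring

lemma measure_sum_lassoVal_ge (M : ModelData D₀ k t σα αmin σ lam ν η)
    (h : CurveData D₀ W v t k) {π : PMF (Finset (Fin p))} (hπ : IsSupportLaw π k)
    {X : Fin n → Ω → Fin m → ℝ} (hX : ∀ i, Measurable (X i)) (hind : iIndepFun X P)
    (hlaw : ∀ i, P.map (X i) = signalLaw D₀ π ν η) :
    P {ω | n * (200 * costScale m k σα σ lam) ≤ ∑ i, lassoVal lam (X i ω) (curve D₀ W v t)}
      ≤ ENNReal.ofReal (Real.exp (-24 * n)) := by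
  set S := costScale m k σα σ lam with hSdef
  have hS : 0 < S := M.scale_pos
  set g : (Fin m → ℝ) → ℝ := fun x => lassoVal lam x (curve D₀ W v t) / (8 * S) with hg
  have hgm : Measurable g := (measurable_lassoVal M.lam_pos.le _).div_const _
  -- The level 25 corresponds to 200S = 25·8S and leaves the exponent 1 - 25 = -24.
  have h1 := measure_ge_sum_le (P := P) (U := fun i ω => g (X i ω))
    (fun i => hgm.comp (hX i)) (hind.comp (fun _ => g) fun _ => hgm)
    (fun i => by
      rw [← lintegral_map (f := fun x => ENNReal.ofReal (Real.exp (g x)))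
        hgm.exp.ennreal_ofReal (hX i), hlaw i]
      exact M.lintegral_exp_lassoVal_le h hπ) 25
  refine le_trans (measure_mono fun ω hω => ?_) (h1.trans (le_of_eq ?_))
  · change _ ≤ ∑ i, lassoVal lam (X i ω) (curve D₀ W v t) / (8 * S)
    rw [← Finset.sum_div, le_div_iff₀ (by positivity)]
    refine le_trans (le_of_eq ?_) hω
    ring
  · congr 2; ring

/-- A uniform lower bound on the empirical increment, off an event of small probability. -/
lemma exists_event_forall_le_deltaF (M : ModelData D₀ k t σα αmin σ lam ν η)
    {π : PMF (Finset (Fin p))} (hπ : IsSupportLaw π k) (hm : 0 < m) (hn : 0 < n)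
    {X : Fin n → Ω → Fin m → ℝ} (hX : ∀ i, Measurable (X i)) (hind : iIndepFun X P)
    (hlaw : ∀ i, P.map (X i) = signalLaw D₀ π ν η) {r E : ℝ} (hr0 : 0 ≤ r) (hr : r ≤ 1)
    (hE : ∀ W v, CurveData D₀ W v t k →
      E ≤ ∫ x, lassoVal lam x (curve D₀ W v t) - lassoVal lam x D₀ ∂(signalLaw D₀ π ν η)) :
    ∃ B : Set Ω, P B ≤ (((2 * (40 * n * m) + 1) ^ (m * p) : ℕ) : ENNReal)
        * (ENNReal.ofReal (Real.exp (-21 * (n * r ^ 2))) + ENNReal.ofReal (Real.exp (-24 * n))) ∧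
      ∀ ω, ω ∉ B → ∀ W ∈ directions D₀, ∀ v ∈ unitSphere p,
        E - 400 * costScale m k σα σ lam * r - 50 * costScale m k σα σ lam * (1 / √n)
          ≤ deltaF lam (fun i => X i ω) D₀ W v t := by
  set S := costScale m k σα σ lam with hSdef
  have hn0 : (0 : ℝ) < n := by exact_mod_cast hn
  obtain ⟨T, hT, hcard, hnet⟩ := exists_finset_curve_net M.dict M.one_le M.pos M.small hm hn
  refine ⟨⋃ q ∈ T, ({ω | ∑ i, (lassoVal lam (X i ω) (curve D₀ q.1 q.2 t)
      - lassoVal lam (X i ω) D₀) ≤ n * (E - 400 * S * r)}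
    ∪ {ω | n * (200 * S) ≤ ∑ i, lassoVal lam (X i ω) (curve D₀ q.1 q.2 t)}), ?_, ?_⟩
  · refine (measure_biUnion_finset_le _ _).trans ?_
    refine (Finset.sum_le_card_nsmul _ _ _ fun q hq => (measure_union_le _ _).trans
      (add_le_add (M.measure_sum_increment_le (hT q hq) hπ hX hind hlaw hr0 hr
        (hE _ _ (hT q hq))) (M.measure_sum_lassoVal_ge (hT q hq) hπ hX hind hlaw))).trans ?_
    rw [nsmul_eq_mul]
    gcongr
  · intro ω hω W hW v hv
    obtain ⟨q, hq, hclose⟩ := hnet W hW v hv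
    simp only [Set.mem_iUnion, not_exists, Set.mem_union, Set.mem_ofPred_eq, not_or,
      not_le] at hω
    obtain ⟨h1, h2⟩ := hω q hq
    have h3 := M.sum_lassoVal_le_of_col_close hn (fun i => X i ω) hclose h2.le
    rw [Finset.sum_sub_distrib] at h1
    rw [deltaF, costF, costF, ← mul_sub, one_div_mul_eq_div, le_div_iff₀ hn0]
    linarith

end ModelData

end Uniform

/-! ### Numerical constants and conclusion -/

section Final

lemma half_lt_log {n : ℕ} (hn : 2 ≤ n) : 69 / 100 < Real.log n := by
  have h1 : Real.log 2 ≤ Real.log n := Real.log_le_log (by norm_num) (by exact_mod_cast hn)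
  linarith [Real.log_two_gt_d9]

/-- The cardinality of the net is absorbed by the deviation probabilities. -/
lemma card_mul_exp_le {m p n : ℕ} (hm : 0 < m) (hp : 0 < p) (hn : 2 ≤ n)
    (hmp : (m * p : ℝ) ≤ n / Real.log n) :
    (((2 * (40 * n * m) + 1) ^ (m * p) : ℕ) : ℝ)
        * (Real.exp (-21 * (m * p * Real.log n)) + Real.exp (-24 * n))
      ≤ ((m * p * n : ℝ) / 9) ^ (-(m * p : ℝ) / 2) := by
  set L := Real.log n with hL
  have hL0 : 69 / 100 < L := half_lt_log hn
  have hn2 : (2 : ℝ) ≤ n := by exact_mod_cast hn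
  have hn0 : (0 : ℝ) < n := by linarith
  have hm1 : (1 : ℝ) ≤ m := by exact_mod_cast hm
  have hp1 : (1 : ℝ) ≤ p := by exact_mod_cast hp
  rw [le_div_iff₀ (by linarith)] at hmp
  set q : ℝ := m * p with hq
  have hq1 : 1 ≤ q := by nlinarith
  have hmq : (m : ℝ) ≤ q := by nlinarith
  have hq2 : q ≤ 3 / 2 * n := by nlinarith
  have hnexp : (n : ℝ) = Real.exp L := (Real.exp_log hn0).symm
  -- From mp·log n ≤ n and log n > 0.69 follows m ≤ mp ≤ 3n/2, so 80nm + 1 ≤ 128n² ≤ n⁹ because 2⁷ ≤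
  -- n⁷.
  have hbase : ((2 * (40 * n * m) + 1 : ℕ) : ℝ) ≤ Real.exp (9 * L) := by
    have h1 : Real.exp (9 * L) = (n : ℝ) ^ 9 := by
      rw [hnexp, ← Real.exp_nat_mul]; norm_num
    rw [h1]
    push_cast
    have h2 : 128 * (n : ℝ) ^ 2 ≤ (n : ℝ) ^ 9 := by
      have : (2 : ℝ) ^ 7 ≤ (n : ℝ) ^ 7 := pow_le_pow_left₀ (by norm_num) hn2 7
      have h3 := mul_le_mul_of_nonneg_right this (sq_nonneg (n : ℝ))
      linarith
    nlinarith [mul_le_mul_of_nonneg_left (hmq.trans hq2) hn0.le]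
  have hcard : (((2 * (40 * n * m) + 1) ^ (m * p) : ℕ) : ℝ) ≤ Real.exp (9 * (q * L)) := by
    rw [Nat.cast_pow]
    refine (pow_le_pow_left₀ (by positivity) hbase (m * p)).trans (le_of_eq ?_)
    rw [← Real.exp_nat_mul, hq]
    push_cast
    ring_nf
  have hsum : Real.exp (-21 * (q * L)) + Real.exp (-24 * n) ≤ 2 * Real.exp (-21 * (q * L)) := by
    have : Real.exp (-24 * n) ≤ Real.exp (-21 * (q * L)) := Real.exp_le_exp.2 (by linarith)
    linarith
  have htwo : (2 : ℝ) ≤ Real.exp (2 * (q * L)) := by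
    have := Real.add_one_le_exp (2 * (q * L))
    nlinarith
  have hlow : Real.exp (-(q * L)) ≤ ((q * n : ℝ) / 9) ^ (-q / 2) := by
    rw [Real.rpow_def_of_pos (by positivity)]
    refine Real.exp_le_exp.2 ?_
    have h1 : Real.log (q * n / 9) ≤ 2 * L := by
      have h2 : 2 * L = Real.log ((n : ℝ) ^ 2) := by rw [Real.log_pow, hL]; norm_num
      rw [h2]
      refine Real.log_le_log (by positivity) ?_
      nlinarith
    nlinarith
  -- The exponents 9, 2 and -21 add up to -10, while -1 would do.
  calc _ ≤ Real.exp (9 * (q * L)) * (2 * Real.exp (-21 * (q * L))) := by gcongr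
    _ ≤ Real.exp (9 * (q * L)) * (Real.exp (2 * (q * L)) * Real.exp (-21 * (q * L))) := by gcongr
    _ = Real.exp (-10 * (q * L)) := by
        rw [← Real.exp_add, ← Real.exp_add]; ring_nf
    _ ≤ Real.exp (-(q * L)) := Real.exp_le_exp.2 (by nlinarith)
    _ ≤ _ := hlow

variable {m p k n : ℕ} {D₀ W : Matrix (Fin m) (Fin p) ℝ} {v : Fin p → ℝ} {t σα αmin σ lam : ℝ}
  {ν η : Measure ℝ}

lemma IsDictionary.pos_of_col {D : Matrix (Fin m) (Fin p) ℝ} (h : IsDictionary D) (j : Fin p) :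
    0 < m := by
  rcases Nat.eq_zero_or_pos m with rfl | hm
  · have := h j
    simp [sqNorm] at this
  · exact hm

/-- Parameter 0 would force α = 0 almost surely, against |α| ≥ α_min. -/
lemma IsSubGaussian.pos_of_bound [IsProbabilityMeasure ν] (h : IsSubGaussian ν σα)
    (hαmin : 0 < αmin) (hb : ∀ᵐ a ∂ν, αmin ≤ |a|) : 0 < σα := by
  refine lt_of_le_of_ne h.1 fun h0 => ?_
  have h1 := h.2
  have h2 : (⟨σα ^ 2, sq_nonneg σα⟩ : NNReal) = 0 := by
    ext; simp [← h0]
  rw [h2] at h1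
  have h3 : ∀ᵐ a ∂ν, False := by
    filter_upwards [h1.ae_eq_zero_of_hasSubgaussianMGF_zero, hb] with a h4 h5
    have h6 : a = 0 := h4
    rw [h6, abs_zero] at h5
    linarith
  exact h3.exists.elim fun _ hf => hf

/-- A nonempty range of regularization parameters exists for small noise. -/
lemma exists_admissible (hσα : 0 < σα) (hαmin : 0 < αmin)
    (hs : k * coherenceAt D₀ t < 1 / 2)
    (ht2 : 3 * t / (2 - constQ D₀ k t ^ 2) < 4 * αmin / (9 * σα)) (ht : 0 < t) :
    ∃ σ₀ > 0, ∀ σ : ℝ, 0 ≤ σ → σ ≤ σ₀ →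
      ∃ lam > 0, Admissible D₀ k t σα αmin σ lam := by
  have hq : 0 < 2 - constQ D₀ k t ^ 2 := by linarith [constQ_sq_lt_two hs]
  set f : ℝ → ℝ := fun σ => 3 / (2 - constQ D₀ k t ^ 2) * √(t ^ 2 * σα ^ 2 + m * σ ^ 2) with hf
  have hcont : Continuous f := by fun_prop
  have h0 : f 0 < 4 / 9 * αmin := by
    have h1 : √(t ^ 2 * σα ^ 2 + m * 0 ^ 2) = t * σα := by
      rw [← Real.sqrt_sq (mul_pos ht hσα).le]; congr 1; ring
    rw [hf]
    simp only [h1]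
    rw [lt_div_iff₀ (by positivity)] at ht2
    calc 3 / (2 - constQ D₀ k t ^ 2) * (t * σα)
        = 3 * t / (2 - constQ D₀ k t ^ 2) * (9 * σα) / 9 := by ring
      _ < 4 * αmin / 9 := by gcongr
      _ = _ := by ring
  -- The strict inequality at σ = 0 persists by continuity, and then λ = (4/9)α_min is admissible.
  obtain ⟨ε, hε, hball⟩ := Metric.eventually_nhds_iff.1
    (hcont.continuousAt.eventually_lt continuousAt_const h0)
  refine ⟨ε / 2, by positivity, fun σ h1 h2 => ⟨4 / 9 * αmin, by positivity, ?_, le_rfl⟩⟩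
  refine (hball ?_).le
  rw [Real.dist_eq, sub_zero, abs_of_nonneg h1]
  linarith

lemma Admissible.sqrt_two_mul_log_two_le (ht : 0 < t) (hσα : 0 < σα)
    (hs : k * coherenceAt D₀ t < 1 / 2) (h : Admissible D₀ k t σα αmin σ lam) :
    √(2 * Real.log 2) ≤ constGamma D₀ k t σα σ lam := by
  have hq : 0 < 2 - constQ D₀ k t ^ 2 := by linarith [constQ_sq_lt_two hs]
  have hτ : 0 < √(t ^ 2 * σα ^ 2 + m * σ ^ 2) := Real.sqrt_pos.2 (by positivity)
  have h1 := h.1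
  rw [div_mul_eq_mul_div, div_le_iff₀ hq] at h1
  -- Squared, this is 10 log 2 ≤ 9; the 3 is the factor in the admissibility condition.
  have h5 : √(2 * Real.log 2) * √5 ≤ 3 := by
    rw [← Real.sqrt_mul (by positivity), Real.sqrt_le_left (by norm_num)]
    linarith [Real.log_two_lt_d9]
  rw [constGamma, le_div_iff₀ (by positivity), ← mul_assoc]
  exact (mul_le_mul_of_nonneg_right h5 hτ.le).trans h1

namespace ModelData

/-- As γ² ≥ 9/5 > 1, the factor γ² can be inserted at no cost. -/
lemma scale_mul_exp_le (M : ModelData D₀ k t σα αmin σ lam ν η) :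
    26 * costScale m k σα σ lam * Real.exp (-constGamma D₀ k t σα σ lam ^ 2)
      ≤ constA m k t σα σ lam * constGamma D₀ k t σα σ lam ^ 2
        * Real.exp (-constGamma D₀ k t σα σ lam ^ 2) := by
  have hS := M.scale_pos
  refine mul_le_mul_of_nonneg_right ?_ (Real.exp_pos _).le
  have h1 : 26 * costScale m k σα σ lam ≤ constA m k t σα σ lam := by
    have h2 : constA m k t σα σ lam
        = 367 * (t ^ 2 * σα ^ 2) + 734 * costScale m k σα σ lam := by
      rw [constA, costScale]; ring
    have : 0 ≤ t ^ 2 * σα ^ 2 := by positivity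
    linarith
  have h3 := M.gamma_sq_ge
  nlinarith

lemma scale_mul_le_constB (M : ModelData D₀ k t σα αmin σ lam ν η) :
    6090 * costScale m k σα σ lam ≤ constB m k t σα σ lam := by
  have h2 : constB m k t σα σ lam
      = 3045 * (k * σα ^ 2 * t) + 6090 * costScale m k σα σ lam := by
    rw [constB, costScale]; ring
  have := M.pos
  have : 0 ≤ k * σα ^ 2 * t := by positivity
  linarith

variable [IsProbabilityMeasure ν] [IsProbabilityMeasure η]
variable {Ω : Type*} [MeasurableSpace Ω] {P : Measure Ω} [IsProbabilityMeasure P]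

/-- The increment of the empirical cost is bounded below uniformly over all curves, with high
probability. -/
theorem measure_not_le_iInf_deltaF_le (M : ModelData D₀ k t σα αmin σ lam ν η)
    {π : PMF (Finset (Fin p))} (hπ : IsSupportLaw π k) (hn : 2 ≤ n)
    (hmp : (m * p : ℝ) ≤ n / Real.log n)
    {X : Fin n → Ω → Fin m → ℝ} (hX : ∀ i, Measurable (X i)) (hind : iIndepFun X P)
    (hlaw : ∀ i, P.map (X i) = signalLaw D₀ π ν η) :
    P {ω | ¬ ((((1 - constK D₀ k t ^ 2) * ((∫ a, a ^ 2 ∂ν) / 2) * (k / p) * t ^ 2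
        - constQ D₀ k t ^ 2 * (16 / 9 * constQ D₀ k t ^ 2 + 3) * (∫ a, |a| ∂ν) * t * (k / p)
          * opNorm D₀ * (k * coherenceAt D₀ t) * lam
        - constA m k t σα σ lam * constGamma D₀ k t σα σ lam ^ 2
          * Real.exp (-constGamma D₀ k t σα σ lam ^ 2)
        - constB m k t σα σ lam * √(m * p * (Real.log n / n)) : ℝ) : EReal)
        ≤ ⨅ W ∈ directions D₀, ⨅ v ∈ unitSphere p,
          ((deltaF lam (fun i => X i ω) D₀ W v t : ℝ) : EReal))}
      ≤ ENNReal.ofReal (((m * p * n : ℝ) / 9) ^ (-(m * p : ℝ) / 2)) := by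
  have hp : 0 < p := M.one_le.trans hπ.le
  have hm : 0 < m := M.dict.pos_of_col ⟨0, hp⟩
  have hS := M.scale_pos
  have hL := half_lt_log hn
  have hn0 : (0 : ℝ) < n := by
    have : (2 : ℝ) ≤ n := by exact_mod_cast hn
    linarith
  have hq1 : (1 : ℝ) ≤ m * p := by exact_mod_cast Nat.mul_pos hm hp
  set r := √(m * p * (Real.log n / n)) with hr
  have hr2 : n * r ^ 2 = m * p * Real.log n := by
    rw [hr, Real.sq_sqrt (by positivity)]; field_simp
  have hr1 : r ≤ 1 := by
    rw [hr, Real.sqrt_le_one, ← mul_div_assoc, div_le_one hn0]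
    rwa [le_div_iff₀ (by linarith)] at hmp
  -- The net error 50S/√n becomes at most 100Sr; with the deviation 400Sr the total 500Sr stays
  -- below the 6090Sr available in `constB`.
  have hrn : 1 / √n ≤ 2 * r := by
    rw [one_div, ← Real.sqrt_inv]
    have h1 : √((n : ℝ)⁻¹) ≤ √(2 ^ 2 * (m * p * (Real.log n / n))) := by
      apply Real.sqrt_le_sqrt
      rw [inv_eq_one_div, mul_div_assoc', mul_div_assoc', div_le_div_iff_of_pos_right hn0]
      nlinarith
    rwa [Real.sqrt_mul (by norm_num), Real.sqrt_sq (by norm_num)] at h1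
  obtain ⟨B, hB, hgood⟩ := M.exists_event_forall_le_deltaF hπ hm (by omega) hX hind hlaw
    (Real.sqrt_nonneg _) hr1 fun W v h => M.le_integral_signalLaw h hπ
  refine (measure_mono (t := B) fun ω hω => ?_).trans (hB.trans ?_)
  · by_contra hωB
    -- In `EReal` an empty family of directions, as for m = 1, has infimum ⊤ and causes no
    -- exception.
    refine hω (le_iInf₂ fun W hW => le_iInf₂ fun v hv => EReal.coe_le_coe_iff.2 ?_)
    refine le_trans ?_ (hgood ω hωB W hW v hv)
    have h1 := M.scale_mul_exp_le
    have h2 := mul_le_mul_of_nonneg_right M.scale_mul_le_constB (Real.sqrt_nonneg _ : 0 ≤ r)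
    have h3 := mul_le_mul_of_nonneg_left hrn hS.le
    have h4 := mul_nonneg hS.le (Real.sqrt_nonneg _ : 0 ≤ r)
    linarith
  · rw [hr2, ← ENNReal.ofReal_add (Real.exp_pos _).le (Real.exp_pos _).le,
      ← ENNReal.ofReal_natCast, ← ENNReal.ofReal_mul (Nat.cast_nonneg _)]
    exact ENNReal.ofReal_le_ofReal (card_mul_exp_le hm hp hn hmp)

end ModelData

end Final

end SparseCoding

theorem mainTheorem3 {m p k : ℕ} (hk : 1 ≤ k)
    (D₀ : Matrix (Fin m) (Fin p) ℝ) (hD₀ : SparseCoding.IsDictionary D₀)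
    (hμ₀ : SparseCoding.coherence D₀ < 1 / 2)
    (t : ℝ) (ht : 0 < t)
    (ν : MeasureTheory.Measure ℝ) [MeasureTheory.IsProbabilityMeasure ν]
    (σα αmin : ℝ)
    (hσα : IsLeast {c : ℝ | SparseCoding.IsSubGaussian ν c} σα)
    (hαmin : 0 < αmin) (hbound : ν {a : ℝ | |a| < αmin} = 0)
    (hsign : 2 ≤ k → ∫ a, Real.sign a ∂ν = 0)
    (hkt : k * SparseCoding.coherenceAt D₀ t < 1 / 2)
    (ht2 : 3 * t / (2 - SparseCoding.constQ D₀ k t ^ 2) < 4 * αmin / (9 * σα)) :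
    (∃ σ₀ > 0, ∀ σ : ℝ, 0 ≤ σ → σ ≤ σ₀ →
      ∃ lam > 0, SparseCoding.Admissible D₀ k t σα αmin σ lam) ∧
    ∀ σ lam : ℝ, 0 ≤ σ → SparseCoding.Admissible D₀ k t σα αmin σ lam →
      √(2 * Real.log 2) ≤ SparseCoding.constGamma D₀ k t σα σ lam ∧
      ∀ (π : PMF (Finset (Fin p))), SparseCoding.IsSupportLaw π k →
      ∀ (η : MeasureTheory.Measure ℝ), MeasureTheory.IsProbabilityMeasure η →
        SparseCoding.IsSubGaussian η σ →
      ∀ n : ℕ, 2 ≤ n → (m * p : ℝ) ≤ n / Real.log n →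
      ∀ (Ω : Type*) [MeasurableSpace Ω] (P : MeasureTheory.Measure Ω)
        [MeasureTheory.IsProbabilityMeasure P] (X : Fin n → Ω → Fin m → ℝ),
        (∀ i, Measurable (X i)) →
        ProbabilityTheory.iIndepFun X P →
        (∀ i, P.map (X i) = SparseCoding.signalLaw D₀ π ν η) →
        P {ω | ¬ (
            (((1 - SparseCoding.constK D₀ k t ^ 2) * ((∫ a, a ^ 2 ∂ν) / 2) * (k / p) * t ^ 2
              - SparseCoding.constQ D₀ k t ^ 2 * (16 / 9 * SparseCoding.constQ D₀ k t ^ 2 + 3)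
                * (∫ a, |a| ∂ν) * t * (k / p) * SparseCoding.opNorm D₀
                * (k * SparseCoding.coherenceAt D₀ t) * lam
              - SparseCoding.constA m k t σα σ lam
                * SparseCoding.constGamma D₀ k t σα σ lam ^ 2
                * Real.exp (-SparseCoding.constGamma D₀ k t σα σ lam ^ 2)
              - SparseCoding.constB m k t σα σ lam
                * √(m * p * (Real.log n / n)) : ℝ) : EReal)
            ≤ ⨅ W ∈ SparseCoding.directions D₀, ⨅ v ∈ SparseCoding.unitSphere p,
                ((SparseCoding.deltaF lam (fun i => X i ω) D₀ W v t : ℝ) : EReal))}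
          ≤ ENNReal.ofReal
              (((m * p * n : ℝ) / 9) ^ (-(m * p : ℝ) / 2)
                + Real.exp (-4 * n * Real.exp (-SparseCoding.constGamma D₀ k t σα σ lam ^ 2))) := by
  have hb : ∀ᵐ a ∂ν, αmin ≤ |a| := by
    rw [MeasureTheory.ae_iff]
    simpa only [not_le] using hbound
  have hσα0 : 0 < σα := hσα.1.pos_of_bound hαmin hb
  refine ⟨SparseCoding.exists_admissible hσα0 hαmin hkt ht2 ht, fun σ lam _ hadm =>
    ⟨hadm.sqrt_two_mul_log_two_le ht hσα0 hkt, ?_⟩⟩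
  intro π hπ η hη hηsub n hn hmp Ω _ P _ X hX hind hlaw
  have M : SparseCoding.ModelData D₀ k t σα αmin σ lam ν η :=
    ⟨hD₀, hk, ht, hkt, hσα.1.2, hηsub.2, hσα0, hαmin, hb, hsign, hadm⟩
  refine (M.measure_not_le_iInf_deltaF_le hπ hn hmp hX hind hlaw).trans
    (ENNReal.ofReal_le_ofReal ?_)
  -- The failure of sign recovery was charged to the expectation, so the net term alone bounds the
  -- probability and the second exponential is merely added.
  exact le_add_of_nonneg_right (Real.exp_pos _).le
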